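/- Definitions. A finite connected graph of diameter $d$ is distance-regular with intersection array $\{b_0,\dots,b_{d-1};c_1,\dots,c_d\}$ if, for any vertices $u,w$ at distance $i$, the number of neighbours of $w$ at distance $j$ from $u$ depends only on $i$ and $j$, and is $b_i$ for $j=i+1$ and $c_i$ for $j=i-1$. For a permutation group $H$ on a finite set $\Omega$, the orbitals are the orbits of $H$ on $\Omega\times\Omega$, the rank is their number, and the suborbits at $v\in\Omega$ are the orbits of the stabilizer $H_v$ on $\Omega$. A graph on $\Omega$ is a union of orbitals if its set of ordered adjacent pairs is one. Let $\mathcal G\le\mathbb F_3^{11}$ be the ternary Golay code spanned by the $11$ cyclic shifts of $(-+-+++---+-)$, with coordinates indexed by $\mathbb Z/11$ and standard basis $e_0,\dots,e_{10}$, and let $\Gamma$ be its coset graph (vertices: the $243$ cosets of $\mathcal G$; two distinct cosets are adjacent if they contain words at Hamming distance $1$). * $\Delta$ (the Koolen–Riebeek graph) is the incidence graph of the cosets of $\mathcal G$ versus the translates of the set $D$ formed by the $45$ cosets of the words $-e_m$, $\ e_0-e_{2m}$, $\ -e_0+e_{2m}$, $\ e_m-e_{2m}$, $\ e_m+e_{6m}$,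 $\ e_m-e_{8m}$, $\ e_m+e_{10m}$, $\ e_{2m}+e_{7m}$, $\ -e_{2m}-e_{6m}$, for $m\in\{1,3,4,5,9\}$ (indices modulo $11$). * $\Sigma$ is the incidence graph of the points of $\mathrm{AG}(5,3)$ versus the $4$-flats not lying in a parallel class that contains a flat through both $p$ and $q$, where $p\neq q$ are two arbitrary points. * $\Upsilon$ (the second Soicher graph, by a theorem of Brouwer the unique distance-regular graph with intersection array $\{56,45,16,1;1,8,45,56\}$) is the following graph. Let $\mathcal O$ be the set of the $56$ hyperovals of $\mathrm{PG}(2,4)$ (sets of six points, no three collinear) that meet the hyperoval through $\langle(1,0,0)\rangle,\langle(0,1,0)\rangle,\langle(0,0,1)\rangle,\langle(1,1,1)\rangle$ in an even number of points. The $486$ vertices are the elements $\infty_i$ with $i\in\mathbb F_4^*$, the pairs $(O,i)$ with $O\in\mathcal O$ and $i\in\mathbb F_4^*$, and the nonzero $3\times 3$ matrices $M$ over $\mathbb F_4$ with $M^2=0$. The edges are: $\infty_i\sim(O,i)$; $(O,i)\sim(O',i)$ if $O\cap O'=\emptyset$; $(O,i)\sim M$ if the elation $1+iM$ maps $O$ to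 itself; and $v f^{\mathsf T}\sim w (v\times w)^{\mathsf T}$ whenever $v f^{\mathsf T}\ne 0$, $f^{\mathsf T}v=0$ and $f^{\mathsf T}w=1$ (where $v\times w$ is the cross product). Theorem. The blocks defining $\Delta$ are cocliques of size $45$ in $\Gamma$, and $\Delta$ has $486$ vertices. Let $H=\mathrm{Aut}(\Delta)$, acting on the vertex set $\Omega$ of $\Delta$. Then: 1. $H\cong 3^5:(2\times M_{10})$, i.e. $H$ is a split extension of an elementary abelian normal subgroup of order $3^5$ by a group isomorphic to $C_2\times M_{10}$, where $M_{10}$ is a point stabilizer in the Mathieu group $M_{11}$ acting on $11$ points. 2. $H$ is transitive of rank $9$ on $\Omega$, and at every vertex the suborbit lengths are $1,2,20,36,40,45,72,90,180$. 3. There are exactly six distance-regular graphs on the vertex set $\Omega$ that are unions of orbitals of $H$. They are isomorphic, respectively, to the complete graph $K_{486}$, the complete bipartite graph $K_{243,243}$, the complete multipartite graph $K_{3^{162}}$ ($162$ parts of size $3$), $\Delta$ (being $\Delta$ itself), $\Upsilon$, and $\Sigma$ (for every choice of $p\ne q$). Their intersection arrays are $\{485;1\}$, $\{243,242;1,243\}$,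 $\{483,2;1,483\}$, $\{45,44,36,5;1,9,40,45\}$, $\{56,45,16,1;1,8,45,56\}$ and $\{81,80,54,1;1,27,80,81\}$, respectively. In particular $\Delta$, $\Upsilon$ and $\Sigma$ are exactly the distance-regular graphs afforded by this action that are not complete, complete bipartite or complete multipartite. -/

import Mathlib

open scoped Matrix Affine

/-! ## Distance-regular graphs and permutation groups -/

section General

variable {V : Type*}

/-- The number of neighbours of `w` at distance `j` from `u`. -/
noncomputable def numNbrsAtDist (X : SimpleGraph V) (u w : V) (j : ℕ) : ℕ :=
  {x | X.Adj w x ∧ X.dist u x = j}.ncard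

/-- A connected graph is distance-regular if, for vertices `u, w`, the numbers of neighbours of `w`
at given distances from `u` depend only on the distance from `u` to `w`. -/
def IsDistanceRegular (X : SimpleGraph V) : Prop :=
  X.Connected ∧ ∀ u w u' w' : V, X.dist u w = X.dist u' w' →
    ∀ j, numNbrsAtDist X u w j = numNbrsAtDist X u' w' j

/-- `X` is distance-regular of diameter `d` with intersection array
`{b₀, …, b_{d-1}; c₁, …, c_d}`, where `bs = [b₀, …, b_{d-1}]` and `cs = [c₁, …, c_d]`. -/
def HasIntersectionArray (X : SimpleGraph V) (bs cs : List ℕ) : Prop :=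
  IsDistanceRegular X ∧ X.diam = bs.length ∧ X.diam = cs.length ∧
  (∀ (i : ℕ) (hi : i < bs.length) (u w : V), X.dist u w = i →
    numNbrsAtDist X u w (i + 1) = bs[i]) ∧
  (∀ (i : ℕ) (hi : i < cs.length) (u w : V), X.dist u w = i + 1 →
    numNbrsAtDist X u w i = cs[i])

/-- The full automorphism group of a graph, as a permutation group on its vertices. -/
def autGroup (X : SimpleGraph V) : Subgroup (Equiv.Perm V) where
  carrier := {σ | ∀ u v, X.Adj (σ u) (σ v) ↔ X.Adj u v}
  mul_mem' := fun {σ τ} hσ hτ u v => (hσ (τ u) (τ v)).trans (hτ u v)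
  one_mem' := fun _ _ => Iff.rfl
  inv_mem' := fun {σ} hσ u v => by
    have h := hσ (σ⁻¹ u) (σ⁻¹ v)
    have hu : σ (σ⁻¹ u) = u := σ.apply_symm_apply u
    have hv : σ (σ⁻¹ v) = v := σ.apply_symm_apply v
    rw [hu, hv] at h
    exact h.symm

/-- The edge set of `X` is a union of orbitals of `H`, that is, of `H`-orbits on ordered pairs. -/
def IsUnionOfOrbitals (H : Subgroup (Equiv.Perm V)) (X : SimpleGraph V) : Prop :=
  ∃ S : Set (Set (V × V)), (∀ O ∈ S, ∃ p : V × V, O = MulAction.orbit H p) ∧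
    {p : V × V | X.Adj p.1 p.2} = ⋃₀ S

/-- The rank of a permutation group: its number of orbits on ordered pairs. -/
noncomputable def permRank (H : Subgroup (Equiv.Perm V)) : ℕ :=
  Nat.card (MulAction.orbitRel.Quotient H (V × V))

/-- The suborbit lengths at `v`: the sizes (with multiplicity) of the orbits on `V` of the
stabilizer of `v`. -/
noncomputable def suborbitLengths [Finite V] (H : Subgroup (Equiv.Perm V)) (v : V) : Multiset ℕ :=
  letI := Fintype.ofFinite (MulAction.orbitRel.Quotient (MulAction.stabilizer H v) V)
  (Finset.univ : Finset (MulAction.orbitRel.Quotient (MulAction.stabilizer H v) V)).val.map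
    fun O => O.orbit.ncard

/-- The incidence graph of an incidence structure with points `P` and blocks `B`. -/
def incidenceGraph {P B : Type*} (I : P → B → Prop) : SimpleGraph (P ⊕ B) :=
  SimpleGraph.fromRel fun
    | Sum.inl p, Sum.inr b => I p b
    | _, _ => False

end General

/-! ## The groups `M₁₀` and `3⁵:(2 × M₁₀)` -/

/-- The Mathieu group `M₁₁`, generated by `(1 2 3 4 5 6 7 8 9 10 11)` and
`(3 7 11 8)(4 10 5 6)`; here the points are numbered from `0`. -/
def mathieuM11 : Subgroup (Equiv.Perm (Fin 11)) :=
  Subgroup.closure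
    {c[0, 1, 2, 3, 4, 5, 6, 7, 8, 9, 10], c[2, 6, 10, 7] * c[3, 9, 4, 5]}

/-- The Mathieu group `M₁₀`: a point stabilizer in `M₁₁`. -/
def mathieuM10 : Subgroup (Equiv.Perm (Fin 11)) :=
  mathieuM11 ⊓ MulAction.stabilizer (Equiv.Perm (Fin 11)) (0 : Fin 11)

/-- The group has the form `3⁵:(2 × M₁₀)`: it is the split extension of an elementary abelian
normal subgroup of order `3⁵` by a group isomorphic to `C₂ × M₁₀`. -/
def HasForm35TwoM10 (G : Type*) [Group G] : Prop :=
  ∃ N K : Subgroup G, N.Normal ∧ N.IsComplement' K ∧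
    Nonempty (N ≃* Multiplicative (Fin 5 → ZMod 3)) ∧
    Nonempty (K ≃* Multiplicative (ZMod 2) × mathieuM10)

/-! ## The ternary Golay code and the Koolen–Riebeek graph -/

/-- The word `(- + - + + + - - - + -)`. -/
def golayWord : ZMod 11 → ZMod 3 :=
  (![-1, 1, -1, 1, 1, 1, -1, -1, -1, 1, -1] : Fin 11 → ZMod 3)

/-- The ternary Golay code, spanned by the cyclic shifts of `golayWord`. -/
def golayCode : Submodule (ZMod 3) (ZMod 11 → ZMod 3) :=
  Submodule.span (ZMod 3) (Set.range fun i j => golayWord (j - i))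

/-- The space of cosets of the ternary Golay code. -/
abbrev GolayCoset : Type := (ZMod 11 → ZMod 3) ⧸ golayCode

/-- The coset graph of the ternary Golay code (the Berlekamp–van Lint–Seidel graph): two distinct
cosets are adjacent if they contain representatives at Hamming distance `1`. -/
def golayCosetGraph : SimpleGraph GolayCoset :=
  SimpleGraph.fromRel fun x y => ∃ u v : ZMod 11 → ZMod 3,
    golayCode.mkQ u = x ∧ golayCode.mkQ v = y ∧ hammingDist u v = 1

/-- The standard basis vector `e i`, with coordinates indexed by the integers modulo `11`. -/
def stdVec (i : ZMod 11) : ZMod 11 → ZMod 3 := Pi.single i 1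

/-- A `45`-coclique in the coset graph, consisting of nine orbits of length `5` under the
automorphism group `e i ↦ e (m * i)` (with `m` a non-zero square modulo `11`) of the code. -/
def baseCoclique : Set GolayCoset :=
  {x | ∃ m ∈ ({1, 3, 4, 5, 9} : Set (ZMod 11)), ∃ w ∈ ({
      - stdVec m,
      stdVec 0 - stdVec (2 * m),
      - stdVec 0 + stdVec (2 * m),
      stdVec m - stdVec (2 * m),
      stdVec m + stdVec (6 * m),
      stdVec m - stdVec (8 * m),
      stdVec m + stdVec (10 * m),
      stdVec (2 * m) + stdVec (7 * m),
      - stdVec (2 * m) - stdVec (6 * m)} : Set (ZMod 11 → ZMod 3)), x = golayCode.mkQ w}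

/-- The blocks: all translates of the base coclique. -/
def krBlocks : Set (Set GolayCoset) :=
  Set.range fun w : GolayCoset => (fun x => w + x) '' baseCoclique

/-- The vertices of the Koolen–Riebeek graph. -/
abbrev KRVertex : Type := GolayCoset ⊕ krBlocks

/-- The Koolen–Riebeek graph `Δ`: the incidence graph of the cosets of the ternary Golay code
versus the collection `krBlocks` of `45`-cocliques in the coset graph. -/
def koolenRiebeekGraph : SimpleGraph KRVertex :=
  incidenceGraph fun (x : GolayCoset) (B : krBlocks) => x ∈ B.1

/-! ## The symmetric net from `AG(5,3)` -/

/-- The `4`-flats of `AG(5,3)` that remain when one deletes every parallel class containing a flat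
through both `p` and `q`. -/
def netFlats (p q : Fin 5 → ZMod 3) : Set (AffineSubspace (ZMod 3) (Fin 5 → ZMod 3)) :=
  {B | Module.finrank (ZMod 3) B.direction = 4 ∧ ¬ ∃ B', B' ∥ B ∧ p ∈ B' ∧ q ∈ B'}

/-- The graph `Σ`: the incidence graph of the points of `AG(5,3)` versus the remaining flats. -/
def affineNetGraph (p q : Fin 5 → ZMod 3) : SimpleGraph ((Fin 5 → ZMod 3) ⊕ netFlats p q) :=
  incidenceGraph fun (x : Fin 5 → ZMod 3) (B : netFlats p q) => x ∈ B.1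

/-! ## The second Soicher graph

A model in the projective plane `PG(2,4)`, adapted to the stabilizer `L₃(4)` of a vertex.  The
`486 = 3 + 3 · 56 + 315` vertices are three special vertices, three copies of an `L₃(4)`-class of
hyperovals, and the non-trivial elations of the plane. -/

/-- The field with four elements. -/
abbrev F4 : Type := GaloisField 2 2

/-- The points of `PG(2,4)`. -/
abbrev PG24 : Type := Projectivization F4 (Fin 3 → F4)

/-- A hyperoval of `PG(2,4)`: six points, no three of them on a line. -/
def IsHyperoval (O : Set PG24) : Prop :=
  O.ncard = 6 ∧ ∀ p ∈ O, ∀ q ∈ O, ∀ r ∈ O, p ≠ q → p ≠ r → q ≠ r →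
    Projectivization.Independent ![p, q, r]

/-- The non-zero vectors spanning a point of `O`. -/
def coneOver (O : Set PG24) : Set (Fin 3 → F4) :=
  {v | ∃ h : v ≠ 0, Projectivization.mk F4 v h ∈ O}

/-- The `56` hyperovals in the same class as the hyperoval through the standard frame
(two hyperovals are in the same class if they meet in an even number of points). -/
def frameHyperovals : Set (Set PG24) :=
  {O | IsHyperoval O ∧ ∃ O₀, IsHyperoval O₀ ∧
    ({![1, 0, 0], ![0, 1, 0], ![0, 0, 1], ![1, 1, 1]} : Set (Fin 3 → F4)) ⊆ coneOver O₀ ∧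
    Even (O ∩ O₀).ncard}

/-- The vertices of the second Soicher graph. A matrix `M ≠ 0` with `M * M = 0` stands for the
elation `1 + M`. -/
inductive SoicherVertex : Type
  | special (i : F4ˣ)
  | hyperoval (O : frameHyperovals) (i : F4ˣ)
  | elation (M : {M : Matrix (Fin 3) (Fin 3) F4 // M ≠ 0 ∧ M * M = 0})

/-- The relation generating the adjacency of the second Soicher graph: the special vertex `i` is
joined to the hyperovals of the `i`-th copy; disjoint hyperovals in the same copy are joined; a
hyperoval of the `i`-th copy is joined to `M` when the elation `1 + i M` fixes it; and the elations
`v ⊗ f` and `w ⊗ (v × w)` with `f v = 0`, `f w = 1` are joined. -/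
def soicherRel : SoicherVertex → SoicherVertex → Prop
  | .special i, .hyperoval _ j => i = j
  | .hyperoval O i, .hyperoval O' j => i = j ∧ Disjoint O.1 O'.1
  | .hyperoval O i, .elation M =>
      ∀ v ∈ coneOver O.1, v + (i : F4) • (M.1 *ᵥ v) ∈ coneOver O.1
  | .elation M, .elation M' => ∃ v w f : Fin 3 → F4,
      f ⬝ᵥ v = 0 ∧ f ⬝ᵥ w = 1 ∧ M.1 = Matrix.vecMulVec v f ∧
      M'.1 = Matrix.vecMulVec w (crossProduct v w)
  | _, _ => False

/-- The second Soicher graph `Υ`. -/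
def secondSoicherGraph : SimpleGraph SoicherVertex := SimpleGraph.fromRel soicherRel

/-! Everything is moved to coordinates. The Golay code is the kernel of a parity check map
(`syndrome`), so its cosets become the vectors of `V = 𝔽₃⁵`. No non-zero translation fixes the base
block, so the blocks become vectors as well, and Δ becomes a graph on `W = V ⊕ V` in which the point
`x` and the block `y` are adjacent when `x - y` lies in a fixed set of 45 vectors. Some
automorphisms are visible: the translations, the polarity that exchanges `x` with `-x`, and eleven
maps acting as `A x + t` on points and as `A x - t` on blocks, which together generate a copy of
`M₁₀`. They generate `bigGroup`.

Two colourings of `V`, by classes of sizes 1, 2, 20, 40, 180 and 36, 45, 72, 90, give every pair of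
vertices one of nine colours. The generators preserve the colours, and short words in them carry a
representative of each class to all its elements. Hence the colours are exactly the orbitals of
`bigGroup`, and the intersection numbers follow by counting at nine representative pairs
(`isScheme`). The rank and the suborbit lengths can be read off.

The full automorphism group is no larger (`autGroup_krModel`). After multiplication by elements of
`bigGroup`, an automorphism fixes an incident point and block and a second point of that block.
Invariants that count triples of points lying on a unique block then fix ten points of the block,
then all 45. A block that meets the base block is determined by its trace there; a point is
determined by ten blocks through it, and a block by its points. So the automorphism is the identity
(`eq_one_of_fixes_base`).

For the structure of the group, `M₁₀` is generated by its Schreier generators inside `M₁₁`. The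
eleven coordinate directions of the code space give eleven vectors of `V`, which the generators
permute up to sign as the Schreier generators permute eleven points. The group generated by the
triples (side, permutation of axes, permutation of `W`) projects injectively to `2 × M₁₀` and to the
complement of the translations, so it is the graph of an isomorphism.

A union of orbitals without loops is one of 2⁸ sets of colours. For each one, connectivity,
distances and distance-regularity depend only on the intersection numbers, and a finite check leaves
six. These are then identified. For Σ, the colours 3 and 5 together form the graph of a quadratic
function in four variables with non-degenerate polar form; a shear turns its translates into the
hyperplanes transverse to a direction. For Υ, the hyperovals and the elations are enumerated and an
explicit numbering is shown to match edges with the colours 2 and 3. -/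

namespace KoolenRiebeek

/-! ## Bounded checks on natural numbers that the kernel evaluates quickly -/

/-- All `k < n` satisfy `p`. -/
def allBelow (n : ℕ) (p : ℕ → Bool) : Bool := Nat.rec true (fun k ih => p k && ih) n

theorem allBelow_iff {n : ℕ} {p : ℕ → Bool} : allBelow n p = true ↔ ∀ k < n, p k = true := by
  induction n with
  | zero => simp [allBelow]
  | succ n ih =>
    have h : allBelow (n + 1) p = (p n && allBelow n p) := rfl
    rw [h, Bool.and_eq_true, ih]
    constructor
    · rintro ⟨h1, h2⟩ k hk
      rcases Nat.lt_succ_iff_lt_or_eq.mp hk with h | rfl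
      exacts [h2 k h, h1]
    · exact fun h => ⟨h n n.lt_succ_self, fun k hk => h k (hk.trans n.lt_succ_self)⟩

/-- The `i`-th digit of `T` in base `2 ^ b`. -/
def entry (b T i : ℕ) : ℕ :=
  Nat.land (Nat.shiftRight T (Nat.mul b i)) (Nat.sub (Nat.shiftLeft 1 b) 1)

/-! ## Vectors over `𝔽₃` and their codes -/

/-- The space of cosets, in coordinates. -/
abbrev V : Type := Fin 5 → ZMod 3

/-- The vector whose coordinates are the ternary digits of `n`. -/
def dec (n : ℕ) : V :=
  ![(n : ZMod 3), ((n / 3 : ℕ) : ZMod 3), ((n / 9 : ℕ) : ZMod 3), ((n / 27 : ℕ) : ZMod 3),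
    ((n / 81 : ℕ) : ZMod 3)]

/-- The number whose ternary digits are the coordinates of `x`. -/
def enc (x : V) : ℕ :=
  (x 0).val + 3 * (x 1).val + 9 * (x 2).val + 27 * (x 3).val + 81 * (x 4).val

/-- The number with the given digits modulo `3`. -/
def pack (a b c d e : ℕ) : ℕ :=
  Nat.add (Nat.mod a 3) (Nat.add (Nat.mul 3 (Nat.mod b 3)) (Nat.add (Nat.mul 9 (Nat.mod c 3))
    (Nat.add (Nat.mul 27 (Nat.mod d 3)) (Nat.mul 81 (Nat.mod e 3)))))

theorem pack_eq (a b c d e : ℕ) :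
    pack a b c d e = a % 3 + (3 * (b % 3) + (9 * (c % 3) + (27 * (d % 3) + 81 * (e % 3)))) := rfl

theorem enc_lt (x : V) : enc x < 243 := by
  have h := fun i => ZMod.val_lt (x i)
  have h0 := h 0
  have h1 := h 1
  have h2 := h 2
  have h3 := h 3
  have h4 := h 4
  unfold enc
  omega

theorem natCast_zmod3_eq {a b : ℕ} (h : a % 3 = b % 3) : (a : ZMod 3) = b :=
  (ZMod.natCast_eq_natCast_iff' a b 3).mpr h

theorem dec_enc (x : V) : dec (enc x) = x := by
  have h := fun i => ZMod.val_lt (x i)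
  have h0 := h 0
  have h1 := h 1
  have h2 := h 2
  have h3 := h 3
  have h4 := h 4
  have key : ∀ (i : Fin 5) (n : ℕ), n % 3 = (x i).val → (n : ZMod 3) = x i := by
    intro i n hn
    rw [← ZMod.natCast_zmod_val (x i)]
    exact natCast_zmod3_eq (by rw [hn, Nat.mod_eq_of_lt (h i)])
  funext i
  fin_cases i
  · exact key 0 _ (by unfold enc; omega)
  · exact key 1 _ (by unfold enc; omega)
  · exact key 2 _ (by unfold enc; omega)
  · exact key 3 _ (by unfold enc; omega)
  · exact key 4 _ (by unfold enc; omega)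

theorem enc_dec {n : ℕ} (hn : n < 243) : enc (dec n) = n := by
  simp only [enc, dec, Matrix.cons_val, ZMod.val_natCast]
  omega

/-- Since `243 = 3⁵`, even the quotient by 81 changes by a multiple of 3. The offset that separates
block numbers from point numbers is therefore invisible to `dec`. -/
theorem dec_add_243 (n : ℕ) : dec (n + 243) = dec n := by
  funext i
  fin_cases i <;> exact natCast_zmod3_eq (by omega)

theorem dec_pack (a b c d e : ℕ) :
    dec (pack a b c d e) = ![(a : ZMod 3), (b : ZMod 3), (c : ZMod 3), (d : ZMod 3), (e : ZMod 3)] := by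
  rw [pack_eq]
  funext i
  fin_cases i <;> exact natCast_zmod3_eq (by omega)

theorem pack_lt (a b c d e : ℕ) : pack a b c d e < 243 := by
  rw [pack_eq]
  omega

theorem forall_vec {P : V → Prop} (h : ∀ n < 243, P (dec n)) (x : V) : P x :=
  dec_enc x ▸ h _ (enc_lt x)

theorem dec_zero : dec 0 = 0 := by
  funext i
  fin_cases i <;> simp [dec]

/-- The code of `dec m - dec n`. -/
def subN (m n : ℕ) : ℕ :=
  pack (Nat.add m (Nat.mul 2 n)) (Nat.add (Nat.div m 3) (Nat.mul 2 (Nat.div n 3)))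
    (Nat.add (Nat.div m 9) (Nat.mul 2 (Nat.div n 9)))
    (Nat.add (Nat.div m 27) (Nat.mul 2 (Nat.div n 27)))
    (Nat.add (Nat.div m 81) (Nat.mul 2 (Nat.div n 81)))

/-- Twice a digit stands for its negative modulo 3, which avoids truncated subtraction. -/
theorem dec_subN (m n : ℕ) : dec (subN m n) = dec m - dec n := by
  have h : ∀ a b : ℕ, ((a + 2 * b : ℕ) : ZMod 3) = (a : ZMod 3) - b := by
    intro a b
    have h3 : (3 : ZMod 3) = 0 := rfl
    push_cast
    linear_combination (b : ZMod 3) * h3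
  rw [subN, dec_pack]
  funext i
  fin_cases i <;> exact h _ _

theorem subN_lt (m n : ℕ) : subN m n < 243 := pack_lt _ _ _ _ _

/-- A number congruent modulo `3` to the scalar product of `dec r` and `dec n`. -/
def dotN (r n : ℕ) : ℕ :=
  Nat.add (Nat.mul r n) (Nat.add (Nat.mul (Nat.div r 3) (Nat.div n 3))
    (Nat.add (Nat.mul (Nat.div r 9) (Nat.div n 9)) (Nat.add (Nat.mul (Nat.div r 27) (Nat.div n 27))
      (Nat.mul (Nat.div r 81) (Nat.div n 81)))))

theorem dotN_cast (r n : ℕ) : (dotN r n : ZMod 3) = dec r ⬝ᵥ dec n := by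
  have h : dotN r n = r * n + (r / 3 * (n / 3) + (r / 9 * (n / 9) + (r / 27 * (n / 27) +
    r / 81 * (n / 81)))) := rfl
  rw [h]
  simp [dotProduct, Fin.sum_univ_five, dec]
  ring

/-! ## The two colourings of `V` -/

/-- The numbers of the classes of the elements of `V` under the linear group `M₁₀`; the classes
`0, 1, 2, 4, 8` have `1, 2, 20, 40, 180` elements. -/
def linTable : ℕ := 21288962369994646272890358088353823875075751050849023619037164207021245378768835096898518839702400921200344149694799667538901258368611274092409778125115056627736829654166960674090664330166377518473874578028259321824738222396681424857711045141991666589795911545091600977065582899667513486090512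

/-- The numbers of the classes of the elements of `V` under an affine group `M₁₀`; the classes
`3, 5, 6, 7` have `36, 45, 72, 90` elements. -/
def affTable : ℕ := 18605875466971923214234409528839882692593789583857712616730100129327197355772583875307469298118978019384835343978365960565909248366705184058268016140717880565448857026254614785308648931789149879974395321607105609129426654712308048793271014239328591754509053169644590222916006837272734341674595

def linColN (n : ℕ) : ℕ := entry 4 linTable n

def affColN (n : ℕ) : ℕ := entry 4 affTable n

def linCol (x : V) : ℕ := linColN (enc x)

def affCol (x : V) : ℕ := affColN (enc x)

theorem linCol_dec {n : ℕ} (hn : n < 243) : linCol (dec n) = linColN n := by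
  rw [linCol, enc_dec hn]

theorem affCol_dec {n : ℕ} (hn : n < 243) : affCol (dec n) = affColN n := by
  rw [affCol, enc_dec hn]

theorem linCol_eq_zero_iff (x : V) : linCol x = 0 ↔ x = 0 := by
  have h : allBelow 243 (fun n => Nat.beq n 0 || !Nat.beq (linColN n) 0) = true := by
    decide +kernel
  rw [allBelow_iff] at h
  revert x
  refine forall_vec fun n hn => ?_
  rw [linCol_dec hn]
  have h1 := h n hn
  rcases Nat.eq_zero_or_pos n with rfl | hpos
  · simpa [dec_zero] using (by decide +kernel : linColN 0 = 0)
  · have h2 : linColN n ≠ 0 := by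
      intro h0
      simp [h0, hpos.ne'] at h1
    refine ⟨fun h0 => absurd h0 h2, fun h0 => absurd ?_ hpos.ne'⟩
    rw [← enc_dec hn, h0]
    rfl

theorem linCol_neg (x : V) : linCol (-x) = linCol x := by
  have h : allBelow 243 (fun n => Nat.beq (linColN (subN 0 n)) (linColN n)) = true := by
    decide +kernel
  rw [allBelow_iff] at h
  revert x
  refine forall_vec fun n hn => ?_
  rw [← zero_sub, ← dec_zero, ← dec_subN, linCol_dec (subN_lt _ _), linCol_dec hn]
  exact Nat.eq_of_beq_eq_true (h n hn)

theorem linCol_mem (x : V) : linCol x ∈ ({0, 1, 2, 4, 8} : Finset ℕ) := by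
  have h : allBelow 243 (fun n => decide (linColN n ∈ ({0, 1, 2, 4, 8} : Finset ℕ))) = true := by
    decide +kernel
  rw [allBelow_iff] at h
  revert x
  refine forall_vec fun n hn => ?_
  rw [linCol_dec hn]
  exact of_decide_eq_true (h n hn)

theorem affCol_mem (x : V) : affCol x ∈ ({3, 5, 6, 7} : Finset ℕ) := by
  have h : allBelow 243 (fun n => decide (affColN n ∈ ({3, 5, 6, 7} : Finset ℕ))) = true := by
    decide +kernel
  rw [allBelow_iff] at h
  revert x
  refine forall_vec fun n hn => ?_
  rw [affCol_dec hn]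
  exact of_decide_eq_true (h n hn)

/-! ## Generators of the group `M₁₀` -/

/-- The rows of eleven `5 × 5` matrices, each followed by a translation vector. -/
def genTable : ℕ := 46924180828325135831031011701286282158585804551654090909960662974499146479738790892752450861170404346391466733419958603356544752271900428577740591391489221558

def genEntry (j i : ℕ) : ℕ := entry 8 genTable (Nat.add (Nat.mul 6 j) i)

def linN (j n : ℕ) : ℕ :=
  pack (dotN (genEntry j 0) n) (dotN (genEntry j 1) n) (dotN (genEntry j 2) n)
    (dotN (genEntry j 3) n) (dotN (genEntry j 4) n)

def affN (j n : ℕ) : ℕ := subN (linN j n) (genEntry j 5)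

/-- The `j`-th generating matrix of `M₁₀`. -/
def genMatrix (j : Fin 11) : Matrix (Fin 5) (Fin 5) (ZMod 3) :=
  Matrix.of fun i => dec (genEntry j i)

/-- The translation vector that belongs to the `j`-th generator of `M₁₀`. -/
def genVec (j : Fin 11) : V := dec (genEntry j 5)

theorem dec_linN (j : Fin 11) (n : ℕ) : dec (linN j n) = genMatrix j *ᵥ dec n := by
  rw [linN, dec_pack]
  funext i
  fin_cases i <;> exact dotN_cast _ _

theorem dec_affN (j : Fin 11) (n : ℕ) : dec (affN j n) = genMatrix j *ᵥ dec n - genVec j := by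
  rw [affN, dec_subN, dec_linN, genVec]

/-- Invariance makes the colour classes unions of orbits; `applyWord_linWords` supplies the
converse, that each class is a single orbit. -/
theorem linCol_genMatrix (j : Fin 11) (x : V) : linCol (genMatrix j *ᵥ x) = linCol x := by
  have h : allBelow 11 (fun j => allBelow 243 fun n => Nat.beq (linColN (linN j n)) (linColN n))
      = true := by
    decide +kernel
  simp only [allBelow_iff] at h
  revert x
  refine forall_vec fun n hn => ?_
  rw [← dec_linN, linCol_dec (n := linN j n) (pack_lt _ _ _ _ _), linCol_dec hn]
  exact Nat.eq_of_beq_eq_true (h j j.2 n hn)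

theorem affCol_genMatrix (j : Fin 11) (x : V) :
    affCol (genMatrix j *ᵥ x - genVec j) = affCol x := by
  have h : allBelow 11 (fun j => allBelow 243 fun n => Nat.beq (affColN (affN j n)) (affColN n))
      = true := by
    decide +kernel
  simp only [allBelow_iff] at h
  revert x
  refine forall_vec fun n hn => ?_
  rw [← dec_affN, affCol_dec (n := affN j n) (subN_lt _ _), affCol_dec hn]
  exact Nat.eq_of_beq_eq_true (h j j.2 n hn)

/-- The `j`-th generating matrix of `M₁₀`, as a linear automorphism. -/
noncomputable def genLin (j : Fin 11) : V ≃ₗ[ZMod 3] V :=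
  LinearEquiv.ofInjectiveEndo (Matrix.mulVecLin (genMatrix j)) <| by
    -- The colour 0 belongs to the zero vector alone and is preserved, so the kernel is trivial.
    rw [← LinearMap.ker_eq_bot, LinearMap.ker_eq_bot']
    intro x hx
    rw [← linCol_eq_zero_iff, ← linCol_genMatrix j, linCol_eq_zero_iff]
    exact hx

theorem genLin_apply (j : Fin 11) (x : V) : genLin j x = genMatrix j *ᵥ x := rfl

/-- Applies the generators with the numbers one less than the nibbles of `w`, the lowest last. -/
def applyWord (f : ℕ → ℕ → ℕ) (fuel w n : ℕ) : ℕ :=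
  Nat.rec (fun _ => n) (fun _ ih w => cond (Nat.beq w 0) n
    (f (Nat.mod (Nat.sub (Nat.land w 15) 1) 11) (ih (Nat.shiftRight w 4)))) fuel w

/-- Words in the generators that take the representative of a class under the linear group to the
elements of the class. -/
def linWords : ℕ := 761358505597791692950363393707975990481060930298079682627386745761963845152395121260843911083103257733814770436254518735408801033505268714435754707486183905296955421383212032358315960154845588736735497708169738186348060848292091202582176957240760341163187189690717286066407816928585093916712783631082563457257458910641717165639536065132131922899121142108392508971056023552643099893948654090226997442675756693238975372032749502338530671074624584266709314534454084666784835123330981458326798554080677025895294268436908563234143295855335571638570205068642081249296837637680506214406085504620082959212398927563096117869978156541468038496642849915803756676266635685659770531016099398843374465016747461414348825475969052857078747393435588812561238766575608662802406777112717961416545641972732104676867547255325635998984158867996896655373824278367282727350035642357570603985955454976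

/-- Words in the generators that take the representative of a class under the affine group to the
elements of the class. -/
def affWords : ℕ := 6817275130183828889090787428899509097933173012448315998875323803221641879967909215417418399578450172262427487105467958654417083593747965606893739398729919337238049504462054316603283556571684166809668316604308187682699790914358880403617118270566646141391875442678929340830513323356389442853543407304518682039378082420575729129745326775117860064248918887750796133635197529375830902145500881676284210910522680359368317612897261710150165021647496887480467011103590398025140888302531379036856203332786393399544327341317164528704026581975837300910403226339295431437584359764430102748839567528352534141784064661208134880858782141923751142507746452882823508942735004506057012482397366044051352704130092111330510993825064927921074193481737735072395246292089497951674209991871743663506761183641278518700079417518564688223097321635581594618583007894400685005503547011040735131331905716224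

/-- Representatives of the nine classes. -/
def repN (c : ℕ) : ℕ := entry 4 53441987344 c

theorem repN_lt (c : ℕ) : repN c < 243 := by
  have h : repN c ≤ 15 := Nat.and_le_right
  omega

/-- A certificate of transitivity on each class: three generators always suffice to get from the
representative to any element. -/
theorem applyWord_linWords {n : ℕ} (hn : n < 243) :
    applyWord linN 3 (entry 12 linWords n) (repN (linColN n)) = n := by
  have h : allBelow 243 (fun n => Nat.beq
      (applyWord linN 3 (entry 12 linWords n) (repN (linColN n))) n) = true := by
    decide +kernel
  exact Nat.eq_of_beq_eq_true (allBelow_iff.mp h n hn)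

theorem applyWord_affWords {n : ℕ} (hn : n < 243) :
    applyWord affN 3 (entry 12 affWords n) (repN (affColN n)) = n := by
  have h : allBelow 243 (fun n => Nat.beq
      (applyWord affN 3 (entry 12 affWords n) (repN (affColN n))) n) = true := by
    decide +kernel
  exact Nat.eq_of_beq_eq_true (allBelow_iff.mp h n hn)

/-! ## The coloured vertex set and its automorphisms -/

/-- Points and blocks, both in coordinates. -/
abbrev W : Type := V ⊕ V

/-- The colour of a pair of vertices. -/
def col : W → W → ℕ
  | .inl x, .inl y => linCol (x - y)
  | .inl x, .inr y => affCol (x - y)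
  | .inr x, .inl y => affCol (y - x)
  | .inr x, .inr y => linCol (x - y)

theorem col_symm (p q : W) : col p q = col q p := by
  rcases p with x | x <;> rcases q with y | y
  · rw [col, col, ← linCol_neg, neg_sub]
  · rfl
  · rfl
  · rw [col, col, ← linCol_neg, neg_sub]

theorem affCol_ne_linCol (x y : V) : affCol x ≠ linCol y := by
  have hx := affCol_mem x
  have hy := linCol_mem y
  intro h
  rw [h] at hx
  simp only [Finset.mem_insert, Finset.mem_singleton] at hx hy
  omega

theorem col_eq_zero_iff (p q : W) : col p q = 0 ↔ p = q := by
  have h : ∀ x : V, affCol x ≠ 0 := fun x h =>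
    affCol_ne_linCol x 0 (h.trans ((linCol_eq_zero_iff 0).mpr rfl).symm)
  rcases p with x | x <;> rcases q with y | y <;>
    simp [col, linCol_eq_zero_iff, sub_eq_zero, h]

theorem col_lt (p q : W) : col p q < 9 := by
  have hl : ∀ x, linCol x < 9 := fun x => by
    have := linCol_mem x
    simp only [Finset.mem_insert, Finset.mem_singleton] at this
    omega
  have ha : ∀ x, affCol x < 9 := fun x => by
    have := affCol_mem x
    simp only [Finset.mem_insert, Finset.mem_singleton] at this
    omega
  rcases p with x | x <;> rcases q with y | y <;> simp only [col] <;> first | exact hl _ | exact ha _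

/-- The graph whose edges are the pairs with a colour in the set with characteristic bits `S`. -/
def colGraph {Ω : Type*} (c : Ω → Ω → ℕ) (hc : ∀ p q, c p q = c q p) (S : ℕ) : SimpleGraph Ω where
  Adj p q := p ≠ q ∧ S.testBit (c p q) = true
  symm := ⟨fun p q h => ⟨h.1.symm, hc p q ▸ h.2⟩⟩
  loopless := ⟨fun _ h => h.1 rfl⟩

/-- The Koolen–Riebeek graph in coordinates. -/
def krModel : SimpleGraph W := colGraph col col_symm 32

theorem krModel_inl_inr (x y : V) : krModel.Adj (.inl x) (.inr y) ↔ affCol (x - y) = 5 := by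
  have h : ∀ c ∈ ({3, 5, 6, 7} : Finset ℕ), Nat.testBit 32 c = true ↔ c = 5 := by decide
  change (_ ≠ _ ∧ _) ↔ _
  simp [col, h _ (affCol_mem (x - y))]

theorem krModel_inr_inl (x y : V) : krModel.Adj (.inr y) (.inl x) ↔ affCol (x - y) = 5 := by
  rw [krModel.adj_comm, krModel_inl_inr]

theorem not_krModel_inl_inl (x y : V) : ¬ krModel.Adj (.inl x) (.inl y) := by
  have h : ∀ c ∈ ({0, 1, 2, 4, 8} : Finset ℕ), ¬ Nat.testBit 32 c = true := by decide
  exact fun hh => h _ (linCol_mem (x - y)) hh.2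

theorem not_krModel_inr_inr (x y : V) : ¬ krModel.Adj (.inr x) (.inr y) := by
  have h : ∀ c ∈ ({0, 1, 2, 4, 8} : Finset ℕ), ¬ Nat.testBit 32 c = true := by decide
  exact fun hh => h _ (linCol_mem (x - y)) hh.2

/-- The permutations that preserve the colours. -/
def colGroup : Subgroup (Equiv.Perm W) where
  carrier := {σ | ∀ p q, col (σ p) (σ q) = col p q}
  mul_mem' := fun {σ τ} hσ hτ p q => (hσ (τ p) (τ q)).trans (hτ p q)
  one_mem' := fun _ _ => rfl
  inv_mem' := fun {σ} hσ p q => by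
    have h := hσ (σ⁻¹ p) (σ⁻¹ q)
    have hp : σ (σ⁻¹ p) = p := σ.apply_symm_apply p
    have hq : σ (σ⁻¹ q) = q := σ.apply_symm_apply q
    rw [hp, hq] at h
    exact h.symm

theorem colGroup_le_autGroup (S : ℕ) : colGroup ≤ autGroup (colGraph col col_symm S) := by
  intro σ hσ p q
  change (_ ≠ _ ∧ _) ↔ (_ ≠ _ ∧ _)
  rw [hσ p q, σ.injective.ne_iff]

/-- Translations. -/
def translation : Multiplicative V →* Equiv.Perm W where
  toFun u := (Equiv.addRight u.toAdd).sumCongr (Equiv.addRight u.toAdd)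
  map_one' := by ext (x | x) : 1 <;> simp
  map_mul' u v := by ext (x | x) : 1 <;> simp [add_comm]

@[simp] theorem translation_inl (u : V) (x : V) : translation (.ofAdd u) (.inl x) = .inl (x + u) := rfl

@[simp] theorem translation_inr (u : V) (x : V) : translation (.ofAdd u) (.inr x) = .inr (x + u) := rfl

/-- The polarity, which interchanges points and blocks. -/
def polarity : Equiv.Perm W where
  toFun := Sum.elim (fun x => .inr (-x)) (fun x => .inl (-x))
  invFun := Sum.elim (fun x => .inr (-x)) (fun x => .inl (-x))
  left_inv := by rintro (x | x) <;> simp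
  right_inv := by rintro (x | x) <;> simp

@[simp] theorem polarity_inl (x : V) : polarity (.inl x) = .inr (-x) := rfl

@[simp] theorem polarity_inr (x : V) : polarity (.inr x) = .inl (-x) := rfl

/-- The generators of `M₁₀` that commute with the polarity. -/
noncomputable def gen (j : Fin 11) : Equiv.Perm W :=
  ((genLin j).toEquiv.trans (Equiv.addRight (genVec j))).sumCongr
    ((genLin j).toEquiv.trans (Equiv.subRight (genVec j)))

@[simp] theorem gen_inl (j : Fin 11) (x : V) :
    gen j (.inl x) = .inl (genMatrix j *ᵥ x + genVec j) := rfl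

@[simp] theorem gen_inr (j : Fin 11) (x : V) :
    gen j (.inr x) = .inr (genMatrix j *ᵥ x - genVec j) := rfl

theorem translation_mem_colGroup (u : Multiplicative V) : translation u ∈ colGroup := by
  induction u using Multiplicative.rec with
  | ofAdd u => rintro (x | x) (y | y) <;> simp only [translation_inl, translation_inr, col, add_sub_add_right_eq_sub]

theorem polarity_mem_colGroup : polarity ∈ colGroup := by
  rintro (x | x) (y | y) <;>
    simp only [polarity_inl, polarity_inr, col, neg_sub_neg]
  · rw [← linCol_neg, neg_sub]
  · rw [← linCol_neg, neg_sub]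

theorem sub_zmod3_eq (t : V) : t + t = -t := by
  funext i
  have : ∀ a : ZMod 3, a + a = -a := by decide
  exact this _

/-- Points are shifted by `t = genVec j` and blocks by `-t`, so the difference of a point and a
block is shifted by `2 t = -t`. This is the affine map that leaves `affCol` invariant. -/
theorem gen_mem_colGroup (j : Fin 11) : gen j ∈ colGroup := by
  have h : ∀ x y : V, affCol (genMatrix j *ᵥ x + genVec j - (genMatrix j *ᵥ y - genVec j))
      = affCol (x - y) := by
    intro x y
    rw [← affCol_genMatrix j (x - y), Matrix.mulVec_sub]
    congr 1
    rw [sub_eq_add_neg _ (genVec j), ← sub_zmod3_eq]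
    abel
  rintro (x | x) (y | y)
  · simp only [gen_inl, col, add_sub_add_right_eq_sub, ← Matrix.mulVec_sub, linCol_genMatrix]
  · exact h x y
  · exact h y x
  · simp only [gen_inr, col, sub_sub_sub_cancel_right, ← Matrix.mulVec_sub, linCol_genMatrix]

/-- The complement `2 × M₁₀`. -/
noncomputable def complementGroup : Subgroup (Equiv.Perm W) :=
  Subgroup.closure (insert polarity (Set.range gen))

/-- The group `3⁵:(2 × M₁₀)` acting on the vertices. -/
noncomputable def bigGroup : Subgroup (Equiv.Perm W) := translation.range ⊔ complementGroup

theorem translation_mem_bigGroup (u : V) : translation (.ofAdd u) ∈ bigGroup :=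
  Subgroup.mem_sup_left ⟨_, rfl⟩

theorem polarity_mem_bigGroup : polarity ∈ bigGroup :=
  Subgroup.mem_sup_right (Subgroup.subset_closure (Set.mem_insert _ _))

theorem gen_mem_bigGroup (j : Fin 11) : gen j ∈ bigGroup :=
  Subgroup.mem_sup_right (Subgroup.subset_closure (Set.mem_insert_of_mem _ ⟨j, rfl⟩))

theorem bigGroup_le_colGroup : bigGroup ≤ colGroup := by
  rw [bigGroup, complementGroup, sup_le_iff, Subgroup.closure_le]
  refine ⟨?_, ?_⟩
  · rintro _ ⟨u, rfl⟩
    exact translation_mem_colGroup u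
  · rintro _ (rfl | ⟨j, rfl⟩)
    exacts [polarity_mem_colGroup, gen_mem_colGroup j]

theorem bigGroup_le_autGroup : bigGroup ≤ autGroup krModel :=
  bigGroup_le_colGroup.trans (colGroup_le_autGroup 32)

/-! ## Orbits -/

/-- The generators of the stabilizer of the point `0`. -/
theorem exists_stabilizer_gen (j : Fin 11) : ∃ g ∈ bigGroup,
    (∀ x, g (.inl x) = .inl (genMatrix j *ᵥ x)) ∧
    ∀ x, g (.inr (-x)) = .inr (-(genMatrix j *ᵥ x - genVec j)) := by
  -- The generator sends the point 0 to `t`, and translation by `-t` brings it back. On blocks the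
  -- total shift is then `-2 t = t`, which becomes `-t` inside the outer minus sign.
  refine ⟨translation (.ofAdd (-genVec j)) * gen j,
    mul_mem (translation_mem_bigGroup _) (gen_mem_bigGroup j), fun x => ?_, fun x => ?_⟩
  · rw [Equiv.Perm.mul_apply, gen_inl, translation_inl, add_neg_cancel_right]
  · simp only [Equiv.Perm.mul_apply, gen_inr, translation_inr, Matrix.mulVec_neg]
    congr 1
    rw [← sub_eq_add_neg, sub_sub, sub_zmod3_eq]
    abel

/-- One group element has to realize the word linearly on points and affinely on blocks at once,
because the rigidity argument needs elements that move a point as prescribed while fixing a block.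
-/
theorem exists_stabilizer_word (fuel w m n : ℕ) : ∃ g ∈ bigGroup, g (.inl 0) = .inl 0 ∧
    g (.inl (dec m)) = .inl (dec (applyWord linN fuel w m)) ∧
    g (.inr (-dec n)) = .inr (-dec (applyWord affN fuel w n)) := by
  induction fuel generalizing w with
  | zero => exact ⟨1, one_mem _, rfl, rfl, rfl⟩
  | succ fuel ih =>
    have hstep : ∀ (f : ℕ → ℕ → ℕ) (n : ℕ), applyWord f (fuel + 1) w n = cond (Nat.beq w 0) n
      (f (Nat.mod (Nat.sub (Nat.land w 15) 1) 11) (applyWord f fuel (Nat.shiftRight w 4) n)) := fun _ _ => rfl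
    rw [hstep, hstep]
    by_cases hw : Nat.beq w 0 = true
    · rw [hw]
      exact ⟨1, one_mem _, rfl, rfl, rfl⟩
    · rw [Bool.eq_false_iff.mpr hw]
      obtain ⟨g, hg, h0, h1, h2⟩ := ih (Nat.shiftRight w 4)
      let j : Fin 11 := ⟨(Nat.sub (Nat.land w 15) 1) % 11, Nat.mod_lt _ (by norm_num)⟩
      obtain ⟨g', hg', h1', h2'⟩ := exists_stabilizer_gen j
      refine ⟨g' * g, mul_mem hg' hg, ?_, ?_, ?_⟩
      · rw [Equiv.Perm.mul_apply, h0, h1', Matrix.mulVec_zero]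
      · rw [Equiv.Perm.mul_apply, h1, h1', ← dec_linN]
        rfl
      · rw [Equiv.Perm.mul_apply, h2, h2', ← dec_affN]
        rfl

/-- Representatives of the orbits of the stabilizer of the point `0`. -/
def repVertex (c : ℕ) : W :=
  if c ∈ ({3, 5, 6, 7} : Finset ℕ) then .inr (-dec (repN c)) else .inl (dec (repN c))

theorem exists_rep (q : W) : ∃ g ∈ bigGroup, g (.inl 0) = .inl 0 ∧
    g (repVertex (col (.inl 0) q)) = q := by
  rcases q with x | x
  · obtain ⟨g, hg, h0, h1, -⟩ := exists_stabilizer_word 3 (entry 12 linWords (enc x))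
      (repN (linCol x)) 0
    have hc : col (.inl 0) (.inl x) = linCol x := by rw [col, zero_sub, linCol_neg]
    have hn : linCol x ∉ ({3, 5, 6, 7} : Finset ℕ) := by
      have := linCol_mem x
      simp only [Finset.mem_insert, Finset.mem_singleton] at this ⊢
      omega
    refine ⟨g, hg, h0, ?_⟩
    rw [hc, repVertex, if_neg hn, h1, linCol, applyWord_linWords (enc_lt x), dec_enc]
  · obtain ⟨g, hg, h0, -, h1⟩ := exists_stabilizer_word 3 (entry 12 affWords (enc (-x))) 0
      (repN (affCol (-x)))
    have hc : col (.inl 0) (.inr x) = affCol (-x) := by rw [col, zero_sub]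
    refine ⟨g, hg, h0, ?_⟩
    rw [hc, repVertex, if_pos (affCol_mem _), h1, affCol, applyWord_affWords (enc_lt (-x)), dec_enc,
      neg_neg]

theorem exists_to_zero (p : W) : ∃ g ∈ bigGroup, g p = .inl 0 := by
  rcases p with x | x
  · refine ⟨_, translation_mem_bigGroup (-x), ?_⟩
    rw [translation_inl, add_neg_cancel]
  · refine ⟨_, mul_mem polarity_mem_bigGroup (translation_mem_bigGroup (-x)), ?_⟩
    rw [Equiv.Perm.mul_apply, translation_inr, add_neg_cancel, polarity_inr, neg_zero]

theorem exists_from_zero (p : W) : ∃ g ∈ bigGroup, g (.inl 0) = p := by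
  obtain ⟨g, hg, h⟩ := exists_to_zero p
  exact ⟨g⁻¹, inv_mem hg, by rw [← h]; exact g.symm_apply_apply p⟩

/-- Every pair is the image of a pair of representatives. -/
theorem exists_pair_rep (p q : W) : ∃ g ∈ bigGroup, g (.inl 0) = p ∧
    g (repVertex (col p q)) = q := by
  obtain ⟨g, hg, rfl⟩ := exists_from_zero p
  obtain ⟨h, hh, h0, h1⟩ := exists_rep (g⁻¹ q)
  have hq : g (g⁻¹ q) = q := g.apply_symm_apply q
  have hc : col (g (.inl 0)) q = col (.inl 0) (g⁻¹ q) := by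
    rw [← bigGroup_le_colGroup hg (.inl 0) (g⁻¹ q), hq]
  refine ⟨g * h, mul_mem hg hh, by rw [Equiv.Perm.mul_apply, h0], ?_⟩
  rw [hc, Equiv.Perm.mul_apply, h1, hq]

/-- Both pairs are images of the same pair of representatives. Together with the invariance of the
colours, this identifies the colour classes with the orbitals. -/
theorem exists_map_pair {p q p' q' : W} (h : col p q = col p' q') :
    ∃ g ∈ bigGroup, g p = p' ∧ g q = q' := by
  obtain ⟨g, hg, h1, h2⟩ := exists_pair_rep p q
  obtain ⟨g', hg', h1', h2'⟩ := exists_pair_rep p' q'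
  refine ⟨g' * g⁻¹, mul_mem hg' (inv_mem hg), ?_, ?_⟩
  · rw [Equiv.Perm.mul_apply, ← h1', ← h1]
    congr 1
    exact g.symm_apply_apply _
  · rw [Equiv.Perm.mul_apply, ← h2', ← h2, h]
    congr 1
    exact g.symm_apply_apply _

/-! ## Coloured sets whose colour classes are the orbitals of a group -/

/-- The colours `c` of the ordered pairs number the nine orbitals of `H`, and `P i j k` are the
intersection numbers. -/
structure IsScheme {Ω : Type*} (H : Subgroup (Equiv.Perm Ω)) (c : Ω → Ω → ℕ) (P : ℕ → ℕ → ℕ → ℕ) :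
    Prop where
  lt : ∀ p q, c p q < 9
  symm : ∀ p q, c p q = c q p
  eq_zero_iff : ∀ p q, c p q = 0 ↔ p = q
  map_eq : ∀ g ∈ H, ∀ p q, c (g p) (g q) = c p q
  exists_map : ∀ p q p' q', c p q = c p' q' → ∃ g ∈ H, g p = p' ∧ g q = q'
  exists_color : ∀ p, ∀ k < 9, ∃ q, c p q = k
  ncard_eq : ∀ p q, ∀ i < 9, ∀ j < 9, {z | c p z = i ∧ c z q = j}.ncard = P i j (c p q)

namespace IsScheme

variable {Ω : Type*} {H : Subgroup (Equiv.Perm Ω)} {c : Ω → Ω → ℕ} {P : ℕ → ℕ → ℕ → ℕ}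

theorem isPretransitive (h : IsScheme H c P) : MulAction.IsPretransitive H Ω where
  exists_smul_eq p q := by
    obtain ⟨g, hg, h1, -⟩ := h.exists_map p p q q
      (((h.eq_zero_iff p p).mpr rfl).trans ((h.eq_zero_iff q q).mpr rfl).symm)
    exact ⟨⟨g, hg⟩, h1⟩

theorem mem_orbit_iff (h : IsScheme H c P) (a b : Ω × Ω) :
    a ∈ MulAction.orbit H b ↔ c a.1 a.2 = c b.1 b.2 := by
  constructor
  · rintro ⟨g, rfl⟩
    exact h.map_eq g g.2 b.1 b.2
  · intro hab
    obtain ⟨g, hg, h1, h2⟩ := h.exists_map b.1 b.2 a.1 a.2 hab.symm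
    exact ⟨⟨g, hg⟩, Prod.ext h1 h2⟩

theorem permRank_eq [Nonempty Ω] (h : IsScheme H c P) : permRank H = 9 := by
  have e : MulAction.orbitRel.Quotient H (Ω × Ω) ≃ Fin 9 := by
    refine Equiv.ofBijective (Quotient.lift (fun a => ⟨c a.1 a.2, h.lt _ _⟩) ?_) ⟨?_, ?_⟩
    · intro a b hab
      exact Fin.ext ((h.mem_orbit_iff a b).mp hab)
    · intro a b
      induction a using Quotient.inductionOn with | _ a
      induction b using Quotient.inductionOn with | _ b
      intro hab
      exact Quotient.sound ((h.mem_orbit_iff a b).mpr (Fin.ext_iff.mp hab))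
    · rintro ⟨k, hk⟩
      obtain ⟨p⟩ := ‹Nonempty Ω›
      obtain ⟨q, hq⟩ := h.exists_color p k hk
      exact ⟨Quotient.mk _ (p, q), Fin.ext hq⟩
  rw [permRank, Nat.card_congr e, Nat.card_fin]

/-- The case `p = q` of the intersection numbers: by symmetry `z` has colour `k` seen from both
ends. -/
theorem ncard_valency (h : IsScheme H c P) (p : Ω) {k : ℕ} (hk : k < 9) :
    {q | c p q = k}.ncard = P k k 0 := by
  rw [← (h.eq_zero_iff p p).mpr rfl, ← h.ncard_eq p p k hk k hk]
  congr 1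
  ext z
  simp only [Set.mem_ofPred_eq, h.symm z p, and_self]

theorem mem_stabilizer_orbit_iff (h : IsScheme H c P) (p a b : Ω) :
    a ∈ MulAction.orbit (MulAction.stabilizer H p) b ↔ c p a = c p b := by
  constructor
  · rintro ⟨⟨⟨g, hg⟩, hgp⟩, rfl⟩
    have hp : g p = p := hgp
    change c p (g b) = _
    conv_lhs => rw [← hp]
    exact h.map_eq g hg p b
  · intro hab
    obtain ⟨g, hg, h1, h2⟩ := h.exists_map p b p a hab.symm
    exact ⟨⟨⟨g, hg⟩, h1⟩, h2⟩

theorem suborbitLengths_eq [Finite Ω] (h : IsScheme H c P) (p : Ω) :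
    suborbitLengths H p = (Multiset.range 9).map fun k => P k k 0 := by
  let := Fintype.ofFinite (MulAction.orbitRel.Quotient (MulAction.stabilizer H p) Ω)
  have hbij : Function.Bijective (Quotient.lift (fun a => (⟨c p a, h.lt _ _⟩ : Fin 9))
      (fun a b hab => Fin.ext ((h.mem_stabilizer_orbit_iff p a b).mp hab)) :
      MulAction.orbitRel.Quotient (MulAction.stabilizer H p) Ω → Fin 9) := by
    constructor
    · intro a b
      induction a using Quotient.inductionOn with | _ a
      induction b using Quotient.inductionOn with | _ b
      intro hab
      exact Quotient.sound ((h.mem_stabilizer_orbit_iff p a b).mpr (Fin.ext_iff.mp hab))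
    · rintro ⟨k, hk⟩
      obtain ⟨q, hq⟩ := h.exists_color p k hk
      exact ⟨Quotient.mk _ q, Fin.ext hq⟩
  let e := Equiv.ofBijective _ hbij
  have horb : ∀ O : MulAction.orbitRel.Quotient (MulAction.stabilizer H p) Ω,
      O.orbit.ncard = P (e O) (e O) 0 := by
    intro O
    induction O using Quotient.inductionOn with | _ a
    rw [← h.ncard_valency p (e _).2]
    congr 1
    ext b
    exact h.mem_stabilizer_orbit_iff p b a
  have h1 : (Multiset.range 9).map (fun k => P k k 0)
      = (Finset.univ : Finset (Fin 9)).val.map fun k : Fin 9 => P k k 0 := rfl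
  rw [h1, ← Finset.univ_map_equiv_to_embedding e, Finset.map_val, Multiset.map_map, suborbitLengths]
  exact Multiset.map_congr rfl fun O _ => horb O

theorem colGraph_adj (h : IsScheme H c P) {S : ℕ} (hS : S.testBit 0 = false) (p q : Ω) :
    (colGraph c h.symm S).Adj p q ↔ S.testBit (c p q) = true := by
  refine ⟨fun hh => hh.2, fun hh => ⟨?_, hh⟩⟩
  rintro rfl
  rw [(h.eq_zero_iff p p).mpr rfl, hS] at hh
  exact absurd hh Bool.false_ne_true

end IsScheme

/-! ## Distances in unions of colour classes -/

/-- The sum of `f k` for `k < n`. -/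
def sumBelow (n : ℕ) (f : ℕ → ℕ) : ℕ := Nat.rec 0 (fun k ih => Nat.add (f k) ih) n

theorem sumBelow_eq (n : ℕ) (f : ℕ → ℕ) : sumBelow n f = ∑ k ∈ Finset.range n, f k := by
  induction n with
  | zero => rfl
  | succ n ih =>
    rw [Finset.sum_range_succ, ← ih]
    exact Nat.add_comm (f n) (sumBelow n f)

theorem ncard_eq_sum_fibers {Ω : Type*} [Finite Ω] (Q : Ω → Prop) (f : Ω → ℕ) {n : ℕ}
    (hf : ∀ x, f x < n) (A : ℕ → Bool) : {x | Q x ∧ A (f x) = true}.ncard =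
      sumBelow n fun i => cond (A i) {x | Q x ∧ f x = i}.ncard 0 := by
  classical
  have := Fintype.ofFinite Ω
  rw [sumBelow_eq, Set.ncard_eq_toFinset_card', Finset.card_eq_sum_card_fiberwise (f := f)
    (t := Finset.range n) (fun x _ => Finset.mem_coe.mpr (Finset.mem_range.mpr (hf x)))]
  refine Finset.sum_congr rfl fun i _ => ?_
  cases hA : A i with
  | false =>
    rw [cond_false, Finset.card_eq_zero, Finset.filter_eq_empty_iff]
    rintro x hx rfl
    simp [hA] at hx
  | true =>
    rw [cond_true, Set.ncard_eq_toFinset_card']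
    congr 1
    ext x
    simp only [Finset.mem_filter, Set.mem_toFinset, Set.mem_ofPred_eq]
    constructor
    · exact fun hx => ⟨hx.1.1, hx.2⟩
    · exact fun hx => ⟨⟨hx.1, by rw [hx.2, hA]⟩, hx.2⟩

/-- The number of neighbours `z` of `q` with `c p z = i`, where `c p q = k` and `S` is the set of
colours of the edges. -/
def adjNum (P : ℕ → ℕ → ℕ → ℕ) (S i k : ℕ) : ℕ :=
  sumBelow 9 fun j => cond (Nat.testBit S j) (P i j k) 0

/-- The digits of `d` in base `16` are the distances, in the graph with set of colours `S`, of the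
pairs with the various colours. -/
def isDistTable (P : ℕ → ℕ → ℕ → ℕ) (S d : ℕ) : Bool :=
  Nat.beq (entry 4 d 0) 0 && allBelow 9 fun k =>
    (Nat.beq k 0 || !allBelow 9 fun i =>
      !(Nat.beq (Nat.succ (entry 4 d i)) (entry 4 d k) && Nat.blt 0 (adjNum P S i k))) &&
    allBelow 9 fun i => Nat.beq (adjNum P S i k) 0 || Nat.ble (entry 4 d k) (Nat.succ (entry 4 d i))

/-- The number of neighbours of `q` at distance `n` from `p`, where `c p q = k`. -/
def nbrNum (P : ℕ → ℕ → ℕ → ℕ) (S d n k : ℕ) : ℕ :=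
  sumBelow 9 fun i => cond (Nat.beq (entry 4 d i) n) (adjNum P S i k) 0

/-- The numbers `nbrNum` depend only on the distance. -/
def isUniform (P : ℕ → ℕ → ℕ → ℕ) (S d : ℕ) : Bool :=
  allBelow 9 fun k => allBelow k fun l => !Nat.beq (entry 4 d k) (entry 4 d l) ||
    allBelow 9 fun n => Nat.beq (nbrNum P S d n k) (nbrNum P S d n l)

/-- A proper set `C` of colours that is closed under steps along edges. -/
def isClosed (P : ℕ → ℕ → ℕ → ℕ) (S C : ℕ) : Bool :=
  Nat.testBit C 0 && (!allBelow 9 fun k => Nat.testBit C k) && allBelow 9 fun i =>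
    !Nat.testBit C i || allBelow 9 fun k => Nat.testBit C k || Nat.beq (adjNum P S k i) 0

namespace IsScheme

variable {Ω : Type*} [Finite Ω] {H : Subgroup (Equiv.Perm Ω)} {c : Ω → Ω → ℕ}
  {P : ℕ → ℕ → ℕ → ℕ} {S d : ℕ}

theorem ncard_adj (h : IsScheme H c P) (hS : S.testBit 0 = false) (p q : Ω) {i : ℕ} (hi : i < 9) :
    {z | (colGraph c h.symm S).Adj q z ∧ c p z = i}.ncard = adjNum P S i (c p q) := by
  have h1 : {z | (colGraph c h.symm S).Adj q z ∧ c p z = i}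
      = {z | c p z = i ∧ S.testBit (c z q) = true} := by
    ext z
    simp only [Set.mem_ofPred_eq, h.colGraph_adj hS, h.symm q z, and_comm]
  rw [h1, ncard_eq_sum_fibers _ (fun z => c z q) (fun z => h.lt z q), adjNum, sumBelow_eq, sumBelow_eq]
  refine Finset.sum_congr rfl fun j hj => ?_
  rw [h.ncard_eq p q i hi j (Finset.mem_range.mp hj)]

theorem exists_adj_iff (h : IsScheme H c P) (hS : S.testBit 0 = false) (p q : Ω) {i : ℕ}
    (hi : i < 9) :
    (∃ z, (colGraph c h.symm S).Adj q z ∧ c p z = i) ↔ adjNum P S i (c p q) ≠ 0 := by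
  rw [← h.ncard_adj hS p q hi, ← Nat.pos_iff_ne_zero, Set.ncard_pos]
  rfl

/-- A function of `q` is the distance from `p` if it is 0 at `p`, drops by exactly one along some
edge at every other vertex, and never rises by more than one along an edge. The drops build a walk
of the right length, and the bound on the rise shows that no walk is shorter. The two conditions in
`isDistTable` state this for colours. -/
theorem connected_and_dist_eq [Nonempty Ω] (h : IsScheme H c P) (hS : S.testBit 0 = false)
    (hd : isDistTable P S d = true) : (colGraph c h.symm S).Connected ∧
      ∀ p q, (colGraph c h.symm S).dist p q = entry 4 d (c p q) := by
  set X := colGraph c h.symm S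
  rw [isDistTable, Bool.and_eq_true, allBelow_iff] at hd
  obtain ⟨hd0, hd⟩ := hd
  have hd0 : entry 4 d 0 = 0 := Nat.eq_of_beq_eq_true hd0
  have hup : ∀ p q z, X.Adj q z → entry 4 d (c p q) ≤ entry 4 d (c p z) + 1 := by
    intro p q z hz
    have h1 := hd _ (h.lt p q)
    rw [Bool.and_eq_true, allBelow_iff] at h1
    have h2 := h1.2 _ (h.lt p z)
    rw [Bool.or_eq_true] at h2
    rcases h2 with h2 | h2
    · exact absurd (Nat.eq_of_beq_eq_true h2)
        ((h.exists_adj_iff hS p q (h.lt p z)).mp ⟨z, hz, rfl⟩)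
    · exact Nat.le_of_ble_eq_true h2
  have hdown : ∀ p q, p ≠ q → ∃ z, X.Adj q z ∧ entry 4 d (c p z) + 1 = entry 4 d (c p q) := by
    intro p q hpq
    have h1 := hd _ (h.lt p q)
    rw [Bool.and_eq_true, Bool.or_eq_true] at h1
    rcases h1.1 with h2 | h2
    · exact absurd ((h.eq_zero_iff p q).mp (Nat.eq_of_beq_eq_true h2)) hpq
    · rw [Bool.not_eq_true', Bool.eq_false_iff, ne_eq, allBelow_iff] at h2
      push Not at h2
      obtain ⟨i, hi, h3⟩ := h2
      rw [ne_eq, Bool.not_eq_true', Bool.not_eq_false, Bool.and_eq_true] at h3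
      obtain ⟨z, hz, rfl⟩ := (h.exists_adj_iff hS p q hi).mpr
        (Nat.pos_iff_ne_zero.mp (Nat.le_of_ble_eq_true h3.2))
      exact ⟨z, hz, Nat.eq_of_beq_eq_true h3.1⟩
  have hwalk : ∀ n p q, entry 4 d (c p q) = n → ∃ w : X.Walk q p, w.length = n := by
    intro n
    induction n with
    | zero =>
      intro p q hn
      by_cases hpq : p = q
      · subst hpq
        exact ⟨.nil, rfl⟩
      · obtain ⟨z, -, hz⟩ := hdown p q hpq
        omega
    | succ n ih =>
      intro p q hn
      by_cases hpq : p = q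
      · rw [(h.eq_zero_iff p q).mpr hpq] at hn
        omega
      · obtain ⟨z, hz, hz'⟩ := hdown p q hpq
        obtain ⟨w, hw⟩ := ih p z (by omega)
        exact ⟨.cons hz w, by rw [SimpleGraph.Walk.length_cons, hw]⟩
  have hle : ∀ p q (w : X.Walk q p), entry 4 d (c p q) ≤ w.length := by
    intro p q w
    induction w with
    | nil => rw [(h.eq_zero_iff _ _).mpr rfl, hd0]; exact Nat.zero_le _
    | cons hz w ih => exact (hup _ _ _ hz).trans (Nat.succ_le_succ ih)
  have hconn : X.Connected :=
    { preconnected := fun p q => (hwalk _ q p rfl).choose.reachable }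
  refine ⟨hconn, fun p q => ?_⟩
  rw [SimpleGraph.dist_comm]
  obtain ⟨w, hw⟩ := hwalk _ p q rfl
  obtain ⟨w', hw'⟩ := hconn.exists_walk_length_eq_dist q p
  exact le_antisymm (hw ▸ SimpleGraph.dist_le w) (hw' ▸ hle p q w')

theorem numNbrsAtDist_eq [Nonempty Ω] (h : IsScheme H c P) (hS : S.testBit 0 = false)
    (hd : isDistTable P S d = true) (u w : Ω) (n : ℕ) :
    numNbrsAtDist (colGraph c h.symm S) u w n = nbrNum P S d n (c u w) := by
  have h1 : {x | (colGraph c h.symm S).Adj w x ∧ (colGraph c h.symm S).dist u x = n}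
      = {x | (colGraph c h.symm S).Adj w x ∧ Nat.beq (entry 4 d (c u x)) n = true} := by
    ext x
    simp only [Set.mem_ofPred_eq, (h.connected_and_dist_eq hS hd).2, Nat.beq_eq]
  rw [numNbrsAtDist, h1, ncard_eq_sum_fibers _ (c u) (fun x => h.lt u x)
    (fun i => Nat.beq (entry 4 d i) n), nbrNum, sumBelow_eq, sumBelow_eq]
  refine Finset.sum_congr rfl fun i hi => ?_
  rw [h.ncard_adj hS u w (Finset.mem_range.mp hi)]

/-- The numbers in question depend only on the colour of the pair, so distance-regularity means that
colours at the same distance have the same numbers. All distances are below 9, so finitely many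
comparisons decide this. -/
theorem isDistanceRegular_iff [Nonempty Ω] (h : IsScheme H c P) (hS : S.testBit 0 = false)
    (hd : isDistTable P S d = true) (hd9 : allBelow 9 (fun k => Nat.blt (entry 4 d k) 9) = true) :
    IsDistanceRegular (colGraph c h.symm S) ↔ isUniform P S d = true := by
  obtain ⟨hconn, hdist⟩ := h.connected_and_dist_eq hS hd
  have hd9 : ∀ k < 9, entry 4 d k < 9 := fun k hk => Nat.le_of_ble_eq_true (allBelow_iff.mp hd9 k hk)
  constructor
  · rintro ⟨-, hr⟩
    obtain ⟨p⟩ := ‹Nonempty Ω›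
    rw [isUniform, allBelow_iff]
    intro k hk
    rw [allBelow_iff]
    intro l hl
    obtain ⟨q, rfl⟩ := h.exists_color p k hk
    obtain ⟨q', rfl⟩ := h.exists_color p l (hl.trans hk)
    rw [Bool.or_eq_true, Bool.not_eq_true', Bool.eq_false_iff, allBelow_iff, ne_eq, Nat.beq_eq,
      ← imp_iff_not_or]
    intro hkl n _
    rw [Nat.beq_eq, ← h.numNbrsAtDist_eq hS hd, ← h.numNbrsAtDist_eq hS hd]
    exact hr _ _ _ _ (by rw [hdist, hdist, hkl]) n
  · intro hu
    refine ⟨hconn, fun u w u' w' hh n => ?_⟩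
    rw [hdist, hdist] at hh
    rw [h.numNbrsAtDist_eq hS hd, h.numNbrsAtDist_eq hS hd]
    by_cases hn : n < 9
    · have key : ∀ k < 9, ∀ l < k, entry 4 d k = entry 4 d l →
          nbrNum P S d n k = nbrNum P S d n l := by
        intro k hk l hl hkl
        have h1 := allBelow_iff.mp (allBelow_iff.mp hu k hk) l hl
        rw [Bool.or_eq_true, Bool.not_eq_true', Bool.eq_false_iff, allBelow_iff, ne_eq, Nat.beq_eq,
          ← imp_iff_not_or] at h1
        exact Nat.eq_of_beq_eq_true (h1 hkl n hn)
      rcases lt_trichotomy (c u w) (c u' w') with hlt | heq | hlt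
      · exact (key _ (h.lt _ _) _ hlt hh.symm).symm
      · rw [heq]
      · exact key _ (h.lt _ _) _ hlt hh
    -- No colour is at distance 9 or more, so both counts are empty sums.
    · have hz : ∀ k, nbrNum P S d n k = 0 := by
        intro k
        rw [nbrNum, sumBelow_eq]
        refine Finset.sum_eq_zero fun i hi => ?_
        have h1 : Nat.beq (entry 4 d i) n = false := by
          rw [Bool.eq_false_iff, ne_eq, Nat.beq_eq]
          have := hd9 i (Finset.mem_range.mp hi)
          omega
        rw [h1, cond_false]
      rw [hz, hz]

/-- A walk from `p` stays within the colours of `C`, while every colour occurs at `p`, including one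
outside `C`. -/
theorem not_connected (h : IsScheme H c P) (hS : S.testBit 0 = false) {C : ℕ}
    (hC : isClosed P S C = true) : ¬ (colGraph c h.symm S).Connected := by
  intro hconn
  rw [isClosed, Bool.and_eq_true, Bool.and_eq_true, Bool.not_eq_true', Bool.eq_false_iff, ne_eq,
    allBelow_iff, allBelow_iff] at hC
  obtain ⟨⟨h0, h1⟩, h2⟩ := hC
  push Not at h1
  obtain ⟨k, hk, hCk⟩ := h1
  obtain ⟨p⟩ := hconn.nonempty
  obtain ⟨q, rfl⟩ := h.exists_color p k hk
  refine hCk ?_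
  obtain ⟨w⟩ := hconn.preconnected q p
  induction w with
  | nil => rwa [(h.eq_zero_iff _ _).mpr rfl]
  | @cons q z p hz w ih =>
    have hz' : C.testBit (c p z) = true := by
      by_contra hne
      exact hne (ih (h.lt _ _) hne)
    have h3 := h2 _ (h.lt p z)
    rw [hz', Bool.not_true, Bool.false_or, allBelow_iff] at h3
    have h4 := h3 _ (h.lt p q)
    rw [Bool.or_eq_true] at h4
    rcases h4 with h4 | h4
    · exact h4
    · exact absurd (Nat.eq_of_beq_eq_true h4)
        ((h.exists_adj_iff hS p z (h.lt p q)).mp ⟨q, hz.symm, rfl⟩)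

end IsScheme

/-! ## Intersection numbers -/

/-- The vertices by number: first the points, then the blocks. -/
def vert (v : ℕ) : W := cond (Nat.ble 243 v) (.inr (dec v)) (.inl (dec v))

theorem vert_inl {v : ℕ} (hv : v < 243) : vert v = .inl (dec v) := by
  have h : Nat.ble 243 v = false := by
    rw [Bool.eq_false_iff, ne_eq, Nat.ble_eq]
    omega
  rw [vert, h, cond_false]

theorem vert_inr {v : ℕ} (hv : 243 ≤ v) : vert v = .inr (dec v) := by
  rw [vert, Nat.ble_eq_true_of_le hv, cond_true]

theorem vert_add (n : ℕ) : vert (n + 243) = .inr (dec n) := by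
  rw [vert_inr (Nat.le_add_left _ _), dec_add_243]

/-- The number of a vertex. -/
def vnum : W → ℕ := Sum.elim enc fun x => enc x + 243

theorem vnum_lt (p : W) : vnum p < 486 := by
  rcases p with x | x
  · exact (enc_lt x).trans (by norm_num)
  · exact Nat.add_lt_add_right (enc_lt x) 243

theorem vert_vnum (p : W) : vert (vnum p) = p := by
  rcases p with x | x
  · exact (vert_inl (enc_lt x)).trans (by rw [dec_enc])
  · exact (vert_add (enc x)).trans (by rw [dec_enc])

theorem vnum_vert {v : ℕ} (hv : v < 486) : vnum (vert v) = v := by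
  by_cases h : v < 243
  · rw [vert_inl h]
    exact enc_dec h
  · obtain ⟨n, rfl⟩ := Nat.exists_eq_add_of_le' (not_lt.mp h)
    rw [vert_add]
    exact congrArg (· + 243) (enc_dec (by omega))

/-- The numbering of the vertices. -/
def vertEquiv : Fin 486 ≃ W where
  toFun v := vert v
  invFun p := ⟨vnum p, vnum_lt p⟩
  left_inv v := Fin.ext (vnum_vert v.2)
  right_inv p := vert_vnum p

/-- The colour of a pair of vertices given by their numbers. -/
def colN (a b : ℕ) : ℕ :=
  cond (Nat.ble 243 a)
    (cond (Nat.ble 243 b) (linColN (subN a b)) (affColN (subN b a)))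
    (cond (Nat.ble 243 b) (affColN (subN a b)) (linColN (subN a b)))

theorem col_vert (a b : ℕ) : col (vert a) (vert b) = colN a b := by
  rw [vert, vert, colN]
  cases Nat.ble 243 a <;> cases Nat.ble 243 b <;>
    simp only [cond_true, cond_false, col, ← dec_subN] <;>
    first | exact linCol_dec (subN_lt _ _) | exact affCol_dec (subN_lt _ _)

theorem sum_mul_pow_injective {B M : ℕ} {a b : ℕ → ℕ} (ha : ∀ m < M, a m < B)
    (hb : ∀ m < M, b m < B)
    (h : ∑ m ∈ Finset.range M, a m * B ^ m = ∑ m ∈ Finset.range M, b m * B ^ m) :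
    ∀ m < M, a m = b m := by
  induction M generalizing a b with
  | zero => exact fun m hm => absurd hm (Nat.not_lt_zero m)
  | succ M ih =>
    have hsum : ∀ f : ℕ → ℕ, ∑ m ∈ Finset.range (M + 1), f m * B ^ m
        = B * (∑ m ∈ Finset.range M, f (m + 1) * B ^ m) + f 0 := by
      intro f
      rw [Finset.sum_range_succ', pow_zero, mul_one, Finset.mul_sum]
      congr 1
      exact Finset.sum_congr rfl fun m _ => by ring
    rw [hsum a, hsum b] at h
    have h0 : a 0 = b 0 := by
      have h1 := congrArg (· % B) h
      simpa [Nat.mul_add_mod, Nat.mod_eq_of_lt (ha 0 M.succ_pos),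
        Nat.mod_eq_of_lt (hb 0 M.succ_pos)] using h1
    have hB : 0 < B := (Nat.zero_le _).trans_lt (ha 0 M.succ_pos)
    have hrest := ih (fun m hm => ha (m + 1) (Nat.succ_lt_succ hm))
      (fun m hm => hb (m + 1) (Nat.succ_lt_succ hm))
      (Nat.eq_of_mul_eq_mul_left hB (by omega))
    intro m hm
    cases m with
    | zero => exact h0
    | succ m => exact hrest m (Nat.lt_of_succ_lt_succ hm)

/-- Counting the values of a function by means of the digits of one number. -/
theorem card_filter_eq_of_sum_pow {N M B : ℕ} {f b : ℕ → ℕ} (hN : N < B) (hf : ∀ v < N, f v < M)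
    (hb : ∀ m < M, b m < B)
    (h : sumBelow N (fun v => B ^ f v) = sumBelow M fun m => b m * B ^ m) {m : ℕ} (hm : m < M) :
    ((Finset.range N).filter fun v => f v = m).card = b m := by
  refine sum_mul_pow_injective (M := M) (B := B)
    (a := fun m => ((Finset.range N).filter fun v => f v = m).card) (b := b) (fun m _ => ?_) hb ?_ m hm
  -- Every count is at most `N < B`, so no carries occur and the counts are the digits in base `B`.
  · exact ((Finset.card_filter_le _ _).trans (Finset.card_range N).le).trans_lt hN
  · rw [sumBelow_eq, sumBelow_eq] at h
    rw [← h, ← Finset.sum_fiberwise_of_maps_to (t := Finset.range M) (g := f)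
      (fun v hv => Finset.mem_range.mpr (hf v (Finset.mem_range.mp hv)))]
    refine Finset.sum_congr rfl fun m _ => ?_
    rw [Finset.sum_congr rfl (g := fun _ => B ^ m), Finset.sum_const, smul_eq_mul]
    intro v hv
    rw [(Finset.mem_filter.mp hv).2]

/-- The `729` intersection numbers. -/
def interTable : ℕ := 2133184972328154028520835082644644829099860149274638832552990147047483304076949223594045866749242808288939730266185386361056288405671297255205984869942531565827328937361737153684025767338808714092123644797125188957539034721077792479587731492129364410080509363088627212247234856507722071647627442365557407093204824404148344977895949315657803687513112803865131408848224312901530739064659415777783023873574543034331280409171684234370051612525696972685316465164141923725268188469929396998285032362567354480895484888266565077152561234899034805926014118784769098258085114766555545522918052107711096297592944664517523973575122642887273825639785964769900124029312088300600001781684611723564586888356862949271644525315334975283071877947585957234707822845282097353869915050893473032127548751258710865793857475253667084772106863283585403805957330070583740519318708064919362643195492366729111694293066977887377987202008664712931016998595548729141670044795563731735078239187661136081831350289071367705952973695474236508830602548722829100239904348324323468971628272718292087963875096475177187924060274065221904848330322907461223679187326094194744334579697064617444504008960691428031792968575652271178185024641479833629003456953673050507425911639748427985265032205526821545929643535734297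008360956143954366752262421241675650255430147148214628778181724603478166729713542196628379174772747543198381017375190546836461697430909931450797258019597818700976705945906371374664705242440609305575575300257507933773209573431978093659182377809427547872521683208775442416194378674528036653110236296214070402883604403443360626405745903142233041785807573957981139417180981250231314496107194040964436762954022496893957611444948178268445788794585127085456660090521949621228543513909526529

/-- The number of `z` with `col p z = i` and `col z q = j`, where `col p q = k`. -/
def interNum (i j k : ℕ) : ℕ := entry 8 interTable (Nat.add (Nat.mul 81 k) (Nat.add (Nat.mul 9 i) j))

/-- The number of the vertex `repVertex k`. -/
def repCode (k : ℕ) : ℕ :=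
  cond (Nat.beq k 3 || Nat.ble 5 k && Nat.ble k 7) (Nat.add (subN 0 (repN k)) 243) (repN k)

theorem repVertex_eq : ∀ k < 9, repVertex k = vert (repCode k) := by
  have h : ∀ k < 9, (Nat.beq k 3 || Nat.ble 5 k && Nat.ble k 7)
      = decide (k ∈ ({3, 5, 6, 7} : Finset ℕ)) := by decide
  intro k hk
  rw [repVertex, repCode, h k hk]
  by_cases hm : k ∈ ({3, 5, 6, 7} : Finset ℕ)
  · rw [if_pos hm, decide_eq_true hm, cond_true]
    refine Eq.trans ?_ (vert_add _).symm
    rw [dec_subN, dec_zero, zero_sub]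
  · rw [if_neg hm, decide_eq_false hm, cond_false, vert_inl (repN_lt k)]

theorem colN_repCode : ∀ k < 9, colN 0 (repCode k) = k := by decide +kernel

theorem vert_zero : vert 0 = .inl 0 := by rw [vert_inl (by norm_num), dec_zero]

theorem col_repVertex {k : ℕ} (hk : k < 9) : col (.inl 0) (repVertex k) = k := by
  rw [repVertex_eq k hk, ← vert_zero, col_vert, colN_repCode k hk]

/-- For each `k` one large number records all 81 counts: a vertex with colours `i` and `j`
contributes `1024 ^ (9 * i + j)`. There are only 486 vertices, so the digits in base 1024 do not
overflow. -/
theorem interNum_check : allBelow 9 (fun k => Nat.beq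
    (sumBelow 486 fun v =>
      Nat.pow 1024 (Nat.add (Nat.mul 9 (colN 0 v)) (colN v (repCode k))))
    (sumBelow 81 fun m =>
      Nat.mul (entry 8 interTable (Nat.add (Nat.mul 81 k) m)) (Nat.pow 1024 m))) = true := by
  decide +kernel

theorem entry_lt (b T i : ℕ) : entry b T i < 2 ^ b := by
  have h1 : entry b T i ≤ 1 <<< b - 1 := Nat.and_le_right
  rw [Nat.one_shiftLeft] at h1
  have h2 : 0 < 2 ^ b := by positivity
  omega

theorem ncard_rep {k : ℕ} (hk : k < 9) {i j : ℕ} (hi : i < 9) (hj : j < 9) :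
    {z | col (.inl 0) z = i ∧ col z (repVertex k) = j}.ncard = interNum i j k := by
  have h1 : {z | col (.inl 0) z = i ∧ col z (repVertex k) = j} = vertEquiv ''
      {v | colN 0 v = i ∧ colN v (repCode k) = j} := by
    ext z
    rw [Equiv.image_eq_preimage_symm]
    change _ ↔ colN 0 (vnum z) = i ∧ colN (vnum z) (repCode k) = j
    rw [← col_vert, ← col_vert, vert_vnum, vert_zero, ← repVertex_eq k hk]
    rfl
  have h9 : ∀ a b, colN a b < 9 := fun a b => col_vert a b ▸ col_lt _ _
  have h2 : ({v : Fin 486 | colN 0 v = i ∧ colN v (repCode k) = j}.ncard) =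
      ((Finset.range 486).filter fun v => 9 * colN 0 v + colN v (repCode k) = 9 * i + j).card := by
    rw [← Set.ncard_image_of_injective _ Fin.val_injective, ← Set.ncard_coe_finset]
    congr 1
    ext v
    simp only [Set.mem_image, Set.mem_ofPred_eq, Finset.coe_filter, Finset.mem_range]
    constructor
    · rintro ⟨v, ⟨h1, h2⟩, rfl⟩
      exact ⟨v.2, by rw [h1, h2]⟩
    · rintro ⟨hv, h⟩
      have := h9 v (repCode k)
      exact ⟨⟨v, hv⟩, by change colN 0 v = i ∧ colN v (repCode k) = j; omega, rfl⟩
  rw [h1, Set.ncard_image_of_injective _ vertEquiv.injective, h2]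
  refine card_filter_eq_of_sum_pow (N := 486) (M := 81) (B := 1024)
    (f := fun v => 9 * colN 0 v + colN v (repCode k)) (b := fun m => entry 8 interTable (81 * k + m))
    (by norm_num) (fun v _ => ?_) (fun m _ => (entry_lt _ _ _).trans (by norm_num)) ?_
    (m := 9 * i + j) (by omega)
  · have := h9 0 v
    have := h9 v (repCode k)
    omega
  · exact Nat.eq_of_beq_eq_true (allBelow_iff.mp interNum_check k hk)

theorem isScheme : IsScheme bigGroup col interNum where
  lt := col_lt
  symm := col_symm
  eq_zero_iff := col_eq_zero_iff
  map_eq g hg := bigGroup_le_colGroup hg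
  exists_map _ _ _ _ h := exists_map_pair h
  exists_color p k hk := by
    obtain ⟨g, hg, rfl⟩ := exists_from_zero p
    exact ⟨g (repVertex k), by rw [bigGroup_le_colGroup hg, col_repVertex hk]⟩
  ncard_eq p q i hi j hj := by
    obtain ⟨g, hg, hp, hq⟩ := exists_pair_rep p q
    have h : {z | col p z = i ∧ col z q = j} =
        g '' {z | col (.inl 0) z = i ∧ col z (repVertex (col p q)) = j} := by
      ext z
      rw [Equiv.image_eq_preimage_symm]
      change _ ↔ col (.inl 0) (g⁻¹ z) = i ∧ col (g⁻¹ z) (repVertex (col p q)) = j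
      have hz : g (g⁻¹ z) = z := g.apply_symm_apply z
      rw [← bigGroup_le_colGroup hg, ← bigGroup_le_colGroup hg (g⁻¹ z), hz, hp, hq]
      rfl
    rw [h, Set.ncard_image_of_injective _ g.injective, ncard_rep (col_lt p q) hi hj]

/-! ## Distance-regular unions of colour classes -/

namespace IsScheme

variable {Ω : Type*} {H : Subgroup (Equiv.Perm Ω)} {c : Ω → Ω → ℕ} {P : ℕ → ℕ → ℕ → ℕ}

/-- The factor 2 keeps bit 0 clear: the diagonal orbital consists of loops and is never used. This
leaves 256 candidates. -/
theorem isUnionOfOrbitals_iff [Nonempty Ω] (h : IsScheme H c P) (X : SimpleGraph Ω) :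
    IsUnionOfOrbitals H X ↔ ∃ s < 256, X = colGraph c h.symm (2 * s) := by
  classical
  constructor
  · rintro ⟨𝒪, h𝒪, hX⟩
    have hcol : ∀ p q p' q', c p q = c p' q' → X.Adj p q → X.Adj p' q' := by
      intro p q p' q' hc hpq
      have h1 : (p, q) ∈ ⋃₀ 𝒪 := hX ▸ hpq
      obtain ⟨O, hO, hp⟩ := h1
      have h2 : (p', q') ∈ ⋃₀ 𝒪 := by
        refine ⟨O, hO, ?_⟩
        obtain ⟨r, rfl⟩ := h𝒪 O hO
        rw [h.mem_orbit_iff] at hp ⊢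
        exact hc.symm.trans hp
      rw [← hX] at h2
      exact h2
    -- Bit `k` of `s` stands for the colour `k + 1`, in accordance with the mask `2 * s`.
    let s : ℕ := Nat.ofBits fun k : Fin 8 => decide (∃ p q, c p q = k + 1 ∧ X.Adj p q)
    refine ⟨s, Nat.ofBits_lt_two_pow _, ?_⟩
    ext p q
    rw [h.colGraph_adj (by simp)]
    have hne : X.Adj p q → c p q ≠ 0 := fun hpq h0 => hpq.ne ((h.eq_zero_iff p q).mp h0)
    rcases hk : c p q with _ | k
    · simp only [Nat.testBit_zero, Nat.mul_mod_right]
      exact ⟨fun hpq => absurd hk (hne hpq), fun hh => by simp at hh⟩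
    · have hk8 : k < 8 := by
        have := h.lt p q
        omega
      rw [Nat.testBit_succ, Nat.mul_div_cancel_left _ (by norm_num), Nat.testBit_ofBits_lt _ _ hk8,
        decide_eq_true_iff]
      constructor
      · exact fun hpq => ⟨p, q, hk, hpq⟩
      · rintro ⟨p', q', h1, h2⟩
        exact hcol p' q' p q (h1.trans hk.symm) h2
  · rintro ⟨s, -, rfl⟩
    refine ⟨{O | ∃ p : Ω × Ω, (colGraph c h.symm (2 * s)).Adj p.1 p.2 ∧ O = MulAction.orbit H p},
      fun O ⟨p, _, hp⟩ => ⟨p, hp⟩, ?_⟩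
    ext p
    constructor
    · exact fun hp => ⟨_, ⟨p, hp, rfl⟩, MulAction.mem_orbit_self p⟩
    · rintro ⟨_, ⟨r, hr, rfl⟩, hp⟩
      rw [h.mem_orbit_iff] at hp
      change (colGraph c h.symm (2 * s)).Adj p.1 p.2
      rw [h.colGraph_adj (by simp)] at hr ⊢
      rwa [hp]

theorem hasIntersectionArray [Nonempty Ω] [Finite Ω] (h : IsScheme H c P) {S d : ℕ}
    (hS : S.testBit 0 = false) (hd : isDistTable P S d = true)
    (hd9 : allBelow 9 (fun k => Nat.blt (entry 4 d k) 9) = true) (hu : isUniform P S d = true)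
    {bs cs : List ℕ} (hlen : cs.length = bs.length)
    (hmax : ∀ k < 9, entry 4 d k ≤ bs.length) (hex : ∃ k < 9, entry 4 d k = bs.length)
    (hb : ∀ k < 9, ∀ (i : ℕ) (hi : i < bs.length), entry 4 d k = i → nbrNum P S d (i + 1) k = bs[i])
    (hc : ∀ k < 9, ∀ (i : ℕ) (hi : i < cs.length), entry 4 d k = i + 1 →
      nbrNum P S d i k = cs[i]) :
    HasIntersectionArray (colGraph c h.symm S) bs cs := by
  obtain ⟨hconn, hdist⟩ := h.connected_and_dist_eq hS hd
  have hdiam : (colGraph c h.symm S).diam = bs.length := by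
    apply le_antisymm
    · obtain ⟨u, v, huv⟩ := (colGraph c h.symm S).exists_dist_eq_diam
      rw [← huv, hdist]
      exact hmax _ (h.lt u v)
    · obtain ⟨k, hk, hkd⟩ := hex
      obtain ⟨p⟩ := ‹Nonempty Ω›
      obtain ⟨q, rfl⟩ := h.exists_color p k hk
      rw [← hkd, ← hdist]
      exact SimpleGraph.dist_le_diam (SimpleGraph.connected_iff_ediam_ne_top.mp hconn)
  refine ⟨(h.isDistanceRegular_iff hS hd hd9).mpr hu, hdiam, hdiam.trans hlen.symm, ?_, ?_⟩
  · intro i hi u w huw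
    rw [h.numNbrsAtDist_eq hS hd]
    exact hb _ (h.lt u w) i hi (hdist u w ▸ huw)
  · intro i hi u w huw
    rw [h.numNbrsAtDist_eq hS hd]
    exact hc _ (h.lt u w) i hi (hdist u w ▸ huw)

end IsScheme

/-- The colours in `L` and those one step along an edge further. -/
def growMask (P : ℕ → ℕ → ℕ → ℕ) (S L : ℕ) : ℕ :=
  sumBelow 9 fun k => cond (Nat.testBit L k || !allBelow 9 fun i =>
    !Nat.testBit L i || Nat.beq (adjNum P S i k) 0) (Nat.shiftLeft 1 k) 0

/-- The colours in the connected component of the colour `0`. -/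
def componentMask (P : ℕ → ℕ → ℕ → ℕ) (S : ℕ) : ℕ :=
  growMask P S (growMask P S (growMask P S (growMask P S (growMask P S (growMask P S 1)))))

/-- Adds one to the digits of `d` outside `L`. -/
def incDist (L d : ℕ) : ℕ :=
  Nat.add d (sumBelow 9 fun k => cond (Nat.testBit L k) 0 (Nat.shiftLeft 1 (Nat.mul 4 k)))

/-- The table of distances. -/
def distTable (P : ℕ → ℕ → ℕ → ℕ) (S : ℕ) : ℕ :=
  incDist (growMask P S (growMask P S (growMask P S 1))) <|
    incDist (growMask P S (growMask P S 1)) <| incDist (growMask P S 1) <| incDist 1 0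

/-- Whether a union of colour classes is certainly not distance-regular. -/
def isIrregular (P : ℕ → ℕ → ℕ → ℕ) (S C d : ℕ) : Bool :=
  isClosed P S C || isDistTable P S d && allBelow 9 (fun k => Nat.blt (entry 4 d k) 9) &&
    !isUniform P S d

/-- The six exceptions are the halves of the masks 12, 32, 40, 232, 508 and 510. Nothing has to be
known about how `componentMask` and `distTable` are computed, since `isClosed` and `isDistTable`
validate their values in each case. -/
theorem isIrregular_check : allBelow 256 (fun s =>
    Nat.beq s 6 || Nat.beq s 16 || Nat.beq s 20 || Nat.beq s 116 || Nat.beq s 254 ||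
    Nat.beq s 255 || isIrregular interNum (Nat.mul 2 s) (componentMask interNum (Nat.mul 2 s))
      (distTable interNum (Nat.mul 2 s))) = true := by
  decide +kernel

/-- The even masks of the six distance-regular unions of colour classes. -/
theorem isDistanceRegular_iff_mem {Ω : Type*} [Nonempty Ω] [Finite Ω] {H : Subgroup (Equiv.Perm Ω)}
    {c : Ω → Ω → ℕ} (h : IsScheme H c interNum) {s : ℕ} (hs : s < 256)
    (hr : IsDistanceRegular (colGraph c h.symm (2 * s))) :
    s = 6 ∨ s = 16 ∨ s = 20 ∨ s = 116 ∨ s = 254 ∨ s = 255 := by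
  have h1 := allBelow_iff.mp isIrregular_check s hs
  simp only [Bool.or_eq_true, Nat.beq_eq, or_assoc] at h1
  rcases h1 with h1 | h1 | h1 | h1 | h1 | h1 | h1
  any_goals omega
  have hS : (Nat.mul 2 s).testBit 0 = false := by
    rw [Nat.testBit_zero, decide_eq_false_iff_not]
    change ¬ (2 * s) % 2 = 1
    omega
  rw [isIrregular, Bool.or_eq_true, Bool.and_eq_true, Bool.and_eq_true, Bool.not_eq_true'] at h1
  rcases h1 with h1 | ⟨⟨h1, h2⟩, h3⟩
  · exact absurd hr.1 (h.not_connected hS h1)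
  · have h4 := (h.isDistanceRegular_iff hS h1 h2).mp hr
    rw [h4] at h3
    exact absurd h3 Bool.noConfusion

/-! ### Intersection arrays of the six unions -/

section Arrays

variable {Ω : Type*} [Nonempty Ω] [Finite Ω] {H : Subgroup (Equiv.Perm Ω)} {c : Ω → Ω → ℕ}

/-- The masks in this section: 510 has all colours but 0; 232 has the point–block colours 3, 5, 6,
7; 508 has all colours but 0 and 1; 32 is the colour 5; 12 has the colours 2 and 3, with valency 20
+ 36; 40 has the colours 3 and 5, with valency 36 + 45. -/
theorem hasIntersectionArray_top (h : IsScheme H c interNum) :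
    HasIntersectionArray (colGraph c h.symm 510) [485] [1] :=
  h.hasIntersectionArray (d := distTable interNum 510) (by decide) (by decide +kernel)
    (by decide +kernel) (by decide +kernel) rfl (by decide +kernel) (by decide +kernel)
    (by decide +kernel) (by decide +kernel)

theorem hasIntersectionArray_bip (h : IsScheme H c interNum) :
    HasIntersectionArray (colGraph c h.symm 232) [243, 242] [1, 243] :=
  h.hasIntersectionArray (d := distTable interNum 232) (by decide) (by decide +kernel)
    (by decide +kernel) (by decide +kernel) rfl (by decide +kernel) (by decide +kernel)
    (by decide +kernel) (by decide +kernel)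

theorem hasIntersectionArray_mult (h : IsScheme H c interNum) :
    HasIntersectionArray (colGraph c h.symm 508) [483, 2] [1, 483] :=
  h.hasIntersectionArray (d := distTable interNum 508) (by decide) (by decide +kernel)
    (by decide +kernel) (by decide +kernel) rfl (by decide +kernel) (by decide +kernel)
    (by decide +kernel) (by decide +kernel)

theorem hasIntersectionArray_kr (h : IsScheme H c interNum) :
    HasIntersectionArray (colGraph c h.symm 32) [45, 44, 36, 5] [1, 9, 40, 45] :=
  h.hasIntersectionArray (d := distTable interNum 32) (by decide) (by decide +kernel)
    (by decide +kernel) (by decide +kernel) rfl (by decide +kernel) (by decide +kernel)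
    (by decide +kernel) (by decide +kernel)

theorem hasIntersectionArray_soi (h : IsScheme H c interNum) :
    HasIntersectionArray (colGraph c h.symm 12) [56, 45, 16, 1] [1, 8, 45, 56] :=
  h.hasIntersectionArray (d := distTable interNum 12) (by decide) (by decide +kernel)
    (by decide +kernel) (by decide +kernel) rfl (by decide +kernel) (by decide +kernel)
    (by decide +kernel) (by decide +kernel)

theorem hasIntersectionArray_net (h : IsScheme H c interNum) :
    HasIntersectionArray (colGraph c h.symm 40) [81, 80, 54, 1] [1, 27, 80, 81] :=
  h.hasIntersectionArray (d := distTable interNum 40) (by decide) (by decide +kernel)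
    (by decide +kernel) (by decide +kernel) rfl (by decide +kernel) (by decide +kernel)
    (by decide +kernel) (by decide +kernel)

/-- The distance-regular unions of orbitals. -/
theorem isDistanceRegular_and_isUnionOfOrbitals_iff (h : IsScheme H c interNum) (X : SimpleGraph Ω) :
    IsDistanceRegular X ∧ IsUnionOfOrbitals H X ↔
      X ∈ ({colGraph c h.symm 510, colGraph c h.symm 232, colGraph c h.symm 508,
        colGraph c h.symm 32, colGraph c h.symm 12, colGraph c h.symm 40} : Set (SimpleGraph Ω)) := by
  rw [h.isUnionOfOrbitals_iff]
  simp only [Set.mem_insert_iff, Set.mem_singleton_iff]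
  constructor
  · rintro ⟨hr, s, hs, rfl⟩
    rcases isDistanceRegular_iff_mem h hs hr with rfl | rfl | rfl | rfl | rfl | rfl <;> simp
  · rintro (rfl | rfl | rfl | rfl | rfl | rfl)
    exacts [⟨(hasIntersectionArray_top h).1, 255, by norm_num, rfl⟩,
      ⟨(hasIntersectionArray_bip h).1, 116, by norm_num, rfl⟩,
      ⟨(hasIntersectionArray_mult h).1, 254, by norm_num, rfl⟩,
      ⟨(hasIntersectionArray_kr h).1, 16, by norm_num, rfl⟩,
      ⟨(hasIntersectionArray_soi h).1, 6, by norm_num, rfl⟩,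
      ⟨(hasIntersectionArray_net h).1, 20, by norm_num, rfl⟩]

end Arrays

theorem suborbitLengths_eq_list {Ω : Type*} [Finite Ω] {H : Subgroup (Equiv.Perm Ω)}
    {c : Ω → Ω → ℕ} (h : IsScheme H c interNum) (p : Ω) :
    suborbitLengths H p = {1, 2, 20, 36, 40, 45, 72, 90, 180} := by
  rw [h.suborbitLengths_eq]
  decide +kernel

/-! ## Rigidity of the Koolen–Riebeek graph -/

/-! ### Counting invariants of graph automorphisms -/

section Invariants

variable {Ω : Type*} (X : SimpleGraph Ω)

/-- The vertices `a`, `b`, `c` have exactly one common neighbour. -/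
def UniqueCommonNbr (a b c : Ω) : Prop := ∃! w, X.Adj a w ∧ X.Adj b w ∧ X.Adj c w

/-- The number of neighbours of `b` that have exactly one common neighbour with `x` and `y`. -/
noncomputable def tripleCount (b x y : Ω) : ℕ := {z | X.Adj b z ∧ UniqueCommonNbr X x y z}.ncard

open Classical in
/-- A number that describes the position of `z` relative to `a₁`, `a₂`, `b` and the vertices `F`. -/
noncomputable def signature (b a₁ a₂ : Ω) (F : List Ω) (z : Ω) : ℕ :=
  F.foldr (fun f acc => acc * 64 + tripleCount X b f z) (if UniqueCommonNbr X a₁ a₂ z then 1 else 0)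

variable {X}

theorem uniqueCommonNbr_map {σ : Equiv.Perm Ω} (hσ : σ ∈ autGroup X) (a b c : Ω) :
    UniqueCommonNbr X (σ a) (σ b) (σ c) ↔ UniqueCommonNbr X a b c := by
  rw [UniqueCommonNbr, Function.Bijective.existsUnique_iff σ.bijective]
  simp only [hσ _ _, UniqueCommonNbr]

theorem tripleCount_map {σ : Equiv.Perm Ω} (hσ : σ ∈ autGroup X) (b x y : Ω) :
    tripleCount X (σ b) (σ x) (σ y) = tripleCount X b x y := by
  have h : {z | X.Adj (σ b) z ∧ UniqueCommonNbr X (σ x) (σ y) z}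
      = σ '' {z | X.Adj b z ∧ UniqueCommonNbr X x y z} := by
    ext z
    obtain ⟨z, rfl⟩ := σ.surjective z
    rw [σ.injective.mem_set_image]
    simp only [Set.mem_ofPred_eq, hσ _ _, uniqueCommonNbr_map hσ]
  rw [tripleCount, h, Set.ncard_image_of_injective _ σ.injective, tripleCount]

theorem signature_map {σ : Equiv.Perm Ω} (hσ : σ ∈ autGroup X) {b a₁ a₂ : Ω} {F : List Ω}
    (hb : σ b = b) (h₁ : σ a₁ = a₁) (h₂ : σ a₂ = a₂) (hF : ∀ f ∈ F, σ f = f) (z : Ω) :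
    signature X b a₁ a₂ F (σ z) = signature X b a₁ a₂ F z := by
  have h := uniqueCommonNbr_map hσ a₁ a₂ z
  rw [h₁, h₂] at h
  unfold signature
  rw [propext h]
  induction F with
  | nil => rfl
  | cons f F ih =>
    have ht := tripleCount_map hσ b f z
    rw [hb, hF f List.mem_cons_self] at ht
    rw [List.foldr_cons, List.foldr_cons, ht, ih fun f hf => hF f (List.mem_cons_of_mem _ hf)]

end Invariants

/-- The neighbours of the block with number `3`: for each of these points its number, the bit mask
of the blocks through it, its signatures relative to the first two and to the first ten points in
the list and, if the `tripleCount` with the point `0` is `7`, a word in the generators that takes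
the second point to it and fixes the point `0` and the block. -/
def nbrData : List (ℕ × ℕ × ℕ × ℕ × ℕ) :=
 [(0, 7126054394795593418161268334478039949528273233858943887713838773001816072, 448, 72906905685594560, 0),
  (22, 3756329586393792039727143379057872355531369675842539392433691420482650122, 7, 128088984806232071, 0),
  (48, 445298334670500035001497741027925856282801643831983471415193593602114184, 65, 18876487634518081, 0),
  (112, 34967314532268742355329201231427368591515471975288679430789802171303048, 68, 72919687406567492, 0),
  (122, 7512766790338666308635080874815663571771571432393893439733255942102458378, 4551, 1279871601407705543, 1091),
  (132, 277822375467451675162904635461947171543706561944190571093006910755258376, 199, 18872498667663559, 2470),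
  (140, 1877710002090609473192937671894419277412083699874160763901391424668909576, 263, 126399864363028743, 2914),
  (202, 111372384288711097780217190062957306479898761710879153955950786581119112, 257, 19985001463431425, 0),
  (208, 1823867355275339484751835892787840843208870715482133264573377190160245512, 451, 126131647883784643, 0),
  (222, 3658357029930000009372441802759612921880792392154858105416827658848829962, 452, 1975205112058308, 0),
  (10, 3534617931037986446872858471374376941049572802075698029453040263257923596, 449, 128084522269684161, 0),
  (14, 125095238572002430156021332991917889613018645898090363382799741014376584, 67, 128102385104728131, 0),
  (24, 7103623296267476916708537215912393883468424736473192634172939647777573128, 67, 55173775928094787, 0),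
  (28, 7509639645940792989096360325093377799505863092274195725330427972117611784, 449, 128084517974716865, 0),
  (35, 345201949775846869630924517981573723911818785681003573536517580757533194, 259, 54892094792954115, 0),
  (42, 1884178549984261568122309487397407213655879818515527584616095436469970952, 71, 54918895387816007, 163),
  (47, 32785417849847823612335058994277035374923215926887480027783644741500940, 195, 54355670523973827, 0),
  (57, 228000483702914852827770555341844311458327228697556435350820889041044492, 4547, 1281023478401348035, 0),
  (61, 3534344697890535319267442575236416373924163557068892993776151574814408840, 455, 18872228151833031, 825),
  (65, 3758864078039883533534143783366124551932752751218179238388023889838016522, 259, 54892090497986819, 0),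
  (67, 7098663482710136805985952836331882318231867968690487996102898724918797064, 455, 54901021948539335, 4498),
  (80, 289875164057151207753598514388345464788091973552886709947747391892423176, 4295, 1207259857821659335, 1143),
  (82, 483554037842172282089997612457830137277858631281279440594922380301222152, 193, 126958897307857089, 0),
  (89, 3644668013369491494134515611869887364405538453130017264984571889781318154, 195, 54918616232759491, 0),
  (93, 7123475077959092433485315241606827316925829574522716811492661913403393032, 4295, 1207822807775080647, 1642),
  (101, 29448741096961273008785859952712820641419698294004430615128917434960008, 4547, 1281006022546977219, 0),
  (106, 7070950451496253529134850725971431895707675663195315220362419734336307212, 455, 56044376602456519, 4533),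
  (108, 7068043739272933131259500328732656526005003419221426223529197821000974348, 196, 20015719102312644, 0),
  (124, 1823140328628525685808780120468998533371606233413882999845323417438946568, 195, 56044513941786819, 0),
  (144, 69079841255477473458622417283680827601386160130850961687142301127935112, 67, 126976483050401859, 0),
  (152, 1781516753153634819945323549608793356822807143438762580278243923535101964, 455, 54338074142601671, 148),
  (154, 1830688640565152873942735320577583024298003558335692624198674484403773450, 195, 56044520434569411, 0),
  (156, 338241179212516885718932955907263596944062247121320599506520940675630344, 455, 55199953819808199, 4486),
  (165, 34967294362782164964845547646636768048828542683881180771216458671988748, 195, 127240367988568259, 0),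
  (169, 448832681420100260093423490071822246428989165310406477951039620231856264, 455, 18309281419637191, 1097),
  (173, 335624389276431970690906741083802840606022085482931473734776182148499720, 195, 126958894085599427, 0),
  (177, 1823140279247506682750237596860957784249959358804552856403031516640231434, 193, 74058915704500417, 0),
  (185, 3561526911522802607788684384946050338076694827291432976137938482500241416, 71, 56044795294658631, 169),
  (194, 2208616359466044482558471131178891045949057077912533924490821641877651976, 455, 128076001069777351, 789),
  (198, 3547553662379546776697636110366483810732722145692182689437117073657431052, 67, 54329344555511875, 0),
  (215, 7516056534895983928101355680309128699331449831898748825185097529694423050, 193, 72370062623011009, 0),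
  (218, 483233506716370896455599171229862252954528219858791160727046173203907848, 196, 18889819195470020, 0),
  (232, 2208693763182702872051113149567430148512037343558239619796817410049714184, 4295, 1172075485767413959, 551),
  (234, 222696353642313634478064612597362381998934732090782150490182003567230988, 193, 126395943059468481, 0),
  (238, 3538871506427583922133063416959845175247388390436223162777398523688649352, 4547, 1281006020399493571, 0)]

/-- The masks of the blocks through the points of `nbrData`. -/
def nbrMasks : List ℕ := nbrData.map fun e => e.2.1

/-- Whether `m` is a power of two. -/
def isPow (m : ℕ) : Bool := !Nat.beq m 0 && Nat.beq (Nat.land m (Nat.sub m 1)) 0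

/-- The number of masks in `l` that have exactly one bit in common with `m`. -/
def countPow (l : List ℕ) (m : ℕ) : ℕ :=
  l.foldr (fun x acc => cond (isPow (Nat.land m x)) (Nat.succ acc) acc) 0

/-- The signature computed from bit masks. -/
def signatureN (a₁ a₂ : ℕ) (F : List ℕ) (m : ℕ) : ℕ :=
  F.foldr (fun f acc => Nat.add (Nat.mul acc 64) (countPow nbrMasks (Nat.land f m)))
    (cond (isPow (Nat.land (Nat.land a₁ a₂) m)) 1 0)

/-- The mask of the blocks through the point `0`. -/
def mask₁ : ℕ := (nbrMasks.getD 0 0)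

/-- The mask of the blocks through the second point of `nbrData`. -/
def mask₂ : ℕ := (nbrMasks.getD 1 0)

theorem nbrData_check : nbrData.all (fun e => Nat.blt e.1 243 && Nat.blt e.2.1 (2 ^ 243) &&
    (allBelow 243 fun w => Nat.beq (entry 1 e.2.1 w) (cond (Nat.beq (affColN (subN e.1 w)) 5) 1 0)) &&
    Nat.beq e.2.2.1 (signatureN mask₁ mask₂ (nbrMasks.take 2) e.2.1) &&
    Nat.beq e.2.2.2.1 (signatureN mask₁ mask₂ (nbrMasks.take 10) e.2.1) &&
    (!Nat.beq (countPow nbrMasks (Nat.land mask₁ e.2.1)) 7 ||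
      Nat.beq (applyWord linN 4 e.2.2.2.2 22) e.1 &&
      Nat.beq (applyWord affN 4 e.2.2.2.2 (subN 0 3)) (subN 0 3))) = true := by
  decide +kernel

theorem nbrData_complete : allBelow 243 (fun n => !Nat.beq (affColN (subN n 3)) 5 ||
    nbrData.any fun e => Nat.beq e.1 n) = true := by
  decide +kernel

theorem nbrData_sound : nbrData.all (fun e => Nat.beq (affColN (subN e.1 3)) 5) = true := by
  decide +kernel

theorem nodup_nbrData : (nbrData.map Prod.fst).Nodup := by decide +kernel

/-- Each of the first ten points is recognized among all 45 by its signature relative to the first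
two. An automorphism that fixes the base block and these two points therefore fixes all ten. -/
theorem signature_two_check : (nbrData.take 10).all (fun e => nbrData.all fun e' =>
    !Nat.beq e.2.2.1 e'.2.2.1 || Nat.beq e.1 e'.1) = true := by
  decide +kernel

/-- Relative to the ten points fixed so far, all 45 points have different signatures. -/
theorem signature_ten_check : nbrData.all (fun e => nbrData.all fun e' =>
    !Nat.beq e.2.2.2.1 e'.2.2.2.1 || Nat.beq e.1 e'.1) = true := by
  decide +kernel

/-- The fold intersects, over the points of the base block on `w`, the sets of blocks through these
points. That only `w` and the base block survive means that the trace on the base block determines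
`w`. The colours 1 and 2 are left out because they mark the 22 blocks disjoint from the base block,
whose traces are empty. -/
theorem block_check : allBelow 243 (fun w => Nat.beq (linColN (subN w 3)) 1 ||
    Nat.beq (linColN (subN w 3)) 2 || Nat.beq (nbrMasks.foldr (fun m acc =>
      cond (Nat.beq (entry 1 m w) 1) (Nat.land m acc) acc) (2 ^ 243 - 1))
    (Nat.lor (Nat.shiftLeft 1 w) (Nat.shiftLeft 1 3))) = true := by
  decide +kernel

theorem entry_one_eq (T i : ℕ) : entry 1 T i = (T.testBit i).toNat := by
  have h : entry 1 T i = (T >>> (1 * i)) &&& (1 <<< 1 - 1) := rfl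
  rw [h, one_mul, Nat.toNat_testBit, Nat.shiftRight_eq_div_pow]
  exact Nat.and_one_is_mod _

theorem entry_one_eq_one_iff (T i : ℕ) : entry 1 T i = 1 ↔ T.testBit i = true := by
  rw [entry_one_eq]
  cases T.testBit i <;> simp

theorem isPow_iff (m : ℕ) : isPow m = true ↔ ∃! i, m.testBit i = true := by
  have h : isPow m = true ↔ m.isPowerOfTwo := by
    rw [← Nat.ne_zero_and_sub_one_eq_zero_iff_isPowerOfTwo, isPow, Bool.and_eq_true,
      Bool.not_eq_true', Bool.eq_false_iff, ne_eq, Nat.beq_eq, Nat.beq_eq]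
    rfl
  rw [h]
  constructor
  · rintro ⟨k, rfl⟩
    exact ⟨k, Nat.testBit_two_pow_self, fun i hi => by
      have hi' : (2 ^ k).testBit i = true := hi
      rw [Nat.testBit_two_pow, decide_eq_true_iff] at hi'
      exact hi'.symm⟩
  · rintro ⟨k, hk, hu⟩
    refine ⟨k, Nat.eq_of_testBit_eq fun i => ?_⟩
    rw [Nat.testBit_two_pow, Bool.eq_iff_iff, decide_eq_true_iff]
    exact ⟨fun hi => (hu i hi).symm, fun hi => hi ▸ hk⟩

/-- The point belonging to an entry of `nbrData`. -/
def nbrPoint (e : ℕ × ℕ × ℕ × ℕ × ℕ) : W := .inl (dec e.1)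

/-- The block whose neighbours are listed in `nbrData`. -/
def baseBlock : W := .inr (dec 3)

theorem nbrData_spec {e : ℕ × ℕ × ℕ × ℕ × ℕ} (he : e ∈ nbrData) :
    e.1 < 243 ∧ e.2.1 < 2 ^ 243 ∧
    (∀ w < 243, e.2.1.testBit w = true ↔ affCol (dec e.1 - dec w) = 5) ∧
    e.2.2.1 = signatureN mask₁ mask₂ (nbrMasks.take 2) e.2.1 ∧
    e.2.2.2.1 = signatureN mask₁ mask₂ (nbrMasks.take 10) e.2.1 ∧
    (countPow nbrMasks (Nat.land mask₁ e.2.1) = 7 → ∃ w, applyWord linN 4 w 22 = e.1 ∧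
      applyWord affN 4 w (subN 0 3) = subN 0 3) := by
  have h := List.all_eq_true.mp nbrData_check e he
  simp only [Bool.and_eq_true, Nat.beq_eq, allBelow_iff, Bool.or_eq_true, Bool.not_eq_true',
    Bool.eq_false_iff, ne_eq, ← imp_iff_not_or] at h
  obtain ⟨⟨⟨⟨⟨h1, h2⟩, h3⟩, h4⟩, h5⟩, h6⟩ := h
  refine ⟨Nat.le_of_ble_eq_true h1, Nat.le_of_ble_eq_true h2, fun w hw => ?_, h4, h5,
    fun h7 => ⟨_, h6 h7⟩⟩
  rw [← entry_one_eq_one_iff, h3 w hw, ← dec_subN, affCol_dec (subN_lt _ _)]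
  cases hb : Nat.beq (affColN (subN e.1 w)) 5
  · simp [← Nat.beq_eq, hb]
  · simp [Nat.eq_of_beq_eq_true hb]

theorem nbrPoint_adj_iff {e : ℕ × ℕ × ℕ × ℕ × ℕ} (he : e ∈ nbrData) (q : W) :
    krModel.Adj (nbrPoint e) q ↔ ∃ w < 243, e.2.1.testBit w = true ∧ q = .inr (dec w) := by
  obtain ⟨-, -, h, -⟩ := nbrData_spec he
  rcases q with x | x
  · exact ⟨fun hq => absurd hq (not_krModel_inl_inl _ _), fun ⟨w, _, _, hw⟩ => nomatch hw⟩
  · rw [nbrPoint, krModel_inl_inr]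
    constructor
    · intro hx
      exact ⟨enc x, enc_lt x, (h _ (enc_lt x)).mpr (by rwa [dec_enc]), by rw [dec_enc]⟩
    · rintro ⟨w, hw, hb, hx⟩
      rw [Sum.inr.inj hx]
      exact (h w hw).mp hb

theorem baseBlock_adj_iff (z : W) : krModel.Adj baseBlock z ↔ ∃ e ∈ nbrData, z = nbrPoint e := by
  rcases z with x | x
  · rw [baseBlock, krModel_inr_inl]
    constructor
    · intro hx
      have h := allBelow_iff.mp nbrData_complete _ (enc_lt x)
      rw [← dec_enc x, ← dec_subN, affCol_dec (subN_lt _ _)] at hx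
      rw [hx] at h
      simp only [Nat.beq_refl, Bool.not_true, Bool.false_or, List.any_eq_true, Nat.beq_eq] at h
      obtain ⟨e, he, hex⟩ := h
      exact ⟨e, he, by rw [nbrPoint, hex, dec_enc]⟩
    · rintro ⟨e, he, hx⟩
      rw [Sum.inl.inj hx, ← dec_subN, affCol_dec (subN_lt _ _)]
      exact Nat.eq_of_beq_eq_true (List.all_eq_true.mp nbrData_sound e he)
  · refine ⟨fun hq => absurd hq (not_krModel_inr_inr _ _), fun ⟨e, _, hx⟩ => nomatch hx⟩

theorem dec_injOn {m n : ℕ} (hm : m < 243) (hn : n < 243) (h : dec m = dec n) : m = n := by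
  rw [← enc_dec hm, h, enc_dec hn]

/-- The three points all lie on the base block, so uniqueness says that no other block contains
them. The blocks through all three are the bits of the conjunction of the masks. -/
theorem uniqueCommonNbr_nbrPoint {e₁ e₂ e₃ : ℕ × ℕ × ℕ × ℕ × ℕ} (h₁ : e₁ ∈ nbrData)
    (h₂ : e₂ ∈ nbrData) (h₃ : e₃ ∈ nbrData) :
    UniqueCommonNbr krModel (nbrPoint e₁) (nbrPoint e₂) (nbrPoint e₃) ↔
      isPow (Nat.land (Nat.land e₁.2.1 e₂.2.1) e₃.2.1) = true := by
  have hand : ∀ i, (Nat.land (Nat.land e₁.2.1 e₂.2.1) e₃.2.1).testBit i = true ↔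
      (e₁.2.1.testBit i = true ∧ e₂.2.1.testBit i = true) ∧ e₃.2.1.testBit i = true := by
    intro i
    change ((e₁.2.1 &&& e₂.2.1) &&& e₃.2.1).testBit i = true ↔ _
    rw [Nat.testBit_and, Nat.testBit_and, Bool.and_eq_true, Bool.and_eq_true]
  have hlt : ∀ i, e₁.2.1.testBit i = true → i < 243 := by
    intro i hi
    by_contra hge
    have := Nat.testBit_lt_two_pow ((nbrData_spec h₁).2.1.trans_le
      (Nat.pow_le_pow_right (by norm_num) (not_lt.mp hge)))
    rw [this] at hi
    exact Bool.false_ne_true hi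
  have hadj : ∀ {e : ℕ × ℕ × ℕ × ℕ × ℕ}, e ∈ nbrData → ∀ w < 243,
      (krModel.Adj (nbrPoint e) (.inr (dec w)) ↔ e.2.1.testBit w = true) := by
    intro e he w hw
    rw [nbrPoint_adj_iff he]
    constructor
    · rintro ⟨w', hw', hb, hx⟩
      rwa [dec_injOn hw hw' (Sum.inr.inj hx)]
    · exact fun hb => ⟨w, hw, hb, rfl⟩
  rw [isPow_iff]
  constructor
  · rintro ⟨q, ⟨hq1, hq2, hq3⟩, hu⟩
    obtain ⟨w, hw, hb, rfl⟩ := (nbrPoint_adj_iff h₁ q).mp hq1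
    refine ⟨w, (hand w).mpr ⟨⟨hb, (hadj h₂ w hw).mp hq2⟩, (hadj h₃ w hw).mp hq3⟩, fun i hi => ?_⟩
    obtain ⟨⟨hi1, hi2⟩, hi3⟩ := (hand i).mp hi
    have hi := hlt i hi1
    exact dec_injOn hi hw (Sum.inr.inj (hu (.inr (dec i)) ⟨(hadj h₁ i hi).mpr hi1,
      (hadj h₂ i hi).mpr hi2, (hadj h₃ i hi).mpr hi3⟩))
  · rintro ⟨w, hw, hu⟩
    obtain ⟨⟨hw1, hw2⟩, hw3⟩ := (hand w).mp hw
    have hlw := hlt w hw1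
    refine ⟨.inr (dec w), ⟨(hadj h₁ w hlw).mpr hw1, (hadj h₂ w hlw).mpr hw2,
      (hadj h₃ w hlw).mpr hw3⟩, ?_⟩
    rintro q ⟨hq1, hq2, hq3⟩
    obtain ⟨i, hi, hb, rfl⟩ := (nbrPoint_adj_iff h₁ q).mp hq1
    rw [hu i ((hand i).mpr ⟨⟨hb, (hadj h₂ i hi).mp hq2⟩, (hadj h₃ i hi).mp hq3⟩)]

theorem nbrPoint_inj {e e' : ℕ × ℕ × ℕ × ℕ × ℕ} (he : e ∈ nbrData) (he' : e' ∈ nbrData)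
    (h : nbrPoint e = nbrPoint e') : e = e' :=
  List.inj_on_of_nodup_map nodup_nbrData he he'
    (dec_injOn (nbrData_spec he).1 (nbrData_spec he').1 (Sum.inl.inj h))

theorem tripleCount_nbrPoint {e e' : ℕ × ℕ × ℕ × ℕ × ℕ} (he : e ∈ nbrData) (he' : e' ∈ nbrData) :
    tripleCount krModel baseBlock (nbrPoint e) (nbrPoint e') =
      countPow nbrMasks (Nat.land e.2.1 e'.2.1) := by
  classical
  have h1 : {z | krModel.Adj baseBlock z ∧
      UniqueCommonNbr krModel (nbrPoint e) (nbrPoint e') z} = nbrPoint ''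
      ((nbrData.filter fun x => isPow (Nat.land (Nat.land e.2.1 e'.2.1) x.2.1)).toFinset : Set _) := by
    ext z
    simp only [Set.mem_ofPred_eq, Set.mem_image, List.coe_toFinset, List.mem_filter,
      baseBlock_adj_iff]
    constructor
    · rintro ⟨⟨x, hx, rfl⟩, hu⟩
      exact ⟨x, ⟨hx, (uniqueCommonNbr_nbrPoint he he' hx).mp hu⟩, rfl⟩
    · rintro ⟨x, ⟨hx, hu⟩, rfl⟩
      exact ⟨⟨x, hx, rfl⟩, (uniqueCommonNbr_nbrPoint he he' hx).mpr hu⟩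
  have h2 : ∀ (l : List (ℕ × ℕ × ℕ × ℕ × ℕ)) (m : ℕ), countPow (l.map fun e => e.2.1) m =
      (l.filter fun x => isPow (Nat.land m x.2.1)).length := by
    intro l m
    induction l with
    | nil => rfl
    | cons x l ih =>
      have hstep : countPow ((x :: l).map fun e => e.2.1) m = cond (isPow (Nat.land m x.2.1))
        (Nat.succ (countPow (l.map fun e => e.2.1) m)) (countPow (l.map fun e => e.2.1) m) := rfl
      rw [hstep, List.filter_cons, ih]
      cases isPow (Nat.land m x.2.1) <;> simp
  rw [tripleCount, h1, Set.InjOn.ncard_image, Set.ncard_coe_finset, List.toFinset_card_of_nodup,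
    nbrMasks, h2]
  · exact (List.Nodup.of_map _ nodup_nbrData).filter _
  · intro x hx y hy hxy
    simp only [List.coe_toFinset, List.mem_filter, Set.mem_ofPred_eq] at hx hy
    exact nbrPoint_inj hx.1 hy.1 hxy

theorem exists_mask₁ : ∃ e ∈ nbrData, e.1 = 0 ∧ e.2.1 = mask₁ :=
  ⟨nbrData[0]'(by decide), List.getElem_mem _, by decide +kernel, by decide +kernel⟩

theorem exists_mask₂ : ∃ e ∈ nbrData, e.1 = 22 ∧ e.2.1 = mask₂ :=
  ⟨nbrData[1]'(by decide), List.getElem_mem _, by decide +kernel, by decide +kernel⟩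

theorem signature_nbrPoint {e : ℕ × ℕ × ℕ × ℕ × ℕ} (he : e ∈ nbrData) (k : ℕ) :
    signature krModel baseBlock (.inl (dec 0)) (.inl (dec 22)) ((nbrData.take k).map nbrPoint)
      (nbrPoint e) = signatureN mask₁ mask₂ (nbrMasks.take k) e.2.1 := by
  obtain ⟨e₁, h₁, h₁', h₁''⟩ := exists_mask₁
  obtain ⟨e₂, h₂, h₂', h₂''⟩ := exists_mask₂
  have hu := uniqueCommonNbr_nbrPoint h₁ h₂ he
  rw [nbrPoint, nbrPoint, h₁', h₂', h₁'', h₂''] at hu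
  have hl : ∀ f ∈ nbrData.take k, f ∈ nbrData := fun f hf => List.mem_of_mem_take hf
  rw [signature, signatureN, nbrMasks, ← List.map_take, propext hu]
  generalize nbrData.take k = l at hl ⊢
  induction l with
  | nil =>
    cases isPow (Nat.land (Nat.land mask₁ mask₂) e.2.1) <;> simp
  | cons f l ih =>
    rw [List.map_cons, List.map_cons, List.foldr_cons, List.foldr_cons,
      ih fun f hf => hl f (List.mem_cons_of_mem _ hf),
      tripleCount_nbrPoint (hl f List.mem_cons_self) he]
    rfl

/-- Two vertices with the same fixed neighbours coincide if there are at least ten of these. -/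
theorem eq_of_common_nbrs {p q : W} (h : 9 < {z | krModel.Adj p z ∧ krModel.Adj q z}.ncard) :
    p = q := by
  by_contra hpq
  have h1 : {z | krModel.Adj p z ∧ krModel.Adj q z} = {z | col p z = 5 ∧ col z q = 5} := by
    have h32 : ∀ k < 9, Nat.testBit 32 k = true ↔ k = 5 := by decide
    ext z
    simp only [Set.mem_ofPred_eq, krModel, isScheme.colGraph_adj (S := 32) (by decide), col_symm z q,
      h32 _ (col_lt _ _)]
  rw [h1, isScheme.ncard_eq p q 5 (by norm_num) 5 (by norm_num)] at h
  -- The bound 9 is the intersection number `c₂`, the largest number of common neighbours of two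
  -- different vertices.
  have h2 : ∀ k < 9, k ≠ 0 → interNum 5 5 k ≤ 9 := by decide +kernel
  exact absurd (h2 _ (col_lt p q) fun h0 => hpq ((col_eq_zero_iff p q).mp h0)) (not_le.mpr h)

theorem ncard_adj_eq (p : W) : {z | krModel.Adj p z}.ncard = 45 := by
  have h1 : {z | krModel.Adj p z} = {z | col p z = 5} := by
    have h32 : ∀ k < 9, Nat.testBit 32 k = true ↔ k = 5 := by decide
    ext z
    simp only [Set.mem_ofPred_eq, krModel, isScheme.colGraph_adj (S := 32) (by decide),
      h32 _ (col_lt _ _)]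
  rw [h1, isScheme.ncard_valency p (by norm_num)]
  decide +kernel

theorem testBit_foldr_land (l : List ℕ) {w v n : ℕ} (hv : v < n)
    (h : ∀ m ∈ l, m.testBit w = true → m.testBit v = true) :
    (l.foldr (fun m acc => cond (Nat.beq (entry 1 m w) 1) (Nat.land m acc) acc)
      (2 ^ n - 1)).testBit v = true := by
  induction l with
  | nil => simpa using hv
  | cons m l ih =>
    have ih := ih fun m hm => h m (List.mem_cons_of_mem _ hm)
    rw [List.foldr_cons]
    cases hb : Nat.beq (entry 1 m w) 1
    · exact ih
    · rw [Nat.beq_eq, entry_one_eq_one_iff] at hb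
      change (m &&& _).testBit v = true
      rw [Nat.testBit_and, h m List.mem_cons_self hb, ih]
      rfl

theorem block_eq_of_trace {w v : ℕ} (hw : w < 243) (hv : v < 243)
    (h1 : linColN (subN w 3) ≠ 1) (h2 : linColN (subN w 3) ≠ 2)
    (h : ∀ e ∈ nbrData, e.2.1.testBit w = true → e.2.1.testBit v = true) : v = w ∨ v = 3 := by
  have hc := allBelow_iff.mp block_check w hw
  simp only [Bool.or_eq_true, Nat.beq_eq, h1, h2, false_or] at hc
  have hb := testBit_foldr_land nbrMasks (w := w) hv fun m hm => by
    obtain ⟨e, he, rfl⟩ := List.mem_map.mp hm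
    exact h e he
  rw [hc] at hb
  change ((1 <<< w) ||| (1 <<< 3)).testBit v = true at hb
  rw [Nat.testBit_or, Nat.one_shiftLeft, Nat.one_shiftLeft, Nat.testBit_two_pow,
    Nat.testBit_two_pow, Bool.or_eq_true, decide_eq_true_iff, decide_eq_true_iff] at hb
  omega

/-- The fixed set grows in stages: ten points of the base block, all its 45 points, all blocks that
meet it (by their traces), all points (each lies on enough fixed blocks), and finally all blocks. -/
theorem eq_one_of_fixes_base {σ : Equiv.Perm W} (hσ : σ ∈ autGroup krModel)
    (hb : σ baseBlock = baseBlock) (h₁ : σ (.inl (dec 0)) = .inl (dec 0))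
    (h₂ : σ (.inl (dec 22)) = .inl (dec 22)) : σ = 1 := by
  have hmem : ∀ e ∈ nbrData, ∃ e' ∈ nbrData, σ (nbrPoint e) = nbrPoint e' := by
    intro e he
    rw [← baseBlock_adj_iff, ← hb, hσ, baseBlock_adj_iff]
    exact ⟨e, he, rfl⟩
  have hsig : ∀ k, (∀ f ∈ nbrData.take k, σ (nbrPoint f) = nbrPoint f) → ∀ e ∈ nbrData,
      ∀ e' ∈ nbrData, σ (nbrPoint e) = nbrPoint e' →
      signatureN mask₁ mask₂ (nbrMasks.take k) e.2.1 =
        signatureN mask₁ mask₂ (nbrMasks.take k) e'.2.1 := by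
    intro k hk e he e' he' hee
    rw [← signature_nbrPoint he, ← signature_nbrPoint he', ← hee]
    refine (signature_map hσ hb h₁ h₂ (fun f hf => ?_) _).symm
    obtain ⟨f, hf', rfl⟩ := List.mem_map.mp hf
    exact hk f hf'
  have hten : ∀ e ∈ nbrData.take 10, σ (nbrPoint e) = nbrPoint e := by
    intro e he
    have he' := List.mem_of_mem_take he
    obtain ⟨e', he'', hee⟩ := hmem e he'
    have hs := hsig 2 (fun f hf => by
      have : nbrData.take 2 = [nbrData[0]'(by decide), nbrData[1]'(by decide)] := rfl
      rw [this] at hf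
      simp only [List.mem_cons, List.not_mem_nil, or_false] at hf
      rcases hf with rfl | rfl
      · exact h₁
      · exact h₂) e he' e' he'' hee
    rw [← (nbrData_spec he').2.2.2.1, ← (nbrData_spec he'').2.2.2.1] at hs
    have hc := List.all_eq_true.mp (List.all_eq_true.mp signature_two_check e he) e' he''
    rw [hs, Nat.beq_refl, Bool.not_true, Bool.false_or, Nat.beq_eq] at hc
    rw [hee, nbrPoint, nbrPoint, hc]
  have hall : ∀ e ∈ nbrData, σ (nbrPoint e) = nbrPoint e := by
    intro e he
    obtain ⟨e', he', hee⟩ := hmem e he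
    have hs := hsig 10 hten e he e' he' hee
    rw [← (nbrData_spec he).2.2.2.2.1, ← (nbrData_spec he').2.2.2.2.1] at hs
    have hc := List.all_eq_true.mp (List.all_eq_true.mp signature_ten_check e he) e' he'
    rw [hs, Nat.beq_refl, Bool.not_true, Bool.false_or, Nat.beq_eq] at hc
    rw [hee, nbrPoint, nbrPoint, hc]
  have hblock : ∀ w < 243, linColN (subN w 3) ≠ 1 → linColN (subN w 3) ≠ 2 →
      σ (.inr (dec w)) = .inr (dec w) := by
    intro w hw hw1 hw2
    have htrace : ∃ e ∈ nbrData, e.2.1.testBit w = true := by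
      by_contra hne
      push Not at hne
      -- With an empty trace the condition on `v` in `block_eq_of_trace` would be vacuous, and at
      -- most two blocks would exist.
      have hv : ∀ v < 243, v = w ∨ v = 3 := fun v hv =>
        block_eq_of_trace hw hv hw1 hw2 fun e he hb => absurd hb (hne e he)
      have := hv 0 (by norm_num)
      have := hv 1 (by norm_num)
      omega
    have hadj : ∀ e ∈ nbrData, e.2.1.testBit w = true →
        krModel.Adj (nbrPoint e) (σ (.inr (dec w))) := by
      intro e he hew
      rw [← hall e he, hσ, nbrPoint_adj_iff he]
      exact ⟨w, hw, hew, rfl⟩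
    obtain ⟨e, he, hew⟩ := htrace
    obtain ⟨v, hv, -, hvx⟩ := (nbrPoint_adj_iff he _).mp (hadj e he hew)
    rcases block_eq_of_trace hw hv hw1 hw2 fun e he hew => by
        obtain ⟨v', hv', hb', hvx'⟩ := (nbrPoint_adj_iff he _).mp (hadj e he hew)
        rw [hvx] at hvx'
        rwa [dec_injOn hv hv' (Sum.inr.inj hvx')] with rfl | rfl
    · exact hvx
    -- If the image is the base block, which is itself fixed, then `w` was the base block.
    · rw [hvx]
      exact (σ.injective (hvx.trans hb.symm)).symm
  have hpoint : ∀ x : V, σ (.inl x) = .inl x := by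
    intro x
    refine (eq_of_common_nbrs ?_).symm
    -- Of the 45 blocks through `x`, at most 2 + 20 are not yet known to be fixed. The remaining 23
    -- or more pass through both `x` and its image, and two different points share at most nine.
    have h1 : ({z | krModel.Adj (.inl x) z} \ ({z | col baseBlock z = 1} ∪ {z | col baseBlock z = 2}) :
        Set W) ⊆ {z | krModel.Adj (.inl x) z ∧ krModel.Adj (σ (.inl x)) z} := by
      rintro (y | y) ⟨hz, hz'⟩
      · exact absurd hz (not_krModel_inl_inl _ _)
      · refine ⟨hz, ?_⟩
        have hcol : col baseBlock (.inr y) = linColN (subN (enc y) 3) := by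
          rw [col_symm, ← linCol_dec (subN_lt _ _), dec_subN, dec_enc]
          rfl
        rw [Set.mem_union, Set.mem_ofPred_eq, Set.mem_ofPred_eq, hcol, not_or] at hz'
        have hy := hblock (enc y) (enc_lt y) hz'.1 hz'.2
        rw [dec_enc] at hy
        rw [← hy, hσ]
        exact hz
    have h2 := Set.ncard_le_ncard h1
    have h3 := Set.le_ncard_sdiff ({z | col baseBlock z = 1} ∪ {z | col baseBlock z = 2})
      {z | krModel.Adj (.inl x) z}
    have h4 := Set.ncard_union_le {z | col baseBlock z = 1} {z | col baseBlock z = 2}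
    rw [isScheme.ncard_valency baseBlock (by norm_num), isScheme.ncard_valency baseBlock
      (by norm_num)] at h4
    have h5 : interNum 1 1 0 + interNum 2 2 0 = 22 := by decide +kernel
    rw [ncard_adj_eq] at h3
    omega
  ext q : 1
  rcases q with x | y
  · exact hpoint x
  · change σ (.inr y) = .inr y
    refine (eq_of_common_nbrs ?_).symm
    have h1 : {z | krModel.Adj (.inr y) z} ⊆
        {z | krModel.Adj (.inr y) z ∧ krModel.Adj (σ (.inr y)) z} := by
      rintro (z | z) hz
      · refine ⟨hz, ?_⟩
        rw [← hpoint z, hσ]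
        exact hz
      · exact absurd hz (not_krModel_inr_inr _ _)
    have h2 := Set.ncard_le_ncard h1
    rw [ncard_adj_eq] at h2
    omega

/-- The full automorphism group of the Koolen–Riebeek graph. -/
theorem autGroup_krModel : autGroup krModel = bigGroup := by
  refine le_antisymm (fun σ hσ => ?_) bigGroup_le_autGroup
  have hstep : ∀ {σ : Equiv.Perm W} {g : Equiv.Perm W}, g ∈ bigGroup → g * σ ∈ bigGroup →
      σ ∈ bigGroup := fun hg h => (Subgroup.mul_mem_cancel_left _ hg).mp h
  -- Vertex-transitivity of `bigGroup` reduces to the case that the point 0 is fixed.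
  obtain ⟨g₁, hg₁, h₁⟩ := exists_to_zero (σ (.inl 0))
  refine hstep hg₁ ?_
  have hσ₁ := mul_mem (bigGroup_le_autGroup hg₁) hσ
  have hσ₁0 : (g₁ * σ) (.inl 0) = .inl 0 := h₁
  generalize g₁ * σ = σ at hσ₁ hσ₁0 ⊢
  have hz : (.inl 0 : W) = .inl (dec 0) := by rw [dec_zero]
  have hb0 : krModel.Adj (.inl 0) baseBlock := by
    rw [hz, baseBlock, krModel_inl_inr, ← dec_subN, affCol_dec (subN_lt _ _)]
    decide +kernel
  have hb1 : krModel.Adj (.inl 0) (σ baseBlock) := by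
    rw [← hσ₁0, hσ₁]
    exact hb0
  -- All incident pairs have the colour 5 and thus form one orbital, so the base block may be
  -- assumed fixed together with the point 0.
  have hb2 : col (σ baseBlock) (.inl 0) = col baseBlock (.inl 0) := by
    have h32 : ∀ k < 9, Nat.testBit 32 k = true → k = 5 := by decide
    rw [col_symm, h32 _ (col_lt _ _) hb1.2, col_symm, h32 _ (col_lt _ _) hb0.2]
  obtain ⟨g₂, hg₂, h₂, h₂'⟩ := exists_map_pair hb2
  refine hstep hg₂ ?_
  have hσ₂ := mul_mem (bigGroup_le_autGroup hg₂) hσ₁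
  have hσ₂b : (g₂ * σ) baseBlock = baseBlock := h₂
  have hσ₂0 : (g₂ * σ) (.inl 0) = .inl 0 := by rw [Equiv.Perm.mul_apply, hσ₁0, h₂']
  generalize g₂ * σ = σ at hσ₂ hσ₂b hσ₂0 ⊢
  obtain ⟨e₁, he₁, h0, hm₁⟩ := exists_mask₁
  obtain ⟨e₂, he₂, h22, hm₂⟩ := exists_mask₂
  have hadj : krModel.Adj baseBlock (σ (nbrPoint e₂)) := by
    rw [← hσ₂b, hσ₂, baseBlock_adj_iff]
    exact ⟨e₂, he₂, rfl⟩
  obtain ⟨e, he, hee⟩ := (baseBlock_adj_iff _).mp hadj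
  -- The second point has `tripleCount` 7 with the point 0, and so has its image. The words in
  -- `nbrData` show that the stabilizer of the incident pair in `bigGroup` is transitive on the
  -- points with this count.
  have h7 := tripleCount_map hσ₂ baseBlock (nbrPoint e₁) (nbrPoint e₂)
  rw [hee, hσ₂b, nbrPoint, h0, ← hz, hσ₂0, hz, ← h0] at h7
  change tripleCount krModel baseBlock (nbrPoint e₁) _ = tripleCount krModel baseBlock (nbrPoint e₁) _
    at h7
  rw [tripleCount_nbrPoint he₁ he, tripleCount_nbrPoint he₁ he₂, hm₁, hm₂] at h7
  obtain ⟨w, hw₁, hw₂⟩ := (nbrData_spec he).2.2.2.2.2 (h7.trans (by decide +kernel))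
  -- Blocks enter `exists_stabilizer_word` with a minus sign, so `subN 0 3` stands for the base
  -- block.
  obtain ⟨g₃, hg₃, h₃, h₃', h₃''⟩ := exists_stabilizer_word 4 w 22 (subN 0 3)
  rw [hw₁] at h₃'
  rw [hw₂, dec_subN, dec_zero, zero_sub, neg_neg] at h₃''
  have hσ₃ : g₃⁻¹ * σ = 1 := by
    refine eq_one_of_fixes_base (mul_mem (inv_mem (bigGroup_le_autGroup hg₃)) hσ₂) ?_ ?_ ?_
    · rw [Equiv.Perm.mul_apply, hσ₂b, Equiv.Perm.inv_eq_iff_eq]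
      exact h₃''.symm
    · rw [Equiv.Perm.mul_apply, ← hz, hσ₂0, Equiv.Perm.inv_eq_iff_eq]
      exact h₃.symm
    · rw [Equiv.Perm.mul_apply, Equiv.Perm.inv_eq_iff_eq, h₃', ← h22]
      exact hee
  rw [inv_mul_eq_one] at hσ₃
  exact hσ₃ ▸ hg₃

/-! ## Generators of `M₁₀` -/

/-- The first generator of `M₁₁`. -/
def rot : Equiv.Perm (Fin 11) := c[0, 1, 2, 3, 4, 5, 6, 7, 8, 9, 10]

/-- The second generator of `M₁₁`. -/
def quad : Equiv.Perm (Fin 11) := c[2, 6, 10, 7] * c[3, 9, 4, 5]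

/-- The Schreier generators of `M₁₀` for the transversal of powers of `rot`. -/
def schreier (j : Fin 11) : Equiv.Perm (Fin 11) := (rot ^ (quad j).val)⁻¹ * quad * rot ^ j.val

theorem rot_pow_zero (j : Fin 11) : (rot ^ j.val) 0 = j := by
  revert j
  decide

theorem schreier_zero (j : Fin 11) : schreier j 0 = 0 := by
  rw [schreier, Equiv.Perm.mul_apply, Equiv.Perm.mul_apply, rot_pow_zero, Equiv.Perm.inv_eq_iff_eq,
    rot_pow_zero]

/-- Schreier's lemma with the transversal formed by the powers of `rot`. The generator `rot`
contributes only trivial Schreier generators. Every element `g` of `M₁₁` is `rot ^ (g 0)` times an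
element of the closure, and the first factor is trivial when `g` fixes 0. -/
theorem mathieuM10_eq_closure : mathieuM10 = Subgroup.closure (Set.range schreier) := by
  have hrot : rot ∈ mathieuM11 := Subgroup.subset_closure (Set.mem_insert _ _)
  have hquad : quad ∈ mathieuM11 := Subgroup.subset_closure (Set.mem_insert_of_mem _ rfl)
  apply le_antisymm
  · rintro g ⟨hg, hg0⟩
    have hstep : ∀ s ∈ ({rot, quad} : Set (Equiv.Perm (Fin 11))), ∀ j : Fin 11,
        ∃ c ∈ Subgroup.closure (Set.range schreier), s * rot ^ j.val = rot ^ (s j).val * c := by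
      rintro s (rfl | rfl) j
      · refine ⟨1, one_mem _, ?_⟩
        have h : ∀ j : Fin 11, rot * rot ^ j.val = rot ^ (rot j).val := by decide
        rw [h, mul_one]
      · exact ⟨schreier j, Subgroup.subset_closure ⟨j, rfl⟩, by
          rw [schreier, ← mul_assoc, ← mul_assoc, mul_inv_cancel, one_mul]⟩
    have key : ∀ g ∈ Submonoid.closure ({rot, quad} : Set (Equiv.Perm (Fin 11))),
        ∃ c ∈ Subgroup.closure (Set.range schreier), g = rot ^ (g 0).val * c := by
      intro g hg
      induction hg using Submonoid.closure_induction_left with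
      | one => exact ⟨1, one_mem _, by simp⟩
      | mul_left s hs g _ ih =>
        obtain ⟨c, hc, hgc⟩ := ih
        obtain ⟨c', hc', h'⟩ := hstep s hs (g 0)
        refine ⟨c' * c, mul_mem hc' hc, ?_⟩
        rw [← mul_assoc, Equiv.Perm.mul_apply, ← h', mul_assoc, ← hgc]
    -- In a finite group no inverses are needed, which permits induction by left multiplication with
    -- generators.
    have hfin : (Subgroup.closure ({rot, quad} : Set (Equiv.Perm (Fin 11)))).toSubmonoid =
        Submonoid.closure {rot, quad} := Subgroup.closure_toSubmonoid_of_finite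
    have hg : g ∈ Submonoid.closure ({rot, quad} : Set (Equiv.Perm (Fin 11))) := hfin ▸ hg
    obtain ⟨c, hc, hgc⟩ := key g hg
    have h0 : g 0 = 0 := hg0
    rw [h0] at hgc
    rw [hgc]
    simpa using hc
  · rw [Subgroup.closure_le]
    rintro _ ⟨j, rfl⟩
    have hj : schreier j ∈ mathieuM11 :=
      mul_mem (mul_mem (inv_mem (pow_mem hrot _)) hquad) (pow_mem hrot _)
    exact ⟨hj, schreier_zero j⟩

/-! ## The structure of the automorphism group -/

/-- The images in `V` of the standard basis of the code space, numbered so that the generators of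
`M₁₀` permute them, up to sign, as `schreier` does. -/
def axisN (i : ℕ) : ℕ := entry 8 3669782669899672494761985 i

def axis (i : Fin 11) : V := dec (axisN i)

/-- This pairs the matrices with the Schreier generators: modulo signs, the linear action on the
eleven axes is the action of `M₁₀` on eleven points. -/
theorem genMatrix_axis (j i : Fin 11) : genMatrix j *ᵥ axis i = axis (schreier j i) ∨
    genMatrix j *ᵥ axis i = -axis (schreier j i) := by
  have h : ∀ j i : Fin 11, linN j (axisN i) = axisN (schreier j i) ∨
      linN j (axisN i) = subN 0 (axisN (schreier j i)) := by decide +kernel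
  rw [axis, axis, ← dec_linN, ← zero_sub (dec _), ← dec_zero, ← dec_subN]
  exact (h j i).imp (congrArg dec) (congrArg dec)

theorem eq_of_axis_eq {i j : Fin 11} (h : axis i = axis j ∨ axis i = -axis j) : i = j := by
  have hd : ∀ i j : Fin 11, axisN i < 243 ∧
      (axisN i = axisN j ∨ axisN i = subN 0 (axisN j) → i = j) := by decide +kernel
  refine (hd i j).2 ?_
  rw [axis, axis, ← zero_sub (dec _), ← dec_zero, ← dec_subN] at h
  exact h.imp (dec_injOn (hd i j).1 (hd j i).1) (dec_injOn (hd i j).1 (subN_lt _ _))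

/-- A linear map that fixes all axes up to sign is `1` or `-1`. -/
theorem eq_smul_of_axis {A : V ≃ₗ[ZMod 3] V} (hA : ∀ i, A (axis i) = axis i ∨ A (axis i) = -axis i) :
    (∀ x, A x = x) ∨ ∀ x, A x = -x := by
  have hs : ∀ i, ∃ s : ZMod 3, (s = 1 ∨ s = -1) ∧ A (axis i) = s • axis i := by
    intro i
    rcases hA i with h | h
    · exact ⟨1, Or.inl rfl, by rw [h, one_smul]⟩
    · exact ⟨-1, Or.inr rfl, by rw [h, neg_one_smul]⟩
  choose s hs hAs using hs
  -- These five axes are the standard basis of `V`, so `A` is diagonal with entries `1` and `-1`.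
  let r : Fin 5 → Fin 11 := ![0, 10, 9, 8, 7]
  have hbasis : ∀ k : Fin 5, (fun j => if k = j then 1 else 0 : V) = axis (r k) := by decide +kernel
  have hcoord : ∀ x k, A x k = s (r k) * x k := by
    intro x k
    have h1 := LinearMap.pi_apply_eq_sum_univ A.toLinearMap x
    have h2 : A x = ∑ i, x i • A (fun j => if i = j then 1 else 0 : V) := h1
    rw [h2, Finset.sum_apply, Finset.sum_eq_single k]
    · rw [hbasis, hAs, ← hbasis, Pi.smul_apply, Pi.smul_apply, smul_eq_mul, smul_eq_mul, if_pos rfl]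
      ring
    · intro i _ hik
      rw [hbasis, hAs, ← hbasis, Pi.smul_apply, Pi.smul_apply, if_neg hik, smul_zero, smul_zero]
    · exact fun h => absurd (Finset.mem_univ k) h
  have hrel : ∀ i k, s (r k) * axis i k = s i * axis i k := by
    intro i k
    rw [← hcoord, hAs, Pi.smul_apply, smul_eq_mul]
  have hunit : ∀ i k, axis i k ≠ 0 → s (r k) = s i := fun i k h => mul_right_cancel₀ h (hrel i k)
  -- An axis with non-zero entries in several coordinates forces their signs to agree. Axis 6 covers
  -- all coordinates but 4, axis 5 all but 0, and these two ranges overlap.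
  have h6 : ∀ k, k ≠ 4 → s (r k) = s 6 := fun k hk => hunit 6 k (by revert k; decide +kernel)
  have h5 : ∀ k, k ≠ 0 → s (r k) = s 5 := fun k hk => hunit 5 k (by revert k; decide +kernel)
  have hall : ∀ k, s (r k) = s 6 := by
    intro k
    by_cases hk : k = 4
    · rw [hk, h5 4 (by decide), ← h5 1 (by decide), h6 1 (by decide)]
    · exact h6 k hk
  rcases hs 6 with h | h
  · left
    intro x
    funext k
    rw [hcoord, hall, h, one_mul]
  · right
    intro x
    funext k
    rw [hcoord, hall, h, neg_one_mul, Pi.neg_apply]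

/-- The side of a vertex. -/
def side : W → ZMod 2 := Sum.elim (fun _ => 0) fun _ => 1

/-- The permutations that normalize the translations and permute the axes as prescribed, together
with their actions on the two sides and on the axes. -/
def axisGroup : Subgroup ((Multiplicative (ZMod 2) × Equiv.Perm (Fin 11)) × Equiv.Perm W) where
  carrier := {g | ∃ A : V ≃ₗ[ZMod 3] V,
    (∀ u p, g.2 (translation (.ofAdd u) p) = translation (.ofAdd (A u)) (g.2 p)) ∧
    (∀ p, side (g.2 p) = g.1.1.toAdd + side p) ∧
    ∀ i, A (axis i) = axis (g.1.2 i) ∨ A (axis i) = -axis (g.1.2 i)}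
  one_mem' := ⟨.refl _ _, fun _ _ => rfl, fun p => (zero_add (side p)).symm, fun _ => Or.inl rfl⟩
  mul_mem' := by
    rintro g h ⟨A, hA, hs, hi⟩ ⟨B, hB, ht, hj⟩
    refine ⟨B.trans A, fun u p => ?_, fun p => ?_, fun i => ?_⟩
    · exact (congrArg g.2 (hB u p)).trans (hA (B u) (h.2 p))
    · exact (hs (h.2 p)).trans (by rw [ht, ← add_assoc]; rfl)
    · change A (B (axis i)) = axis (g.1.2 (h.1.2 i)) ∨ A (B (axis i)) = -axis (g.1.2 (h.1.2 i))
      rcases hj i with h1 | h1 <;> rw [h1]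
      · exact hi _
      · rw [map_neg, neg_inj, neg_eq_iff_eq_neg]
        exact (hi _).symm
  inv_mem' := by
    rintro g ⟨A, hA, hs, hi⟩
    have hg : ∀ p, g.2 (g.2⁻¹ p) = p := g.2.apply_symm_apply
    have hg' : ∀ i, g.1.2 (g.1.2⁻¹ i) = i := g.1.2.apply_symm_apply
    refine ⟨A.symm, fun u p => ?_, fun p => ?_, fun i => ?_⟩
    · change g.2⁻¹ _ = translation _ (g.2⁻¹ p)
      rw [Equiv.Perm.inv_eq_iff_eq, hA, hg, LinearEquiv.apply_symm_apply]
    · change side (g.2⁻¹ p) = -g.1.1.toAdd + side p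
      have h1 := hs (g.2⁻¹ p)
      rw [hg] at h1
      rw [h1, neg_add_cancel_left]
    · change A.symm _ = axis (g.1.2⁻¹ i) ∨ A.symm _ = -axis (g.1.2⁻¹ i)
      have h1 := hi (g.1.2⁻¹ i)
      rw [hg'] at h1
      rw [LinearEquiv.symm_apply_eq, LinearEquiv.symm_apply_eq, map_neg]
      rcases h1 with h1 | h1 <;> rw [h1]
      · exact Or.inl rfl
      · exact Or.inr (neg_neg _).symm

/-- The generators of the complement, in the three actions. -/
noncomputable def tripleGen : Option (Fin 11) →
    (Multiplicative (ZMod 2) × Equiv.Perm (Fin 11)) × Equiv.Perm W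
  | none => ((.ofAdd 1, 1), polarity)
  | some j => ((1, schreier j), gen j)

/-- The polarity inverts translations, so its linear part is `-1`. This only changes the signs of
the axes, and the permutation assigned to it is trivial. -/
theorem tripleGen_mem (o : Option (Fin 11)) : tripleGen o ∈ axisGroup := by
  rcases o with _ | j
  · refine ⟨.neg (ZMod 3), ?_, ?_, fun i => Or.inr rfl⟩
    · rintro u (x | x) <;> simp [tripleGen, add_comm, -ofAdd_neg]
    · rintro (x | x)
      · rfl
      · exact (by decide : (0 : ZMod 2) = 1 + 1)
  · refine ⟨genLin j, ?_, ?_, fun i => genMatrix_axis j i⟩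
    · rintro u (x | x)
      · simp only [tripleGen, translation_inl, gen_inl, genLin_apply, Matrix.mulVec_add]
        rw [add_right_comm]
      · simp only [tripleGen, translation_inr, gen_inr, genLin_apply, Matrix.mulVec_add]
        rw [sub_add_eq_add_sub]
    · rintro (x | x)
      · exact (zero_add _).symm
      · exact (zero_add _).symm

/-- The graph of the isomorphism between `2 × M₁₀` and the complement. -/
noncomputable def tripleGroup :
    Subgroup ((Multiplicative (ZMod 2) × Equiv.Perm (Fin 11)) × Equiv.Perm W) :=
  Subgroup.closure (Set.range tripleGen)

theorem tripleGroup_le : tripleGroup ≤ axisGroup := by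
  rw [tripleGroup, Subgroup.closure_le]
  rintro _ ⟨o, rfl⟩
  exact tripleGen_mem o

theorem map_snd_tripleGroup :
    tripleGroup.map (MonoidHom.snd _ (Equiv.Perm W)) = complementGroup := by
  rw [tripleGroup, MonoidHom.map_closure, complementGroup, ← Set.range_comp]
  congr 1
  ext σ
  constructor
  · rintro ⟨_ | j, rfl⟩
    exacts [Set.mem_insert _ _, Set.mem_insert_of_mem _ ⟨j, rfl⟩]
  · rintro (rfl | ⟨j, rfl⟩)
    exacts [⟨none, rfl⟩, ⟨some j, rfl⟩]

theorem map_fst_tripleGroup : tripleGroup.map (MonoidHom.fst _ (Equiv.Perm W)) =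
    (⊤ : Subgroup (Multiplicative (ZMod 2))).prod mathieuM10 := by
  apply le_antisymm
  · rw [tripleGroup, MonoidHom.map_closure, Subgroup.closure_le]
    rintro _ ⟨_, ⟨_ | j, rfl⟩, rfl⟩
    · exact ⟨trivial, one_mem _⟩
    · exact ⟨trivial, by rw [mathieuM10_eq_closure]; exact Subgroup.subset_closure ⟨j, rfl⟩⟩
  · rw [Subgroup.prod_le_iff]
    constructor
    · rintro _ ⟨a, -, rfl⟩
      have h1 : ((.ofAdd 1, 1) : Multiplicative (ZMod 2) × Equiv.Perm (Fin 11)) ∈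
          tripleGroup.map (MonoidHom.fst _ (Equiv.Perm W)) :=
        ⟨tripleGen none, Subgroup.subset_closure ⟨none, rfl⟩, rfl⟩
      have h2 : ∀ a : Multiplicative (ZMod 2), a = 1 ∨ a = .ofAdd 1 := by decide
      rcases h2 a with rfl | rfl
      · exact one_mem _
      · exact h1
    · rw [mathieuM10_eq_closure, MonoidHom.map_closure, Subgroup.closure_le]
      rintro _ ⟨_, ⟨j, rfl⟩, rfl⟩
      exact ⟨tripleGen (some j), Subgroup.subset_closure ⟨some j, rfl⟩, rfl⟩

theorem polarity_comm {σ : Equiv.Perm W} (hσ : σ ∈ complementGroup) :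
    σ * polarity = polarity * σ := by
  have h : complementGroup ≤ Subgroup.centralizer {polarity} := by
    rw [complementGroup, Subgroup.closure_le]
    rintro _ (rfl | ⟨j, rfl⟩)
    · rw [SetLike.mem_coe, Subgroup.mem_centralizer_singleton_iff]
    · rw [SetLike.mem_coe, Subgroup.mem_centralizer_singleton_iff]
      ext (x | x) : 1 <;> simp [Matrix.mulVec_neg, sub_eq_add_neg, add_comm]
  exact Subgroup.mem_centralizer_singleton_iff.mp (h hσ)

theorem affCol_translation {t : V} (h : ∀ x, affCol (x - t) = affCol x) : t = 0 := by
  have hc : allBelow 243 (fun t => Nat.beq t 0 || !allBelow 243 fun n =>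
      Nat.beq (affColN (subN n t)) (affColN n)) = true := by decide +kernel
  have h1 := allBelow_iff.mp hc _ (enc_lt t)
  have h2 : allBelow 243 (fun n => Nat.beq (affColN (subN n (enc t))) (affColN n)) = true := by
    rw [allBelow_iff]
    intro n hn
    rw [Nat.beq_eq, ← affCol_dec (subN_lt _ _), ← affCol_dec hn, dec_subN, dec_enc, h]
  rw [h2, Bool.not_true, Bool.or_false, Nat.beq_eq] at h1
  rw [← dec_enc t, h1, dec_zero]

theorem not_affCol_neg (t : V) : ¬ ∀ x, affCol (-x - t) = affCol x := by
  intro h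
  have hc : allBelow 243 (fun t => !allBelow 243 fun n =>
      Nat.beq (affColN (subN (subN 0 n) t)) (affColN n)) = true := by decide +kernel
  have h1 := allBelow_iff.mp hc _ (enc_lt t)
  have h2 : allBelow 243 (fun n => Nat.beq (affColN (subN (subN 0 n) (enc t))) (affColN n))
      = true := by
    rw [allBelow_iff]
    intro n hn
    rw [Nat.beq_eq, ← affCol_dec (subN_lt _ _), ← affCol_dec hn, dec_subN, dec_subN, dec_zero,
      zero_sub, dec_enc, h]
  rw [h2, Bool.not_true] at h1
  exact Bool.false_ne_true h1

/-- Such a permutation is `A x + t` on points with `A = 1` or `A = -1`, and commuting with the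
polarity makes it `A x - t` on blocks. No map `x ↦ -x - t` preserves `affCol`, and no non-zero
translation does. -/
theorem eq_one_of_axisGroup {σ : Equiv.Perm W} (h : ((1, 1), σ) ∈ axisGroup)
    (hσ : σ ∈ complementGroup) : σ = 1 := by
  obtain ⟨A, hA, hs, hi⟩ := h
  obtain ⟨t, ht⟩ : ∃ t, σ (.inl 0) = .inl t := by
    have h1 : side (σ (.inl 0)) = 0 + 0 := hs (.inl 0)
    rcases h2 : σ (.inl 0) with t | t
    · exact ⟨t, rfl⟩
    · rw [h2] at h1
      exact absurd h1 (by decide : (1 : ZMod 2) ≠ 0 + 0)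
  have hl : ∀ x, σ (.inl x) = .inl (A x + t) := by
    intro x
    have h1 : σ (translation (.ofAdd x) (.inl 0)) = translation (.ofAdd (A x)) (σ (.inl 0)) := hA x _
    rw [ht, translation_inl, translation_inl, zero_add, add_comm] at h1
    exact h1
  have hr : ∀ x, σ (.inr x) = .inr (A x - t) := by
    intro x
    have h1 := congrArg (fun τ => τ (.inl (-x))) (polarity_comm hσ)
    simp only [Equiv.Perm.mul_apply, polarity_inl, neg_neg, hl] at h1
    rw [h1, map_neg, neg_add, neg_neg, sub_eq_add_neg]
  have hcol : ∀ x, affCol (A x - t) = affCol x := by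
    intro x
    -- The images of the point `x` and the block 0 differ by `A x + 2 t = A x - t`.
    have h1 := bigGroup_le_colGroup (Subgroup.mem_sup_right hσ) (.inl x) (.inr 0)
    rw [hl, hr, col, col, map_zero, zero_sub, sub_neg_eq_add, sub_zero, add_assoc, sub_zmod3_eq,
      ← sub_eq_add_neg] at h1
    exact h1
  rcases eq_smul_of_axis hi with h1 | h1
  · have ht0 : t = 0 := affCol_translation fun x => by rw [← hcol x, h1]
    ext (x | x) : 1
    · rw [hl, h1, ht0, add_zero]
      rfl
    · rw [hr, h1, ht0, sub_zero]
      rfl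
  · exact absurd (fun x => by rw [← hcol x, h1]) (not_affCol_neg t)

/-- A subgroup of a product with both projections injective is the graph of an isomorphism between
its two images; this is the first projection. -/
theorem fst_injective_tripleGroup :
    Function.Injective ((MonoidHom.fst _ (Equiv.Perm W)).subgroupMap tripleGroup) := by
  rw [injective_iff_map_eq_one]
  rintro ⟨⟨⟨a, π⟩, σ⟩, h⟩ h1
  have h2 : (a, π) = (1, 1) := congrArg Subtype.val h1
  obtain ⟨rfl, rfl⟩ := Prod.mk.inj h2
  have hσ : σ ∈ complementGroup := map_snd_tripleGroup ▸ ⟨_, h, rfl⟩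
  rw [Subtype.mk_eq_mk, eq_one_of_axisGroup (tripleGroup_le h) hσ]
  rfl

/-- The permutation of `W` determines the action on the sides and the linear part. The latter
determines the permutation of the axes, since different axes are not equal up to sign. -/
theorem snd_injective_tripleGroup :
    Function.Injective ((MonoidHom.snd _ (Equiv.Perm W)).subgroupMap tripleGroup) := by
  rw [injective_iff_map_eq_one]
  rintro ⟨⟨⟨a, π⟩, σ⟩, h⟩ h1
  have h2 : σ = 1 := congrArg Subtype.val h1
  subst h2
  obtain ⟨A, hA, hs, hi⟩ := tripleGroup_le h
  have ha : a = 1 := by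
    have h3 : side (.inl 0) = a.toAdd + side (.inl 0) := hs (.inl 0)
    exact toAdd_eq_zero.mp (right_eq_add.mp h3)
  have hAx : ∀ u, A u = u := by
    intro u
    have h3 : translation (.ofAdd u) (.inl 0) = translation (.ofAdd (A u)) (.inl 0) := hA u (.inl 0)
    rw [translation_inl, translation_inl, zero_add, zero_add] at h3
    exact (Sum.inl.inj h3).symm
  have hπ : π = 1 := by
    ext1 i
    have h3 : A (axis i) = axis (π i) ∨ A (axis i) = -axis (π i) := hi i
    rw [hAx] at h3
    exact (eq_of_axis_eq h3).symm
  subst ha hπ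
  rfl

/-- The complement is isomorphic to `2 × M₁₀`. -/
noncomputable def complementEquiv : complementGroup ≃* Multiplicative (ZMod 2) × mathieuM10 :=
  (MulEquiv.subgroupCongr map_snd_tripleGroup).symm.trans <|
    (MulEquiv.ofBijective _ ⟨snd_injective_tripleGroup,
      MonoidHom.subgroupMap_surjective _ _⟩).symm.trans <|
    (MulEquiv.ofBijective _ ⟨fst_injective_tripleGroup,
      MonoidHom.subgroupMap_surjective _ _⟩).trans <|
    (MulEquiv.subgroupCongr map_fst_tripleGroup).trans <|
    (Subgroup.prodEquiv _ _).trans (Subgroup.topEquiv.prodCongr (MulEquiv.refl _))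

theorem translation_injective : Function.Injective translation := by
  rw [injective_iff_map_eq_one]
  intro u hu
  have h : (.inl (0 + u.toAdd) : W) = .inl 0 := congrArg (fun σ : Equiv.Perm W => σ (.inl 0)) hu
  rw [zero_add] at h
  exact toAdd_eq_zero.mp (Sum.inl.inj h)

theorem conj_translation_mem {σ : Equiv.Perm W} (hσ : σ ∈ complementGroup) (u : Multiplicative V) :
    σ * translation u * σ⁻¹ ∈ translation.range := by
  rw [← map_snd_tripleGroup] at hσ
  obtain ⟨g, hg, rfl⟩ := hσ
  obtain ⟨A, hA, -⟩ := tripleGroup_le hg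
  refine ⟨.ofAdd (A u.toAdd), ?_⟩
  rw [eq_mul_inv_iff_mul_eq]
  ext p : 1
  exact (hA u.toAdd p).symm

theorem bigGroup_le_normalizer :
    bigGroup ≤ Subgroup.normalizer (translation.range : Set (Equiv.Perm W)) := by
  rw [bigGroup, sup_le_iff]
  refine ⟨Subgroup.le_normalizer, fun σ hσ => ?_⟩
  rw [Subgroup.mem_normalizer_iff]
  intro τ
  constructor
  · rintro ⟨u, rfl⟩
    exact conj_translation_mem hσ u
  · rintro ⟨u, hu⟩
    have h := conj_translation_mem (inv_mem hσ) u
    rwa [hu, inv_inv, mul_assoc, mul_assoc, inv_mul_cancel, mul_one, ← mul_assoc,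
      inv_mul_cancel, one_mul] at h

/-- The complement centralizes the polarity, but the polarity inverts every translation, and `u =
-u` forces `u = 0` in characteristic 3. -/
theorem disjoint_translation_complement : Disjoint translation.range complementGroup := by
  rw [Subgroup.disjoint_def]
  rintro _ ⟨u, rfl⟩ hu
  have h : (.inr (-(0 : V) + u.toAdd) : W) = .inr (-(0 + u.toAdd)) :=
    congrArg (fun τ : Equiv.Perm W => τ (.inl 0)) (polarity_comm hu)
  have h1 := Sum.inr.inj h
  rw [neg_zero, zero_add, ← sub_zmod3_eq, left_eq_add] at h1
  rw [toAdd_eq_zero.mp h1, map_one]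

/-- The automorphism group has the form `3⁵:(2 × M₁₀)`. -/
theorem hasForm_bigGroup : HasForm35TwoM10 bigGroup := by
  have hN : translation.range ≤ bigGroup := le_sup_left
  have hK : complementGroup ≤ bigGroup := le_sup_right
  have hnormal : (translation.range.subgroupOf bigGroup).Normal :=
    (Subgroup.normal_subgroupOf_iff_le_normalizer hN).mpr bigGroup_le_normalizer
  refine ⟨translation.range.subgroupOf bigGroup, complementGroup.subgroupOf bigGroup, hnormal, ?_,
    ⟨(Subgroup.subgroupOfEquivOfLe hN).trans (MonoidHom.ofInjective translation_injective).symm⟩,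
    ⟨(Subgroup.subgroupOfEquivOfLe hK).trans complementEquiv⟩⟩
  refine Subgroup.isComplement'_of_disjoint_and_mul_eq_univ ?_ ?_
  · rw [Subgroup.disjoint_def]
    intro g h1 h2
    exact Subtype.ext (Subgroup.disjoint_def.mp disjoint_translation_complement h1 h2)
  · rw [← Subgroup.normal_mul, ← Subgroup.subgroupOf_sup hN hK]
    exact Set.eq_univ_of_forall fun g => g.2

theorem HasForm35TwoM10.of_mulEquiv {G G' : Type*} [Group G] [Group G'] (e : G ≃* G')
    (h : HasForm35TwoM10 G) : HasForm35TwoM10 G' := by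
  obtain ⟨N, K, hN, hNK, ⟨eN⟩, ⟨eK⟩⟩ := h
  refine ⟨N.map e.toMonoidHom, K.map e.toMonoidHom, hN.map _ e.surjective, ?_,
    ⟨(e.subgroupMap N).symm.trans eN⟩, ⟨(e.subgroupMap K).symm.trans eK⟩⟩
  refine Subgroup.isComplement'_of_disjoint_and_mul_eq_univ ?_ ?_
  · rw [Subgroup.disjoint_def]
    rintro _ ⟨x, hx, rfl⟩ ⟨y, hy, hxy⟩
    obtain rfl : y = x := e.injective hxy
    have h1 : y = 1 := Subgroup.disjoint_def.mp hNK.disjoint hx hy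
    rw [h1, map_one]
  · refine Set.eq_univ_of_forall fun g => ?_
    obtain ⟨⟨x, y⟩, hxy⟩ := hNK.2 (e.symm g)
    refine ⟨e x, ⟨x, x.2, rfl⟩, e y, ⟨y, y.2, rfl⟩, ?_⟩
    have h1 : (x : G) * y = e.symm g := hxy
    change e x * e y = g
    rw [← map_mul, h1, MulEquiv.apply_symm_apply]

/-! ## The Golay code and its cosets -/

/-- The syndromes of the standard basis vectors. -/
def checkCol (i : ZMod 11) : V := dec (entry 8 126691294961647101938303745 i.val)

/-- The syndrome map, whose kernel is the Golay code. -/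
noncomputable def syndrome : (ZMod 11 → ZMod 3) →ₗ[ZMod 3] V :=
  Fintype.linearCombination (ZMod 3) checkCol

theorem syndrome_stdVec (i : ZMod 11) : syndrome (stdVec i) = checkCol i := by
  rw [syndrome, stdVec, Fintype.linearCombination_apply_single, one_smul]

theorem syndrome_shift (i : ZMod 11) : syndrome (fun j => golayWord (j - i)) = 0 := by
  have h : ∀ i : ZMod 11, ∑ j : ZMod 11, golayWord (j - i) • checkCol j = 0 := by
    decide +kernel
  rw [syndrome, Fintype.linearCombination_apply]
  exact h i

/-- The word supported on the first five coordinates with a given syndrome. -/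
noncomputable def leader : V →ₗ[ZMod 3] (ZMod 11 → ZMod 3) :=
  Fintype.linearCombination (ZMod 3) fun k : Fin 5 => stdVec k.val

/-- The coefficients that express the code words `e i - leader (checkCol i)` by cyclic shifts. -/
def shiftCoeff : ZMod 11 → ZMod 11 → ZMod 3 :=
  (![0, 0, 0, 0, 0, ![0, 2, 0, 0, 2, 0, 0, 0, 0, 0, 0], ![0, 0, 2, 0, 0, 2, 0, 0, 0, 0, 0],
    ![1, 1, 2, 1, 0, 0, 0, 0, 0, 0, 0], ![0, 2, 1, 2, 2, 0, 0, 0, 0, 0, 0],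
    ![0, 1, 2, 1, 0, 2, 0, 0, 0, 0, 0], ![1, 0, 0, 1, 0, 0, 0, 0, 0, 0, 0]] :
    Fin 11 → Fin 11 → ZMod 3)

theorem stdVec_sub_leader_mem (i : ZMod 11) : stdVec i - leader (checkCol i) ∈ golayCode := by
  have h : ∀ i : ZMod 11, stdVec i - ∑ k : Fin 5, checkCol i k • stdVec k.val =
      ∑ j : ZMod 11, shiftCoeff i j • fun k => golayWord (k - j) := by
    decide +kernel
  rw [leader, Fintype.linearCombination_apply, h]
  exact sum_mem fun j _ => Submodule.smul_mem _ _ (Submodule.subset_span ⟨j, rfl⟩)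

theorem sub_leader_mem (x : ZMod 11 → ZMod 3) : x - leader (syndrome x) ∈ golayCode := by
  have hx : x = ∑ i, x i • stdVec i := by
    simp only [stdVec, ← Pi.single_smul, smul_eq_mul, mul_one, Finset.univ_sum_single]
  have h : x - leader (syndrome x) = ∑ i, x i • (stdVec i - leader (checkCol i)) := by
    simp only [smul_sub, Finset.sum_sub_distrib, ← hx, ← syndrome_stdVec, ← map_smul, ← map_sum]
  rw [h]
  exact sum_mem fun i _ => Submodule.smul_mem _ _ (stdVec_sub_leader_mem i)

/-- The cyclic shifts have syndrome 0. Conversely, every word differs from the `leader` of its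
syndrome by a code word, and that leader is 0 when the syndrome is 0. -/
theorem ker_syndrome : LinearMap.ker syndrome = golayCode := by
  apply le_antisymm
  · intro x hx
    have h := sub_leader_mem x
    rwa [LinearMap.mem_ker.mp hx, map_zero, sub_zero] at h
  · rw [golayCode, Submodule.span_le]
    rintro _ ⟨i, rfl⟩
    exact syndrome_shift i

theorem syndrome_leader (v : V) : syndrome (leader v) = v := by
  have h : ∀ k : Fin 5, checkCol k.val = Pi.single k 1 := by decide +kernel
  simp only [leader, Fintype.linearCombination_apply, map_sum, map_smul, syndrome_stdVec, h, ← Pi.single_smul, smul_eq_mul, mul_one,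
    Finset.univ_sum_single]

/-- The cosets of the Golay code in coordinates. -/
noncomputable def cosetEquiv : GolayCoset ≃ₗ[ZMod 3] V :=
  (Submodule.quotEquivOfEq _ _ ker_syndrome.symm).trans
    (syndrome.quotKerEquivOfSurjective fun v => ⟨_, syndrome_leader v⟩)

theorem cosetEquiv_mkQ (w : ZMod 11 → ZMod 3) : cosetEquiv (golayCode.mkQ w) = syndrome w := rfl

/-! ## The blocks -/

/-- The syndromes of the words that define the base block. -/
def baseList (m : ZMod 11) : List V :=
  [-checkCol m, checkCol 0 - checkCol (2 * m), -checkCol 0 + checkCol (2 * m),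
    checkCol m - checkCol (2 * m), checkCol m + checkCol (6 * m), checkCol m - checkCol (8 * m),
    checkCol m + checkCol (10 * m), checkCol (2 * m) + checkCol (7 * m),
    -checkCol (2 * m) - checkCol (6 * m)]

/-- This is the link between the definition of the base block by words and the colouring: in
coordinates the base block is the class of 45 vectors, so incidence becomes the colour 5. -/
theorem mem_baseCoclique (x : GolayCoset) : x ∈ baseCoclique ↔ affCol (cosetEquiv x) = 5 := by
  have h1 : x ∈ baseCoclique ↔
      ∃ m ∈ ([1, 3, 4, 5, 9] : List (ZMod 11)), cosetEquiv x ∈ baseList m := by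
    obtain ⟨v, rfl⟩ := golayCode.mkQ_surjective x
    have h : ∀ w, golayCode.mkQ v = golayCode.mkQ w ↔ syndrome v = syndrome w := fun w => by
      rw [← cosetEquiv_mkQ, ← cosetEquiv_mkQ, cosetEquiv.injective.eq_iff]
    simp only [baseCoclique, Set.mem_ofPred_eq, h, Set.mem_insert_iff, Set.mem_singleton_iff,
      List.mem_cons, List.not_mem_nil, or_false, cosetEquiv_mkQ, baseList]
    refine exists_congr fun m => and_congr_right fun _ => ?_
    simp only [or_and_right, exists_or, exists_eq_left, map_neg, map_sub, map_add, syndrome_stdVec]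
  rw [h1]
  have h2 : ∀ m ∈ ([1, 3, 4, 5, 9] : List (ZMod 11)), ∀ v ∈ baseList m, affCol v = 5 := by
    decide +kernel
  have h3 : ∀ n ∈ List.range 243, affColN n = 5 →
      ∃ m ∈ ([1, 3, 4, 5, 9] : List (ZMod 11)), dec n ∈ baseList m := by
    decide +kernel
  refine ⟨fun ⟨m, hm, h⟩ => h2 m hm _ h, fun h => ?_⟩
  have h4 := h3 _ (List.mem_range.mpr (enc_lt (cosetEquiv x))) h
  rwa [dec_enc] at h4

theorem mem_translate_baseCoclique (x w : GolayCoset) :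
    x ∈ (fun x => w + x) '' baseCoclique ↔ affCol (cosetEquiv x - cosetEquiv w) = 5 := by
  rw [Set.image_add_left, Set.mem_preimage, mem_baseCoclique, map_add, map_neg, neg_add_eq_sub]

/-- The base block has trivial stabilizer among the translations, so its 243 translates are
distinct. -/
theorem eq_zero_of_affCol_sub {t : V} (h : ∀ x, affCol (x - t) = 5 ↔ affCol x = 5) : t = 0 := by
  have hk : allBelow 243 (fun n => Nat.beq n 0 || !allBelow 243 fun k =>
      Nat.beq (affColN (subN k n)) 5 == Nat.beq (affColN k) 5) = true := by
    decide +kernel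
  rw [← dec_enc t, ← dec_zero]
  have h1 := allBelow_iff.mp hk _ (enc_lt t)
  rw [Bool.or_eq_true, Bool.not_eq_true', Bool.eq_false_iff, ne_eq, allBelow_iff] at h1
  rcases h1 with h1 | h1
  · rw [Nat.eq_of_beq_eq_true h1]
  · refine absurd (fun k hk => ?_) h1
    rw [beq_iff_eq, Bool.eq_iff_iff, Nat.beq_eq, Nat.beq_eq, ← affCol_dec hk,
      ← affCol_dec (subN_lt _ _), dec_subN, dec_enc]
    exact h _

/-- The blocks in coordinates. -/
noncomputable def blockEquiv : V ≃ krBlocks :=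
  Equiv.ofBijective (fun v => ⟨(fun x => cosetEquiv.symm v + x) '' baseCoclique, _, rfl⟩) <| by
    constructor
    · intro v w h
      have h1 := Subtype.ext_iff.mp h
      rw [← sub_eq_zero]
      refine eq_zero_of_affCol_sub fun x => ?_
      have h2 := Set.ext_iff.mp h1 (cosetEquiv.symm (x + w))
      simp only [mem_translate_baseCoclique, LinearEquiv.apply_symm_apply] at h2
      rwa [add_sub_cancel_right, add_sub_assoc, ← neg_sub v w, ← sub_eq_add_neg] at h2
    · rintro ⟨_, w, rfl⟩
      refine ⟨cosetEquiv w, ?_⟩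
      simp only [LinearEquiv.symm_apply_apply]

theorem mem_blockEquiv (x : GolayCoset) (v : V) :
    x ∈ (blockEquiv v).1 ↔ affCol (cosetEquiv x - v) = 5 :=
  (mem_translate_baseCoclique x _).trans (by rw [LinearEquiv.apply_symm_apply])

/-- The vertices of the Koolen–Riebeek graph in coordinates. -/
noncomputable def vertexEquiv : KRVertex ≃ W :=
  Equiv.sumCongr cosetEquiv.toEquiv blockEquiv.symm

theorem koolenRiebeekGraph_adj (p q : KRVertex) :
    koolenRiebeekGraph.Adj p q ↔ krModel.Adj (vertexEquiv p) (vertexEquiv q) := by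
  have h : ∀ (x : GolayCoset) (B : krBlocks),
      affCol (cosetEquiv x - blockEquiv.symm B) = 5 ↔ x ∈ B.1 := fun x B => by
    rw [← mem_blockEquiv, Equiv.apply_symm_apply]
  rcases p with x | B <;> rcases q with y | C
  · simp [koolenRiebeekGraph, incidenceGraph, vertexEquiv, not_krModel_inl_inl]
  · simpa [koolenRiebeekGraph, incidenceGraph, vertexEquiv, krModel_inl_inr] using (h x C).symm
  · simpa [koolenRiebeekGraph, incidenceGraph, vertexEquiv, krModel_inr_inl] using (h y B).symm
  · simp [koolenRiebeekGraph, incidenceGraph, vertexEquiv, not_krModel_inr_inr]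

theorem card_krVertex : Nat.card KRVertex = 486 := by
  rw [Nat.card_congr (vertexEquiv.trans vertEquiv.symm), Nat.card_fin]

theorem ncard_affCol_eq_five (w : V) : {x : V | affCol (x - w) = 5}.ncard = 45 := by
  have h0 : {x : V | affCol (x - w) = 5} =
      (fun n => dec n + w) '' ((List.range 243).filter fun n => Nat.beq (affColN n) 5).toFinset := by
    ext x
    simp only [Set.mem_ofPred_eq, Set.mem_image, Finset.mem_coe, List.mem_toFinset,
      List.mem_filter, List.mem_range, Nat.beq_eq]
    constructor
    · exact fun h => ⟨enc (x - w), ⟨enc_lt _, h⟩, by rw [dec_enc, sub_add_cancel]⟩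
    · rintro ⟨n, ⟨hn, h⟩, rfl⟩
      rwa [add_sub_cancel_right, affCol_dec hn]
  rw [h0, Set.InjOn.ncard_image, Set.ncard_coe_finset,
    List.toFinset_card_of_nodup (List.nodup_range.filter _)]
  · decide +kernel
  · intro m hm n hn h
    simp only [Finset.mem_coe, List.mem_toFinset, List.mem_filter, List.mem_range] at hm hn
    rw [← enc_dec hm.1, ← enc_dec hn.1, add_right_cancel h]

theorem ncard_of_mem_krBlocks {B : Set GolayCoset} (hB : B ∈ krBlocks) : B.ncard = 45 := by
  obtain ⟨w, rfl⟩ := hB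
  rw [← ncard_affCol_eq_five (cosetEquiv w), ← Set.ncard_image_of_injective _ cosetEquiv.injective]
  congr 1
  ext x
  obtain ⟨y, rfl⟩ := cosetEquiv.surjective x
  rw [cosetEquiv.injective.mem_set_image, mem_translate_baseCoclique]
  rfl

/-- The difference of two cosets at distance one in the coset graph. -/
theorem linCol_of_hammingDist_eq_one {u v : ZMod 11 → ZMod 3} (h : hammingDist u v = 1) :
    linCol (syndrome u - syndrome v) = 1 ∨ linCol (syndrome u - syndrome v) = 2 := by
  obtain ⟨i, hi⟩ := Finset.card_eq_one.mp h
  have h1 : u - v = (u i - v i) • stdVec i := by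
    rw [stdVec, ← Pi.single_smul, smul_eq_mul, mul_one]
    funext j
    by_cases hj : j = i
    · subst hj
      simp
    · have : j ∉ ({i} : Finset (ZMod 11)) := by simpa using hj
      rw [← hi] at this
      simpa [Pi.single_eq_of_ne hj, sub_eq_zero] using this
  have h2 : u i - v i ≠ 0 := by
    have : i ∈ ({i} : Finset (ZMod 11)) := Finset.mem_singleton_self i
    rw [← hi] at this
    simpa [sub_eq_zero] using this
  rw [← map_sub, h1, map_smul, syndrome_stdVec]
  have h3 : ∀ (a : ZMod 3) (i : ZMod 11), a ≠ 0 →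
      linCol (a • checkCol i) = 1 ∨ linCol (a • checkCol i) = 2 := by
    decide +kernel
  exact h3 _ i h2

/-- Adjacent cosets differ by a non-zero multiple of a syndrome of a basis vector, which has colour
1 or 2. No two vectors of the base block have such a difference, and translation preserves
differences. -/
theorem isIndepSet_of_mem_krBlocks {B : Set GolayCoset} (hB : B ∈ krBlocks) :
    golayCosetGraph.IsIndepSet B := by
  obtain ⟨w, rfl⟩ := hB
  have hk : allBelow 243 (fun m => !Nat.beq (affColN m) 5 || allBelow 243 fun n =>
      !Nat.beq (affColN n) 5 || !(Nat.beq (linColN (subN m n)) 1 || Nat.beq (linColN (subN m n)) 2))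
      = true := by
    decide +kernel
  have key : ∀ x y : V, affCol x = 5 → affCol y = 5 →
      ¬ (linCol (x - y) = 1 ∨ linCol (x - y) = 2) := by
    refine forall_vec fun m hm => forall_vec fun n hn h1 h2 => ?_
    have h3 := allBelow_iff.mp hk m hm
    rw [affCol_dec hm] at h1
    rw [affCol_dec hn] at h2
    rw [Bool.or_eq_true, allBelow_iff] at h3
    have h4 := (h3.resolve_left (by simp [h1])) n hn
    rw [← dec_subN, linCol_dec (subN_lt _ _)]
    simpa [h2, ← Nat.beq_eq] using h4
  have key2 : ∀ x y : GolayCoset, x ∈ (fun x => w + x) '' baseCoclique →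
      y ∈ (fun x => w + x) '' baseCoclique →
      ¬ ∃ u v : ZMod 11 → ZMod 3,
        golayCode.mkQ u = x ∧ golayCode.mkQ v = y ∧ hammingDist u v = 1 := by
    rintro _ _ hx hy ⟨u, v, rfl, rfl, h⟩
    rw [mem_translate_baseCoclique, cosetEquiv_mkQ] at hx hy
    refine key _ _ hx hy ?_
    rw [sub_sub_sub_cancel_right]
    exact linCol_of_hammingDist_eq_one h
  intro x hx y hy _ hadj
  rw [golayCosetGraph, SimpleGraph.fromRel_adj] at hadj
  exact hadj.2.elim (key2 x y hx hy) (key2 y x hy hx)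

/-! ## The automorphism group of the Koolen–Riebeek graph -/

/-- The colour of a pair of vertices of the Koolen–Riebeek graph. -/
noncomputable def krCol (p q : KRVertex) : ℕ := col (vertexEquiv p) (vertexEquiv q)

theorem krCol_symm (p q : KRVertex) : krCol p q = krCol q p := col_symm _ _

/-- A union of colour classes is isomorphic to its version in coordinates. -/
noncomputable def colGraphIso (S : ℕ) : colGraph krCol krCol_symm S ≃g colGraph col col_symm S where
  toEquiv := vertexEquiv
  map_rel_iff' := and_congr vertexEquiv.injective.ne_iff Iff.rfl

theorem koolenRiebeekGraph_eq : koolenRiebeekGraph = colGraph krCol krCol_symm 32 := by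
  ext p q
  rw [koolenRiebeekGraph_adj]
  exact (colGraphIso 32).map_adj_iff

theorem permCongr_mem_bigGroup (g : Equiv.Perm KRVertex) :
    vertexEquiv.permCongrHom g ∈ bigGroup ↔ g ∈ autGroup koolenRiebeekGraph := by
  rw [← autGroup_krModel]
  change (∀ p q, _) ↔ ∀ p q, _
  rw [vertexEquiv.forall_congr_left]
  refine forall_congr' fun p => ?_
  rw [vertexEquiv.forall_congr_left]
  refine forall_congr' fun q => ?_
  rw [koolenRiebeekGraph_adj, koolenRiebeekGraph_adj]
  simp [Equiv.permCongrHom]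

/-- The automorphism group in coordinates. -/
noncomputable def autEquiv : autGroup koolenRiebeekGraph ≃* bigGroup :=
  (vertexEquiv.permCongrHom.subgroupMap _).trans <| MulEquiv.subgroupCongr <| by
    ext g
    obtain ⟨g, rfl⟩ := vertexEquiv.permCongrHom.surjective g
    rw [permCongr_mem_bigGroup]
    exact Subgroup.mem_map_iff_mem vertexEquiv.permCongrHom.injective

theorem krIsScheme : IsScheme (autGroup koolenRiebeekGraph) krCol interNum where
  lt _ _ := col_lt _ _
  symm := krCol_symm
  eq_zero_iff p q := (col_eq_zero_iff _ _).trans vertexEquiv.injective.eq_iff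
  map_eq g hg p q := by
    have h := isScheme.map_eq _ ((permCongr_mem_bigGroup g).mpr hg) (vertexEquiv p) (vertexEquiv q)
    simp only [Equiv.permCongrHom, MulEquiv.coe_mk, Equiv.permCongr_apply, Equiv.symm_apply_apply] at h
    exact h
  exists_map p q p' q' h := by
    obtain ⟨g, hg, h1, h2⟩ := isScheme.exists_map _ _ _ _ h
    obtain ⟨g, rfl⟩ := vertexEquiv.permCongrHom.surjective g
    refine ⟨g, (permCongr_mem_bigGroup g).mp hg, vertexEquiv.injective ?_, vertexEquiv.injective ?_⟩
    · simpa [Equiv.permCongrHom] using h1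
    · simpa [Equiv.permCongrHom] using h2
  exists_color p k hk := by
    obtain ⟨q, hq⟩ := isScheme.exists_color (vertexEquiv p) k hk
    exact ⟨vertexEquiv.symm q, by rw [krCol, Equiv.apply_symm_apply, hq]⟩
  ncard_eq p q i hi j hj := by
    rw [krCol, ← isScheme.ncard_eq _ _ i hi j hj, ← Set.ncard_image_of_injective _ vertexEquiv.injective]
    congr 1
    ext z
    obtain ⟨z, rfl⟩ := vertexEquiv.surjective z
    rw [vertexEquiv.injective.mem_set_image]
    rfl

/-! ## Complete, complete bipartite and complete multipartite graphs -/

theorem colGraph_eq_top {Ω : Type*} {H : Subgroup (Equiv.Perm Ω)} {c : Ω → Ω → ℕ}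
    {P : ℕ → ℕ → ℕ → ℕ} (h : IsScheme H c P) : colGraph c h.symm 510 = ⊤ := by
  have h1 : ∀ k < 9, k ≠ 0 → Nat.testBit 510 k = true := by decide
  ext p q
  rw [SimpleGraph.top_adj]
  exact and_iff_left_of_imp fun hpq => h1 _ (h.lt p q) ((h.eq_zero_iff p q).not.mpr hpq)

/-- The numbering of the vectors. -/
def vecEquiv : V ≃ Fin 243 where
  toFun x := ⟨enc x, enc_lt x⟩
  invFun n := dec n
  left_inv x := dec_enc x
  right_inv n := Fin.ext (enc_dec n.2)

theorem nonempty_iso_completeBipartiteGraph :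
    Nonempty (colGraph col col_symm 232 ≃g completeBipartiteGraph (Fin 243) (Fin 243)) := by
  refine ⟨⟨Equiv.sumCongr vecEquiv vecEquiv, ?_⟩⟩
  have hl : ∀ c ∈ ({0, 1, 2, 4, 8} : Finset ℕ), Nat.testBit 232 c = false := by decide
  have ha : ∀ c ∈ ({3, 5, 6, 7} : Finset ℕ), Nat.testBit 232 c = true := by decide
  rintro (x | x) (y | y)
  · simp [completeBipartiteGraph, colGraph, col, hl _ (linCol_mem _)]
  · simp [completeBipartiteGraph, colGraph, col, ha _ (affCol_mem _)]
  · simp [completeBipartiteGraph, colGraph, col, ha _ (affCol_mem _)]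
  · simp [completeBipartiteGraph, colGraph, col, hl _ (linCol_mem _)]

theorem enc_div_three_eq_iff (x y : V) :
    enc x / 3 = enc y / 3 ↔ x 1 = y 1 ∧ x 2 = y 2 ∧ x 3 = y 3 ∧ x 4 = y 4 := by
  have hx := fun i => ZMod.val_lt (x i)
  have hy := fun i => ZMod.val_lt (y i)
  have := hx 0
  have := hx 1
  have := hx 2
  have := hx 3
  have := hx 4
  have := hy 0
  have := hy 1
  have := hy 2
  have := hy 3
  have := hy 4
  simp only [← (ZMod.val_injective 3).eq_iff, enc]
  omega

/-- The colours 0 and 1 together make up the line through the first basis vector, that is, the codes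
0, 1, 2. Its cosets are the classes of equal quotient by 3. -/
theorem testBit_linCol_sub_iff (x y : V) : Nat.testBit 508 (linCol (x - y)) = false ↔
    enc x / 3 = enc y / 3 := by
  have h1 : ∀ c ∈ ({0, 1, 2, 4, 8} : Finset ℕ), Nat.testBit 508 c = !Nat.ble c 1 := by decide
  have h2 : allBelow 243 (fun n => Nat.ble (linColN n) 1 == Nat.beq (Nat.div n 3) 0) = true := by
    decide +kernel
  have h3 := allBelow_iff.mp h2 _ (enc_lt (x - y))
  rw [beq_iff_eq] at h3
  rw [h1 _ (linCol_mem _), linCol, h3, Bool.not_eq_false', Nat.beq_eq, enc_div_three_eq_iff]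
  refine (enc_div_three_eq_iff (x - y) 0).trans ?_
  simp [sub_eq_zero]

/-- As 3 divides the offset 243, the quotients of the vertex numbers by 3 number the 81 + 81 parts
on the two sides without overlap. -/
theorem nonempty_iso_completeEquipartiteGraph :
    Nonempty (colGraph col col_symm 508 ≃g SimpleGraph.completeEquipartiteGraph 162 3) := by
  refine ⟨⟨vertEquiv.symm.trans (finProdFinEquiv (m := 162) (n := 3)).symm, ?_⟩⟩
  have ha : ∀ c ∈ ({3, 5, 6, 7} : Finset ℕ), Nat.testBit 508 c = true := by decide
  have h0 : ∀ p q : W, (colGraph col col_symm 508).Adj p q ↔ Nat.testBit 508 (col p q) = true := by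
    intro p q
    refine and_iff_right_of_imp fun h hpq => ?_
    rw [(col_eq_zero_iff p q).mpr hpq] at h
    simp at h
  have key : ∀ p q : W, vnum p / 3 ≠ vnum q / 3 ↔ Nat.testBit 508 (col p q) = true := by
    rintro (x | x) (y | y)
    · rw [← Bool.not_eq_false, col, testBit_linCol_sub_iff]
      rfl
    · have hx := enc_lt x
      have h : vnum (.inl x) / 3 ≠ vnum (.inr y) / 3 := by
        change enc x / 3 ≠ (enc y + 243) / 3
        omega
      exact iff_of_true h (ha _ (affCol_mem _))
    · have hy := enc_lt y
      have h : vnum (.inr x) / 3 ≠ vnum (.inl y) / 3 := by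
        change (enc x + 243) / 3 ≠ enc y / 3
        omega
      exact iff_of_true h (ha _ (affCol_mem _))
    · rw [← Bool.not_eq_false, col, testBit_linCol_sub_iff, ne_eq, not_iff_not]
      change (enc x + 243) / 3 = (enc y + 243) / 3 ↔ _
      omega
  intro p q
  rw [h0, ← key]
  exact Fin.ext_iff.not

/-! ## The symmetric net -/

/-- The last four coordinates are mapped to the first by a quadratic function. -/
def quadFun (x : V) : ZMod 3 :=
  2 * x 2 + x 1 * x 2 + 2 * x 1 * x 3 + 2 * x 1 * x 4 + x 2 * x 3 + x 2 * x 4 + x 3 * x 4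

/-- The colours 3 and 5 cover 36 + 45 = 81 vectors, one for each choice of the last four
coordinates. -/
theorem testBit_affCol_iff (x : V) : Nat.testBit 40 (affCol x) = true ↔ x 0 = quadFun x := by
  have h : ∀ n ∈ List.range 243,
      Nat.testBit 40 (affColN n) = decide (dec n 0 = quadFun (dec n)) := by
    decide +kernel
  have h1 := h _ (List.mem_range.mpr (enc_lt x))
  rw [dec_enc] at h1
  rw [affCol, h1, decide_eq_true_iff]

/-- Turns the point sets of the blocks into affine hyperplanes. -/
def shear : V ≃ V where
  toFun x := ![x 0 - quadFun x, x 1, x 2, x 3, x 4]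
  invFun x := ![x 0 + quadFun x, x 1, x 2, x 3, x 4]
  left_inv x := by
    funext i
    fin_cases i <;> simp [quadFun]
  right_inv x := by
    funext i
    fin_cases i <;> simp [quadFun]

/-- The coefficients of the linear form that defines the hyperplane of a block. -/
def blockRow (w : V) : V :=
  ![1, w 2 + 2 * w 3 + 2 * w 4, w 1 + w 3 + w 4, 2 * w 1 + w 2 + w 4, 2 * w 1 + w 2 + w 3]

/-- The constant term of the equation of the hyperplane of a block. -/
def blockConst (w : V) : ZMod 3 := w 0 + quadFun w - w 2

/-- In the expansion of `quadFun (x - w)` the terms in `x` alone are absorbed by `shear`, and the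
mixed terms are linear in `x` with coefficients linear in `w`. A translate of the graph of `quadFun`
thus becomes a hyperplane whose first coefficient is 1. -/
theorem testBit_affCol_sub_iff (x w : V) :
    Nat.testBit 40 (affCol (x - w)) = true ↔ ∑ i, shear x i * blockRow w i = blockConst w := by
  have h3 : (3 : ZMod 3) = 0 := rfl
  rw [testBit_affCol_iff, ← sub_eq_zero, ← sub_eq_zero (a := ∑ i, _)]
  refine Eq.congr ?_ rfl
  simp only [Fin.sum_univ_five, shear, blockRow, blockConst, quadFun, Equiv.coe_fn_mk,
    Matrix.cons_val, Pi.sub_apply]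
  linear_combination (w 2) * h3

/-- The block with a given row of coefficients and constant term. -/
def rowBlock (r : V) (c : ZMod 3) : V :=
  let w : V := ![0, r 1 + r 3 + r 4, r 2 + 2 * r 3 + 2 * r 4, r 1 + 2 * r 2 + 2 * r 3,
    r 1 + 2 * r 2 + 2 * r 4]
  ![c - quadFun w + w 2, w 1, w 2, w 3, w 4]

/-- The polar form of `quadFun` is non-degenerate on the last four coordinates; `rowBlock` contains
its inverse matrix. -/
theorem blockRow_rowBlock {r : V} (h : r 0 = 1) (c : ZMod 3) : blockRow (rowBlock r c) = r := by
  have h3 : (3 : ZMod 3) = 0 := rfl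
  funext i
  fin_cases i
  · exact h.symm
  all_goals
    simp only [blockRow, rowBlock, Matrix.cons_val, Fin.mk_one, Fin.reduceFinMk]
  · linear_combination (r 1 + 3 * r 2 + 2 * r 3 + 2 * r 4) * h3
  · linear_combination (r 1 + r 2 + r 3 + r 4) * h3
  · linear_combination (r 1 + r 2 + r 3 + 2 * r 4) * h3
  · linear_combination (r 1 + r 2 + 2 * r 3 + r 4) * h3

theorem blockConst_rowBlock (r : V) (c : ZMod 3) : blockConst (rowBlock r c) = c := by
  simp only [blockConst, rowBlock, quadFun, Matrix.cons_val]
  ring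

theorem rowBlock_blockRow (w : V) : rowBlock (blockRow w) (blockConst w) = w := by
  have h3 : (3 : ZMod 3) = 0 := rfl
  have h : ∀ i : Fin 5, i ≠ 0 → rowBlock (blockRow w) (blockConst w) i = w i := by
    intro i hi
    fin_cases i
    · exact absurd rfl hi
    all_goals
      simp only [blockRow, rowBlock, Matrix.cons_val, Fin.mk_one, Fin.reduceFinMk]
    · linear_combination (w 1 + w 2 + w 3 + w 4) * h3
    · linear_combination (3 * w 1 + w 2 + w 3 + w 4) * h3
    · linear_combination (2 * w 1 + w 2 + w 3 + 2 * w 4) * h3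
    · linear_combination (2 * w 1 + w 2 + 2 * w 3 + w 4) * h3
  funext i
  by_cases hi : i = 0
  · subst hi
    have h0 := blockConst_rowBlock (blockRow w) (blockConst w)
    generalize rowBlock (blockRow w) (blockConst w) = u at h h0 ⊢
    simp only [blockConst, quadFun, h 1 (by decide), h 2 (by decide), h 3 (by decide),
      h 4 (by decide)] at h0
    linear_combination h0
  · exact h i hi

/-- Every non-zero vector is the first vector of a basis. -/
theorem exists_basis_zero_eq {d : V} (hd : d ≠ 0) :
    ∃ b : Module.Basis (Fin 5) (ZMod 3) V, b 0 = d := by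
  obtain ⟨f, hf, -⟩ := Submodule.exists_dual_map_eq_bot_of_notMem (p := (⊥ : Submodule (ZMod 3) V))
    (x := d) hd inferInstance
  have hf0 : f ≠ 0 := fun h => hf (by rw [h, LinearMap.zero_apply])
  have hrank : Module.finrank (ZMod 3) (LinearMap.ker f) = 4 := by
    have := f.finrank_ker_add_one_of_ne_zero hf0
    rw [Module.finrank_fin_fun] at this
    omega
  refine ⟨Module.Basis.mkFinCons d (Module.finBasisOfFinrankEq _ _ hrank) ?_ ?_, ?_⟩
  · intro c x hx h
    have h1 := congrArg f h
    rw [map_add, map_smul, LinearMap.mem_ker.mp hx, add_zero, map_zero, smul_eq_mul] at h1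
    exact (mul_eq_zero.mp h1).resolve_right hf
  · intro z
    refine ⟨-(f z / f d), ?_⟩
    rw [LinearMap.mem_ker, map_add, map_smul, smul_eq_mul, neg_mul, div_mul_cancel₀ _ hf,
      add_neg_cancel]
  · rw [Module.Basis.coe_mkFinCons, Fin.cons_zero]

/-- The parallel of `B` through `p` contains `q` exactly when `q - p` is a direction of `B`. -/
theorem mem_netFlats_iff (p q : V) (B : AffineSubspace (ZMod 3) V) : B ∈ netFlats p q ↔
    Module.finrank (ZMod 3) B.direction = 4 ∧ q - p ∉ B.direction := by
  refine and_congr_right fun h4 => not_congr ⟨?_, fun h => ⟨AffineSubspace.mk' p B.direction, ?_, ?_, ?_⟩⟩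
  · rintro ⟨B', hB, hp, hq⟩
    rw [← hB.direction_eq]
    exact AffineSubspace.vsub_mem_direction hq hp
  · rw [AffineSubspace.parallel_iff_direction_eq_and_eq_bot_iff_eq_bot,
      AffineSubspace.direction_mk']
    -- Parallelism requires that both flats be non-empty; the empty flat has a direction of
    -- dimension 0, not 4.
    refine ⟨rfl, iff_of_false ((AffineSubspace.nonempty_iff_ne_bot _).mp ⟨p, AffineSubspace.self_mem_mk' _ _⟩) ?_⟩
    rintro rfl
    rw [AffineSubspace.direction_bot, finrank_bot] at h4
    exact absurd h4 (by norm_num)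
  · exact AffineSubspace.self_mem_mk' _ _
  · rwa [AffineSubspace.mem_mk']

/-- The hyperplane with the equation `f x = c`, for a form `f` with `f d = 1`. -/
noncomputable def levelFlat (d : V) (f : V →ₗ[ZMod 3] ZMod 3) (c : ZMod 3) :
    AffineSubspace (ZMod 3) V :=
  AffineSubspace.mk' (c • d) (LinearMap.ker f)

theorem mem_levelFlat {d : V} {f : V →ₗ[ZMod 3] ZMod 3} (hf : f d = 1) (c : ZMod 3) (x : V) :
    x ∈ levelFlat d f c ↔ f x = c := by
  rw [levelFlat, AffineSubspace.mem_mk', LinearMap.mem_ker, vsub_eq_sub, map_sub, map_smul, hf,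
    smul_eq_mul, mul_one, sub_eq_zero]

theorem finrank_ker_eq_four {d : V} {f : V →ₗ[ZMod 3] ZMod 3} (hf : f d = 1) :
    Module.finrank (ZMod 3) (LinearMap.ker f) = 4 := by
  have h0 : f ≠ 0 := fun h => by simp [h] at hf
  have := Module.Dual.finrank_ker_add_one_of_ne_zero (f := f) h0
  rw [Module.finrank_fin_fun] at this
  omega

theorem levelFlat_mem_netFlats {p q : V} {f : V →ₗ[ZMod 3] ZMod 3} (hf : f (q - p) = 1)
    (c : ZMod 3) : levelFlat (q - p) f c ∈ netFlats p q := by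
  rw [mem_netFlats_iff, levelFlat, AffineSubspace.direction_mk']
  refine ⟨finrank_ker_eq_four hf, ?_⟩
  rw [LinearMap.mem_ker, hf]
  exact one_ne_zero

theorem exists_eq_levelFlat {p q : V} {B : AffineSubspace (ZMod 3) V} (hB : B ∈ netFlats p q) :
    ∃ (f : V →ₗ[ZMod 3] ZMod 3) (c : ZMod 3), f (q - p) = 1 ∧ B = levelFlat (q - p) f c := by
  rw [mem_netFlats_iff] at hB
  obtain ⟨h4, hd⟩ := hB
  obtain ⟨f, hf, hmap⟩ := Submodule.exists_dual_map_eq_bot_of_notMem hd inferInstance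
  have hg : ((f (q - p))⁻¹ • f) (q - p) = 1 := by
    rw [LinearMap.smul_apply, smul_eq_mul, inv_mul_cancel₀ hf]
  have hdir : B.direction = LinearMap.ker ((f (q - p))⁻¹ • f) := by
    refine Submodule.eq_of_le_of_finrank_eq ?_ (h4.trans (finrank_ker_eq_four hg).symm)
    intro x hx
    have : f x = 0 := (Submodule.mem_bot _).mp (hmap ▸ Submodule.mem_map_of_mem hx)
    rw [LinearMap.mem_ker, LinearMap.smul_apply, this, smul_zero]
  have hne : B ≠ ⊥ := by
    rintro rfl
    rw [AffineSubspace.direction_bot, finrank_bot] at h4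
    exact absurd h4 (by norm_num)
  obtain ⟨x, hx⟩ := (AffineSubspace.nonempty_iff_ne_bot B).mpr hne
  refine ⟨_, ((f (q - p))⁻¹ • f) x, hg, ?_⟩
  ext y
  rw [mem_levelFlat hg, ← AffineSubspace.vsub_right_mem_direction_iff_mem hx, hdir,
    LinearMap.mem_ker, vsub_eq_sub, map_sub, sub_eq_zero]

/-- In a basis that starts with `q - p`, the forms with value 1 at `q - p` are exactly the rows with
first coefficient 1. Hence the blocks correspond to the remaining flats for any choice of `p ≠ q`.
-/
theorem nonempty_iso_affineNetGraph {p q : V} (hpq : p ≠ q) :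
    Nonempty (colGraph col col_symm 40 ≃g affineNetGraph p q) := by
  obtain ⟨b, hb⟩ := exists_basis_zero_eq (sub_ne_zero.mpr hpq.symm)
  have hone : ∀ w : V, b.constr (ZMod 3) (blockRow w) (q - p) = 1 := fun w => by
    rw [← hb, Module.Basis.constr_basis]
    rfl
  have hval : ∀ x w : V, b.constr (ZMod 3) (blockRow w) (b.equivFun.symm x) =
      ∑ i, x i * blockRow w i := fun x w => by
    rw [Module.Basis.constr_apply_fintype, LinearEquiv.apply_symm_apply]
    rfl
  have hbij : Function.Bijective fun w : V => (⟨levelFlat (q - p)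
      (b.constr (ZMod 3) (blockRow w)) (blockConst w), levelFlat_mem_netFlats (hone w) _⟩ :
      netFlats p q) := by
    constructor
    · intro w w' h
      have h1 : ∀ x, b.constr (ZMod 3) (blockRow w) x = blockConst w ↔
          b.constr (ZMod 3) (blockRow w') x = blockConst w' := by
        intro x
        rw [← mem_levelFlat (hone w), ← mem_levelFlat (hone w')]
        exact SetLike.ext_iff.mp (Subtype.ext_iff.mp h) x
      -- Test vectors recover the data from the flat: a multiple of `q - p` gives the constant, and
      -- basis vectors shifted along `q - p` give the coefficients.
      have hc : blockConst w = blockConst w' := by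
        have h2 := (h1 (blockConst w • (q - p))).mp (by
          rw [map_smul, hone, smul_eq_mul, mul_one])
        rwa [map_smul, hone, smul_eq_mul, mul_one] at h2
      have hr : blockRow w = blockRow w' := by
        funext i
        have h2 := (h1 (b i + (blockConst w - blockRow w i) • (q - p))).mp (by
          rw [map_add, map_smul, hone, smul_eq_mul, mul_one, Module.Basis.constr_basis,
            add_sub_cancel])
        rw [map_add, map_smul, hone, smul_eq_mul, mul_one, Module.Basis.constr_basis, ← hc] at h2
        linear_combination -h2
      rw [← rowBlock_blockRow w, hc, hr, rowBlock_blockRow]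
    · rintro ⟨B, hB⟩
      obtain ⟨f, c, hf, rfl⟩ := exists_eq_levelFlat hB
      have h0 : f (b 0) = 1 := by rw [hb, hf]
      refine ⟨rowBlock (fun i => f (b i)) c, Subtype.ext ?_⟩
      have h1 : b.constr (ZMod 3) (fun i => f (b i)) = f := b.constr_self _ f
      simp only [blockRow_rowBlock (r := fun i => f (b i)) h0, blockConst_rowBlock, h1]
  refine ⟨⟨Equiv.sumCongr (shear.trans b.equivFun.symm.toEquiv) (Equiv.ofBijective _ hbij), ?_⟩⟩
  have hl : ∀ c ∈ ({0, 1, 2, 4, 8} : Finset ℕ), Nat.testBit 40 c = false := by decide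
  have key : ∀ x w : V, b.equivFun.symm (shear x) ∈ levelFlat (q - p)
      (b.constr (ZMod 3) (blockRow w)) (blockConst w) ↔ Nat.testBit 40 (affCol (x - w)) = true := by
    intro x w
    rw [mem_levelFlat (hone w), hval, testBit_affCol_sub_iff]
  rintro (x | x) (y | y)
  · simp [affineNetGraph, incidenceGraph, colGraph, col, hl _ (linCol_mem _)]
  · simpa [affineNetGraph, incidenceGraph, colGraph, col] using key x y
  · simpa [affineNetGraph, incidenceGraph, colGraph, col] using key y x
  · simp [affineNetGraph, incidenceGraph, colGraph, col, hl _ (linCol_mem _)]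

/-! ## Codes for the field with four elements -/

theorem card_F4 : Nat.card F4 = 4 := GaloisField.card 2 2 two_ne_zero

theorem exists_sq_eq_add_one : ∃ w : F4, w ^ 2 = w + 1 := by
  classical
  let _ := Fintype.ofFinite F4
  have hcard : Fintype.card F4 = 4 := Nat.card_eq_fintype_card.symm.trans card_F4
  obtain ⟨w, hw⟩ : ∃ w : F4, w ∉ ({0, 1} : Finset F4) := by
    by_contra! h
    have h1 := Finset.card_le_card (fun x _ => h x : (Finset.univ : Finset F4) ⊆ {0, 1})
    have h2 := Finset.card_le_two (a := (0 : F4)) (b := 1)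
    rw [Finset.card_univ, hcard] at h1
    omega
  simp only [Finset.mem_insert, Finset.mem_singleton, not_or] at hw
  have h4 : w ^ 4 = w := hcard ▸ FiniteField.pow_card w
  have h2 : (2 : F4) = 0 := CharP.cast_eq_zero F4 2
  refine ⟨w, ?_⟩
  -- In characteristic 2 this product is `w ^ 4 - w`.
  have h3 : w * (w - 1) * (w ^ 2 - (w + 1)) = 0 := by
    linear_combination h4 + (w - w ^ 3) * h2
  exact sub_eq_zero.mp ((mul_eq_zero.mp h3).resolve_left
    (mul_ne_zero hw.1 (sub_ne_zero.mpr hw.2)))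

/-- A primitive element of the field with four elements. -/
noncomputable def omega4 : F4 := exists_sq_eq_add_one.choose

theorem omega4_sq : omega4 ^ 2 = omega4 + 1 := exists_sq_eq_add_one.choose_spec

theorem two_F4 : (2 : F4) = 0 := CharP.cast_eq_zero F4 2

theorem neg_F4 (a : F4) : -a = a := by linear_combination (-a) * two_F4

/-- The element of `F4` whose coordinates are the last two bits of `n`. -/
noncomputable def felt (n : ℕ) : F4 := n + (n / 2 : ℕ) * omega4

theorem natCast_F4_eq {a b : ℕ} (h : a % 2 = b % 2) : (a : F4) = b :=
  (CharP.natCast_eq_natCast F4 2).mpr h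

theorem felt_eq {a b : ℕ} (h : a % 4 = b % 4) : felt a = felt b := by
  rw [felt, felt, natCast_F4_eq (a := a) (b := b) (by omega),
    natCast_F4_eq (a := a / 2) (b := b / 2) (by omega)]

theorem felt_xor (a b : ℕ) : felt (a ^^^ b) = felt a + felt b := by
  have h : ∀ m n : ℕ, ((m ^^^ n : ℕ) : F4) = m + n := fun m n => by
    rw [natCast_F4_eq Nat.xor_mod_two_eq, Nat.cast_add]
  rw [felt, Nat.xor_div_two, h, h, felt, felt]
  ring

theorem felt_zero : felt 0 = 0 := by simp [felt]

theorem felt_one : felt 1 = 1 := by simp [felt]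

theorem felt_two : felt 2 = omega4 := by
  simp [felt, two_F4]

theorem felt_three : felt 3 = omega4 + 1 := by
  have h : (3 : F4) = 1 := by linear_combination two_F4
  simp [felt, h, add_comm]

theorem omega4_ne_zero : omega4 ≠ 0 := fun h => by
  have := omega4_sq
  simp [h] at this

theorem omega4_ne_one : omega4 ≠ 1 := fun h => by
  have := omega4_sq
  simp [h] at this

theorem felt_eq_zero_iff {n : ℕ} (hn : n < 4) : felt n = 0 ↔ n = 0 := by
  have h : omega4 + 1 ≠ 0 := fun h => omega4_ne_one (by linear_combination h - two_F4)
  interval_cases n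
  · simp [felt_zero]
  · simp [felt_one]
  · simp [felt_two, omega4_ne_zero]
  · simp [felt_three, h]

theorem felt_injOn {m n : ℕ} (hm : m < 4) (hn : n < 4) (h : felt m = felt n) : m = n := by
  have h1 : felt (m ^^^ n) = 0 := by
    rw [felt_xor, h]
    linear_combination felt n * two_F4
  rw [felt_eq_zero_iff (Nat.xor_lt_two_pow (n := 2) hm hn), Nat.xor_eq_zero_iff] at h1
  exact h1

theorem exists_felt (x : F4) : ∃ n < 4, felt n = x := by
  have hinj : Function.Injective fun n : Fin 4 => felt n :=
    fun m n h => Fin.ext (felt_injOn m.2 n.2 h)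
  have hbij := (Nat.bijective_iff_injective_and_card _).mpr ⟨hinj, by rw [card_F4, Nat.card_fin]⟩
  obtain ⟨n, hn⟩ := hbij.2 x
  exact ⟨n, n.2, hn⟩

theorem pow_three_F4 {x : F4} (hx : x ≠ 0) : x ^ 3 = 1 := by
  let _ := Fintype.ofFinite F4
  have hcard : Fintype.card F4 = 4 := Nat.card_eq_fintype_card.symm.trans card_F4
  have := FiniteField.pow_card_sub_one_eq_one x hx
  rwa [hcard] at this

/-- The code of `felt a * felt b`. -/
def mulN (a b : ℕ) : ℕ := Nat.mod (Nat.shiftRight 2625168384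
  (Nat.add (Nat.mul 8 (Nat.mod a 4)) (Nat.mul 2 (Nat.mod b 4)))) 4

theorem mulN_lt (a b : ℕ) : mulN a b < 4 := Nat.mod_lt _ (by norm_num)

theorem felt_mulN (a b : ℕ) : felt (mulN a b) = felt a * felt b := by
  have h0 : mulN a b = mulN (a % 4) (b % 4) := by
    change (2625168384 >>> (8 * (a % 4) + 2 * (b % 4))) % 4 =
      (2625168384 >>> (8 * (a % 4 % 4) + 2 * (b % 4 % 4))) % 4
    rw [Nat.mod_mod, Nat.mod_mod]
  have h : ∀ a < 4, ∀ b < 4, mulN a b =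
      (a * b + (a / 2) * (b / 2)) % 2 + 2 * ((a * (b / 2) + (a / 2) * b + (a / 2) * (b / 2)) % 2) := by
    decide +kernel
  rw [h0, h _ (Nat.mod_lt _ (by norm_num)) _ (Nat.mod_lt _ (by norm_num)),
    ← felt_eq (Nat.mod_mod a 4), ← felt_eq (Nat.mod_mod b 4)]
  generalize a % 4 = a
  generalize b % 4 = b
  have h1 : ∀ m n : ℕ, felt (m % 2 + 2 * (n % 2)) = m + n * omega4 := fun m n => by
    rw [felt, natCast_F4_eq (a := m % 2 + 2 * (n % 2)) (b := m) (by omega),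
      natCast_F4_eq (a := (m % 2 + 2 * (n % 2)) / 2) (b := n) (by omega)]
  rw [h1, felt, felt]
  push_cast
  linear_combination (-((a / 2 : ℕ) : F4) * ((b / 2 : ℕ) : F4)) * omega4_sq

/-! ## Codes for vectors over the field with four elements -/

/-- The vector whose coordinates have the digits of `n` in base `4` as codes. -/
noncomputable def fvec (n : ℕ) : Fin 3 → F4 := ![felt n, felt (n / 4), felt (n / 16)]

/-- The code of the vector with the coordinates `felt a`, `felt b`, `felt c`. -/
def packF (a b c : ℕ) : ℕ := Nat.add a (Nat.add (Nat.mul 4 b) (Nat.mul 16 c))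

theorem packF_lt {a b c : ℕ} (ha : a < 4) (hb : b < 4) (hc : c < 4) : packF a b c < 64 := by
  change a + (4 * b + 16 * c) < 64
  omega

theorem fvec_packF {a b : ℕ} (ha : a < 4) (hb : b < 4) (c : ℕ) :
    fvec (packF a b c) = ![felt a, felt b, felt c] := by
  have h : packF a b c = a + (4 * b + 16 * c) := rfl
  rw [fvec, h, felt_eq (a := a + (4 * b + 16 * c)) (b := a) (by omega),
    felt_eq (a := (a + (4 * b + 16 * c)) / 4) (b := b) (by omega),
    felt_eq (a := (a + (4 * b + 16 * c)) / 16) (b := c) (by omega)]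

theorem fvec_injOn {m n : ℕ} (hm : m < 64) (hn : n < 64) (h : fvec m = fvec n) : m = n := by
  have key : ∀ a b : ℕ, felt a = felt b → a % 4 = b % 4 := fun a b hab =>
    felt_injOn (Nat.mod_lt _ (by norm_num)) (Nat.mod_lt _ (by norm_num))
      ((felt_eq (Nat.mod_mod a 4)).trans (hab.trans (felt_eq (Nat.mod_mod b 4)).symm))
  have h0 := key _ _ (congrFun h 0)
  have h1 := key _ _ (congrFun h 1)
  have h2 := key _ _ (congrFun h 2)
  omega

theorem exists_fvec (v : Fin 3 → F4) : ∃ n < 64, fvec n = v := by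
  obtain ⟨a, ha, h0⟩ := exists_felt (v 0)
  obtain ⟨b, hb, h1⟩ := exists_felt (v 1)
  obtain ⟨c, hc, h2⟩ := exists_felt (v 2)
  refine ⟨packF a b c, packF_lt ha hb hc, ?_⟩
  rw [fvec_packF ha hb, h0, h1, h2]
  funext i
  fin_cases i <;> rfl

theorem fvec_zero : fvec 0 = 0 := by
  funext i
  fin_cases i <;> exact felt_zero

theorem fvec_eq_zero_iff {n : ℕ} (hn : n < 64) : fvec n = 0 ↔ n = 0 :=
  ⟨fun h => fvec_injOn hn (by norm_num) (h.trans fvec_zero.symm), fun h => h ▸ fvec_zero⟩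

theorem fvec_xor (a b : ℕ) : fvec (a ^^^ b) = fvec a + fvec b := by
  have h4 : ∀ m n : ℕ, (m ^^^ n) / 4 = m / 4 ^^^ n / 4 := fun m n => Nat.xor_div_two_pow (n := 2)
  have h16 : ∀ m n : ℕ, (m ^^^ n) / 16 = m / 16 ^^^ n / 16 :=
    fun m n => Nat.xor_div_two_pow (n := 4)
  rw [fvec, h4, h16, felt_xor, felt_xor, felt_xor, fvec, fvec]
  funext i
  fin_cases i <;> rfl

/-- The code of a scalar multiple. -/
def smulN (c n : ℕ) : ℕ := packF (mulN c n) (mulN c (Nat.div n 4)) (mulN c (Nat.div n 16))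

theorem smulN_lt (c n : ℕ) : smulN c n < 64 := packF_lt (mulN_lt _ _) (mulN_lt _ _) (mulN_lt _ _)

theorem fvec_smulN (c n : ℕ) : fvec (smulN c n) = felt c • fvec n := by
  rw [smulN, fvec_packF (mulN_lt _ _) (mulN_lt _ _), felt_mulN, felt_mulN, felt_mulN]
  funext i
  fin_cases i <;> rfl

/-- The code of a scalar product. -/
def dotF (m n : ℕ) : ℕ :=
  Nat.xor (mulN m n) (Nat.xor (mulN (Nat.div m 4) (Nat.div n 4)) (mulN (Nat.div m 16) (Nat.div n 16)))

theorem dotF_lt (m n : ℕ) : dotF m n < 4 :=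
  Nat.xor_lt_two_pow (n := 2) (mulN_lt _ _) (Nat.xor_lt_two_pow (n := 2) (mulN_lt _ _) (mulN_lt _ _))

theorem felt_dotF (m n : ℕ) : felt (dotF m n) = fvec m ⬝ᵥ fvec n := by
  have h : felt (dotF m n) = felt m * felt n +
      (felt (m / 4) * felt (n / 4) + felt (m / 16) * felt (n / 16)) := by
    rw [← felt_mulN, ← felt_mulN, ← felt_mulN, ← felt_xor, ← felt_xor]
    rfl
  rw [h, dotProduct, Fin.sum_univ_three, add_assoc]
  rfl

theorem xor_mulN_lt (a b c d : ℕ) : Nat.xor (mulN a b) (mulN c d) < 4 :=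
  Nat.xor_lt_two_pow (n := 2) (mulN_lt _ _) (mulN_lt _ _)

/-- The code of a cross product. -/
def crossN (m n : ℕ) : ℕ := packF
  (Nat.xor (mulN (Nat.div m 4) (Nat.div n 16)) (mulN (Nat.div m 16) (Nat.div n 4)))
  (Nat.xor (mulN (Nat.div m 16) n) (mulN m (Nat.div n 16)))
  (Nat.xor (mulN m (Nat.div n 4)) (mulN (Nat.div m 4) n))

theorem fvec_crossN (m n : ℕ) : fvec (crossN m n) = crossProduct (fvec m) (fvec n) := by
  have h : ∀ a b c d : ℕ, felt (Nat.xor (mulN a b) (mulN c d)) =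
      felt a * felt b - felt c * felt d := by
    intro a b c d
    rw [sub_eq_add_neg, neg_F4, ← felt_mulN, ← felt_mulN, ← felt_xor]
    rfl
  rw [crossN, fvec_packF (xor_mulN_lt _ _ _ _) (xor_mulN_lt _ _ _ _), h, h, h, cross_apply]
  rfl

/-- The code of a determinant. -/
def detN (a b c : ℕ) : ℕ := dotF a (crossN b c)

theorem detN_ne_zero_iff (a b c : ℕ) :
    detN a b c ≠ 0 ↔ LinearIndependent F4 ![fvec a, fvec b, fvec c] := by
  rw [ne_eq, ← felt_eq_zero_iff (n := detN a b c) (dotF_lt _ _), detN, felt_dotF, fvec_crossN,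
    triple_product_eq_det, ← ne_eq, ← isUnit_iff_ne_zero]
  exact (Matrix.isUnit_iff_isUnit_det _).symm.trans Matrix.linearIndependent_rows_iff_isUnit.symm

/-! ## The points of the projective plane of order four -/

/-- The code of the normalized vector that spans the `k`-th point. -/
def ptCode (k : ℕ) : ℕ := entry 6 82284218519986228377020173690404622593 k

/-- The number of the point spanned by the vector with code `n`. -/
def ptIdx (n : ℕ) : ℕ := entry 5 564518332653228668338399559217508542348004254872385450205073944927550038638865048636491020894208 n

theorem ptCode_lt (k : ℕ) : ptCode k < 64 := entry_lt 6 _ _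

theorem ptCode_ne_zero : ∀ k : Fin 21, ptCode k ≠ 0 := by decide +kernel

theorem fvec_ptCode_ne_zero (k : Fin 21) : fvec (ptCode k) ≠ 0 :=
  (fvec_eq_zero_iff (ptCode_lt k)).not.mpr (ptCode_ne_zero k)

/-- The `k`-th point. -/
noncomputable def pt (k : Fin 21) : PG24 := Projectivization.mk F4 _ (fvec_ptCode_ne_zero k)

theorem exists_eq_smulN (n : ℕ) (hn : n < 64) (h0 : n ≠ 0) :
    ptIdx n < 21 ∧ ∃ c < 4, c ≠ 0 ∧ n = smulN c (ptCode (ptIdx n)) := by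
  have h : ∀ n < 64, n ≠ 0 → ptIdx n < 21 ∧ ∃ c < 4, c ≠ 0 ∧ n = smulN c (ptCode (ptIdx n)) := by
    decide +kernel
  exact h n hn h0

theorem ptIdx_smulN : ∀ k : Fin 21, ∀ c < 4, c ≠ 0 → ptIdx (smulN c (ptCode k)) = k := by
  decide +kernel

theorem mk_fvec {n : ℕ} (hn : n < 64) (h : fvec n ≠ 0) :
    ∃ hk : ptIdx n < 21, Projectivization.mk F4 (fvec n) h = pt ⟨ptIdx n, hk⟩ := by
  obtain ⟨hk, c, hc, -, hnc⟩ := exists_eq_smulN n hn ((fvec_eq_zero_iff hn).not.mp h)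
  refine ⟨hk, (Projectivization.mk_eq_mk_iff' F4 _ _ _ _).mpr ⟨felt c, ?_⟩⟩
  rw [← fvec_smulN, ← hnc]

theorem pt_surjective : Function.Surjective pt := by
  intro p
  induction p using Projectivization.ind with | _ v hv
  obtain ⟨n, hn, rfl⟩ := exists_fvec v
  obtain ⟨hk, h⟩ := mk_fvec hn hv
  exact ⟨_, h.symm⟩

theorem pt_injective : Function.Injective pt := by
  intro k l h
  obtain ⟨a, ha⟩ := (Projectivization.mk_eq_mk_iff' F4 _ _ _ _).mp h
  obtain ⟨c, hc, rfl⟩ := exists_felt a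
  have hc0 : c ≠ 0 := by
    rintro rfl
    rw [felt_zero, zero_smul] at ha
    exact fvec_ptCode_ne_zero k ha.symm
  rw [← fvec_smulN] at ha
  have h1 := ptIdx_smulN l c hc hc0
  rw [fvec_injOn (smulN_lt _ _) (ptCode_lt k) ha] at h1
  have h2 := ptIdx_smulN k 1 (by norm_num) one_ne_zero
  rw [fvec_injOn (smulN_lt _ _) (ptCode_lt k) (by rw [fvec_smulN, felt_one, one_smul])] at h2
  exact Fin.ext (h2.symm.trans h1)

/-- The points `a`, `b`, `c` are not on a line. -/
def indN (a b c : ℕ) : Bool := !Nat.beq (detN (ptCode a) (ptCode b) (ptCode c)) 0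

theorem independent_pt_iff (a b c : Fin 21) :
    Projectivization.Independent ![pt a, pt b, pt c] ↔ indN a b c = true := by
  have h1 : indN a b c = true ↔ detN (ptCode a) (ptCode b) (ptCode c) ≠ 0 := by
    rw [indN, Bool.not_eq_true', Bool.eq_false_iff, ne_eq, Nat.beq_eq]
  choose u hu using fun k => Projectivization.exists_smul_eq_mk_rep F4 _ (fvec_ptCode_ne_zero k)
  have h2 : Projectivization.rep ∘ ![pt a, pt b, pt c] =
      ![u a, u b, u c] • ![fvec (ptCode a), fvec (ptCode b), fvec (ptCode c)] := by
    funext i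
    fin_cases i <;> exact (hu _).symm
  rw [h1, detN_ne_zero_iff, Projectivization.independent_iff, h2, LinearIndependent.units_smul_iff]

/-! ## Sets of points -/

/-- The `k`-th bit of `m`. -/
def bit (m k : ℕ) : Bool := Nat.beq (entry 1 m k) 1

/-- The set of points with characteristic bits `m`. -/
def ofMask (m : ℕ) : Set PG24 := {p | ∃ k : Fin 21, bit m k = true ∧ pt k = p}

theorem pt_mem_ofMask (m : ℕ) (k : Fin 21) : pt k ∈ ofMask m ↔ bit m k = true :=
  ⟨fun ⟨_, hl, h⟩ => pt_injective h ▸ hl, fun h => ⟨k, h, rfl⟩⟩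

theorem fvec_mem_coneOver (m : ℕ) {n : ℕ} (hn : n < 64) :
    fvec n ∈ coneOver (ofMask m) ↔ n ≠ 0 ∧ bit m (ptIdx n) = true := by
  constructor
  · rintro ⟨h, hm⟩
    obtain ⟨hk, he⟩ := mk_fvec hn h
    rw [he, pt_mem_ofMask] at hm
    exact ⟨(fvec_eq_zero_iff hn).not.mp h, hm⟩
  · rintro ⟨h, hm⟩
    have h' := (fvec_eq_zero_iff hn).not.mpr h
    obtain ⟨hk, he⟩ := mk_fvec hn h'
    exact ⟨h', by rw [he, pt_mem_ofMask]; exact hm⟩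

theorem smul_mem_coneOver {O : Set PG24} {v : Fin 3 → F4} (hv : v ∈ coneOver O) {c : F4}
    (hc : c ≠ 0) : c • v ∈ coneOver O := by
  obtain ⟨h, hm⟩ := hv
  refine ⟨smul_ne_zero hc h, ?_⟩
  rwa [(Projectivization.mk_eq_mk_iff' F4 _ _ _ h).mpr ⟨c, rfl⟩]

theorem disjoint_ofMask_iff (m m' : ℕ) : Disjoint (ofMask m) (ofMask m') ↔
    allBelow 21 (fun k => !(bit m k && bit m' k)) = true := by
  rw [Set.disjoint_left, allBelow_iff, pt_surjective.forall]
  simp only [pt_mem_ofMask, Bool.not_eq_true', Bool.and_eq_false_imp, Bool.not_eq_true]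
  exact ⟨fun h k hk => h ⟨k, hk⟩, fun h k => h k k.2⟩

/-! ## The hyperovals -/

/-- The characteristic bits of the `h`-th hyperoval. -/
def hypMask (h : ℕ) : ℕ := entry 21 859928391302611403389477961309782805007680825801214913865315733483438629059943418682113529650734084327146723513001268868960269981224649124101455448606567802797611890308987540668862564380490533034961364962051487317970862847318328649326209727314587946616958581131514132602590573388260007777617712041882508388652045494157699253035612505870977045399337468195 h

theorem card_hypMask : ∀ h < 56,
    (Finset.univ.filter fun k : Fin 21 => bit (hypMask h) k = true).card = 6 := by
  decide +kernel

theorem indN_hypMask {h : ℕ} (hh : h < 56) {a b c : Fin 21} (ha : bit (hypMask h) a = true)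
    (hb : bit (hypMask h) b = true) (hc : bit (hypMask h) c = true) (hab : a ≠ b) (hac : a ≠ c)
    (hbc : b ≠ c) : indN a b c = true := by
  have hk : allBelow 56 (fun h => allBelow 21 fun a => !bit (hypMask h) a || allBelow 21 fun b =>
      !bit (hypMask h) b || Nat.beq a b || allBelow 21 fun c =>
        !bit (hypMask h) c || Nat.beq a c || Nat.beq b c || indN a b c) = true := by
    decide +kernel
  simp only [allBelow_iff, Bool.or_eq_true, Bool.not_eq_true', Nat.beq_eq] at hk
  have h1 := ((hk h hh a a.2).resolve_left (by simp [ha]) b b.2).resolve_left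
    (by simp [hb, Fin.val_inj, hab]) c c.2
  exact h1.resolve_left (by simp [hc, Fin.val_inj, hac, hbc])

theorem ofMask_eq_image (m : ℕ) :
    ofMask m = pt '' ↑(Finset.univ.filter fun k : Fin 21 => bit m k = true) := by
  ext p
  simp [ofMask]

theorem isHyperoval_ofMask {h : ℕ} (hh : h < 56) : IsHyperoval (ofMask (hypMask h)) := by
  constructor
  · rw [ofMask_eq_image, Set.ncard_image_of_injective _ pt_injective, Set.ncard_coe_finset,
      card_hypMask h hh]
  · rintro _ ⟨a, ha, rfl⟩ _ ⟨b, hb, rfl⟩ _ ⟨c, hc, rfl⟩ hab hac hbc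
    rw [independent_pt_iff]
    exact indN_hypMask hh ha hb hc (fun h => hab (h ▸ rfl)) (fun h => hac (h ▸ rfl))
      (fun h => hbc (h ▸ rfl))

theorem ncard_inter_ofMask (m : ℕ) (K : Finset (Fin 21)) :
    (pt '' ↑K ∩ ofMask m).ncard = ∑ k ∈ K, entry 1 m k := by
  have h1 : pt '' ↑K ∩ ofMask m = pt '' ↑(K.filter fun k : Fin 21 => bit m k = true) := by
    ext p
    obtain ⟨k, rfl⟩ := pt_surjective p
    rw [Set.mem_inter_iff, pt_injective.mem_set_image, pt_injective.mem_set_image, pt_mem_ofMask]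
    simp
  rw [h1, Set.ncard_image_of_injective _ pt_injective, Set.ncard_coe_finset, Finset.card_filter]
  refine Finset.sum_congr rfl fun k _ => ?_
  have h2 := entry_lt 1 m k
  have h3 : bit m k = true ↔ entry 1 m k = 1 := by rw [bit, Nat.beq_eq]
  split_ifs with h <;> rw [h3] at h <;> omega

/-- The condition on six points that is checked for all arcs: if they contain the frame, then they
form the first hyperoval, and if they meet it evenly, then they form a hyperoval of the list. -/
def arcCond (a b c d e f : ℕ) : Bool :=
  (!(allBelow 4 fun i => let r := entry 4 34064 i
      Nat.beq a r || Nat.beq b r || Nat.beq c r || Nat.beq d r || Nat.beq e r || Nat.beq f r) ||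
    (bit (hypMask 0) a && bit (hypMask 0) b && bit (hypMask 0) c && bit (hypMask 0) d &&
      bit (hypMask 0) e && bit (hypMask 0) f)) &&
  (Nat.beq (Nat.mod (Nat.add (entry 1 (hypMask 0) a) (Nat.add (entry 1 (hypMask 0) b)
      (Nat.add (entry 1 (hypMask 0) c) (Nat.add (entry 1 (hypMask 0) d)
        (Nat.add (entry 1 (hypMask 0) e) (entry 1 (hypMask 0) f)))))) 2) 1 ||
    !(allBelow 56 fun h => !(bit (hypMask h) a && bit (hypMask h) b && bit (hypMask h) c &&
      bit (hypMask h) d && bit (hypMask h) e && bit (hypMask h) f)))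

/-- An exhaustive search over increasing six-tuples of points, cut off as soon as three chosen
points are collinear. -/
theorem arc_check : allBelow 21 (fun f => allBelow f fun e => allBelow e fun d => !indN d e f ||
    allBelow d fun c => !(indN c d e && indN c d f && indN c e f) ||
    allBelow c fun b => !(indN b c d && indN b c e && indN b c f && indN b d e && indN b d f &&
      indN b e f) ||
    allBelow b fun a => !(indN a b c && indN a b d && indN a b e && indN a b f && indN a c d &&
      indN a c e && indN a c f && indN a d e && indN a d f && indN a e f) ||
    arcCond a b c d e f) = true := by
  decide +kernel

theorem arcCond_of_arc {o : Fin 6 → ℕ} (ho : StrictMono o) (hlt : ∀ i, o i < 21)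
    (hind : ∀ i j k, i < j → j < k → indN (o i) (o j) (o k) = true) :
    arcCond (o 0) (o 1) (o 2) (o 3) (o 4) (o 5) = true := by
  have h := arc_check
  simp only [allBelow_iff, Bool.or_eq_true, Bool.not_eq_true', Bool.and_eq_false_iff] at h
  have h5 := (h (o 5) (hlt 5) (o 4) (ho (by decide)) (o 3) (ho (by decide))).resolve_left
    (by simp [hind 3 4 5]) (o 2) (ho (by decide))
  have h2 := (h5.resolve_left (by simp [hind 2 3 4, hind 2 3 5, hind 2 4 5])) (o 1) (ho (by decide))
  have h1 := (h2.resolve_left (by simp [hind 1 2 3, hind 1 2 4, hind 1 2 5, hind 1 3 4, hind 1 3 5,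
    hind 1 4 5])) (o 0) (ho (by decide))
  exact h1.resolve_left (by simp [hind 0 1 2, hind 0 1 3, hind 0 1 4, hind 0 1 5, hind 0 2 3,
    hind 0 2 4, hind 0 2 5, hind 0 3 4, hind 0 3 5, hind 0 4 5])

theorem exists_finset_of_isHyperoval {O : Set PG24} (hO : IsHyperoval O) :
    ∃ K : Finset (Fin 21), O = pt '' ↑K ∧ K.card = 6 ∧
      ((∀ r ∈ ({0, 1, 5, 8} : Finset (Fin 21)), r ∈ K) → ∀ k ∈ K, bit (hypMask 0) k = true) ∧
      (Even (∑ k ∈ K, entry 1 (hypMask 0) k) → ∃ h < 56, ∀ k ∈ K, bit (hypMask h) k = true) := by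
  classical
  obtain ⟨K, hK⟩ : ∃ K : Finset (Fin 21), O = pt '' ↑K :=
    ⟨Finset.univ.filter fun k => pt k ∈ O, by
      ext p
      obtain ⟨k, rfl⟩ := pt_surjective p
      rw [pt_injective.mem_set_image]
      simp⟩
  have hcard : K.card = 6 := by
    rw [← hO.1, hK, Set.ncard_image_of_injective _ pt_injective, Set.ncard_coe_finset]
  refine ⟨K, hK, hcard, ?_⟩
  let o := K.orderEmbOfFin hcard
  have hmem : ∀ i, o i ∈ K := K.orderEmbOfFin_mem hcard
  have hsurj : ∀ k ∈ K, ∃ i, o i = k := fun k hk => by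
    have : k ∈ Set.range o := by
      rw [K.range_orderEmbOfFin hcard]
      exact hk
    exact this
  have hpt : ∀ i, pt (o i) ∈ O := fun i => hK ▸ ⟨o i, hmem i, rfl⟩
  have hne : ∀ i j, i < j → pt (o i) ≠ pt (o j) := fun i j hij h =>
    hij.ne (o.injective (pt_injective h))
  have harc := arcCond_of_arc (o := fun i => o i) (fun i j hij => o.strictMono hij)
    (fun i => (o i).2) fun i j k hij hjk => (independent_pt_iff _ _ _).mp
      (hO.2 _ (hpt i) _ (hpt j) _ (hpt k) (hne i j hij) (hne i k (hij.trans hjk)) (hne j k hjk))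
  rw [arcCond, Bool.and_eq_true, Bool.or_eq_true, Bool.or_eq_true, Bool.not_eq_true',
    Bool.not_eq_true', Bool.eq_false_iff, Bool.eq_false_iff, ne_eq, ne_eq, allBelow_iff,
    allBelow_iff] at harc
  obtain ⟨h1, h2⟩ := harc
  have hall : ∀ m, (bit m (o 0) && bit m (o 1) && bit m (o 2) && bit m (o 3) && bit m (o 4) &&
      bit m (o 5)) = true → ∀ k ∈ K, bit m k = true := by
    intro m h k hk
    obtain ⟨i, rfl⟩ := hsurj k hk
    simp only [Bool.and_eq_true] at h
    fin_cases i
    exacts [h.1.1.1.1.1, h.1.1.1.1.2, h.1.1.1.2, h.1.1.2, h.1.2, h.2]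
  constructor
  · intro hr
    refine hall _ (h1.resolve_left fun h => h fun i hi => ?_)
    -- In base 16 the digits of 34064 are 8, 5, 1, 0: the numbers of the frame points.
    have hfr : ∀ i < 4, ∃ r ∈ ({0, 1, 5, 8} : Finset (Fin 21)), r.val = entry 4 34064 i := by
      decide +kernel
    obtain ⟨r, hr', he⟩ := hfr i hi
    obtain ⟨j, hj⟩ := hsurj r (hr r hr')
    simp only [← he, ← hj, Bool.or_eq_true, Nat.beq_eq]
    fin_cases j <;> simp
  · intro heven
    have hsum : ∑ k ∈ K, entry 1 (hypMask 0) k = ∑ i, entry 1 (hypMask 0) (o i) := by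
      rw [← K.map_orderEmbOfFin_univ hcard, Finset.sum_map]
      rfl
    rw [hsum, Fin.sum_univ_six, Nat.even_iff] at heven
    have h3 := h2.resolve_left fun h => by
      have h4 := Nat.eq_of_beq_eq_true h
      change (_ + (_ + (_ + (_ + (_ + _))))) % 2 = 1 at h4
      omega
    push Not at h3
    obtain ⟨h, hh, hb⟩ := h3
    rw [ne_eq, Bool.not_eq_true', Bool.not_eq_false] at hb
    exact ⟨h, hh, hall _ hb⟩

theorem image_eq_ofMask {K : Finset (Fin 21)} (hK : K.card = 6) {h : ℕ} (hh : h < 56)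
    (hb : ∀ k ∈ K, bit (hypMask h) k = true) : pt '' ↑K = ofMask (hypMask h) := by
  have h1 : K = Finset.univ.filter fun k : Fin 21 => bit (hypMask h) k = true :=
    Finset.eq_of_subset_of_card_le (fun k hk => by simpa using hb k hk)
      (by rw [card_hypMask h hh, hK])
  rw [ofMask_eq_image, ← h1]

theorem fvec_frame : fvec 1 = ![1, 0, 0] ∧ fvec 4 = ![0, 1, 0] ∧ fvec 16 = ![0, 0, 1] ∧
    fvec 21 = ![1, 1, 1] := by
  have h4 : felt 4 = 0 := (felt_eq (by norm_num)).trans felt_zero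
  have h16 : felt 16 = 0 := (felt_eq (by norm_num)).trans felt_zero
  have h21 : felt 21 = 1 := (felt_eq (by norm_num)).trans felt_one
  have h5 : felt 5 = 1 := (felt_eq (by norm_num)).trans felt_one
  simp [fvec, h4, h16, h21, h5, felt_zero, felt_one]

theorem frame_subset_coneOver_iff (O : Set PG24) :
    ({![1, 0, 0], ![0, 1, 0], ![0, 0, 1], ![1, 1, 1]} : Set (Fin 3 → F4)) ⊆ coneOver O ↔
      ∀ r ∈ ({0, 1, 5, 8} : Finset (Fin 21)), pt r ∈ O := by
  have hcode : ptCode (0 : Fin 21) = 1 ∧ ptCode (1 : Fin 21) = 4 ∧ ptCode (5 : Fin 21) = 16 ∧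
      ptCode (8 : Fin 21) = 21 := by
    decide +kernel
  have hpt : ∀ k : Fin 21, fvec (ptCode k) ∈ coneOver O ↔ pt k ∈ O := fun k =>
    ⟨fun ⟨_, h⟩ => h, fun h => ⟨fvec_ptCode_ne_zero k, h⟩⟩
  obtain ⟨h0, h1, h2, h3⟩ := fvec_frame
  have hp0 := hpt 0
  have hp1 := hpt 1
  have hp2 := hpt 5
  have hp3 := hpt 8
  rw [hcode.1, h0] at hp0
  rw [hcode.2.1, h1] at hp1
  rw [hcode.2.2.1, h2] at hp2
  rw [hcode.2.2.2, h3] at hp3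
  simp [Set.insert_subset_iff, hp0, hp1, hp2, hp3]

theorem mem_frameHyperovals_iff (O : Set PG24) :
    O ∈ frameHyperovals ↔ ∃ h < 56, O = ofMask (hypMask h) := by
  constructor
  · rintro ⟨hO, O₀, hO₀, hframe, heven⟩
    obtain ⟨K₀, rfl, hc₀, h1, -⟩ := exists_finset_of_isHyperoval hO₀
    obtain ⟨K, rfl, hc, -, h2⟩ := exists_finset_of_isHyperoval hO
    rw [frame_subset_coneOver_iff] at hframe
    simp only [pt_injective.mem_set_image] at hframe
    rw [image_eq_ofMask hc₀ (by norm_num) (h1 hframe), ncard_inter_ofMask] at heven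
    obtain ⟨h, hh, hb⟩ := h2 heven
    exact ⟨h, hh, image_eq_ofMask hc hh hb⟩
  · rintro ⟨h, hh, rfl⟩
    refine ⟨isHyperoval_ofMask hh, _, isHyperoval_ofMask (h := 0) (by norm_num), ?_, ?_⟩
    · rw [frame_subset_coneOver_iff]
      intro r hr
      rw [pt_mem_ofMask]
      revert r
      decide +kernel
    · have hk : ∀ h < 56, (∑ k ∈ Finset.univ.filter fun k : Fin 21 => bit (hypMask h) k = true,
          entry 1 (hypMask 0) k) % 2 = 0 := by
        decide +kernel
      rw [ofMask_eq_image (hypMask h), ncard_inter_ofMask, Nat.even_iff]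
      exact hk h hh

/-! ## The elations -/

/-- A non-zero matrix with square zero has rank one. -/
theorem exists_eq_vecMulVec_of_mul_self_eq_zero {M : Matrix (Fin 3) (Fin 3) F4} (h0 : M ≠ 0) (h : M * M = 0) :
    ∃ v f : Fin 3 → F4, v ≠ 0 ∧ f ≠ 0 ∧ f ⬝ᵥ v = 0 ∧ M = Matrix.vecMulVec v f := by
  have hle : LinearMap.range M.mulVecLin ≤ LinearMap.ker M.mulVecLin := by
    rintro _ ⟨x, rfl⟩
    rw [LinearMap.mem_ker, Matrix.mulVecLin_apply, Matrix.mulVecLin_apply, Matrix.mulVec_mulVec, h,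
      Matrix.zero_mulVec]
  -- The rank is at most the nullity and they add up to 3, so the rank is at most 1.
  have h1 := Submodule.finrank_mono hle
  have h2 := M.mulVecLin.finrank_range_add_finrank_ker
  rw [Module.finrank_fin_fun] at h2
  obtain ⟨v, hv⟩ := finrank_le_one_iff.mp (by omega : Module.finrank F4
    (LinearMap.range M.mulVecLin) ≤ 1)
  choose f hf using hv
  have hM : M = Matrix.vecMulVec v (fun j => f ⟨_, ⟨Pi.single j 1, rfl⟩⟩) := by
    ext i j
    have h3 : f _ * v.1 i = (M *ᵥ Pi.single j 1) i :=
      congrFun (Subtype.ext_iff.mp (hf ⟨_, ⟨Pi.single j 1, rfl⟩⟩)) i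
    rw [Matrix.mulVec_single_one] at h3
    rw [Matrix.vecMulVec_apply, mul_comm]
    exact h3.symm
  generalize (fun j => f ⟨_, ⟨Pi.single j 1, rfl⟩⟩) = g at hM
  generalize (v : Fin 3 → F4) = w at hM
  subst hM
  rw [ne_eq, Matrix.vecMulVec_eq_zero, not_or] at h0
  rw [Matrix.vecMulVec_mul_vecMulVec, Matrix.vecMulVec_smul, smul_eq_zero,
    Matrix.vecMulVec_eq_zero] at h
  exact ⟨w, g, h0.1, h0.2, h.resolve_right (not_or.mpr h0), rfl⟩

/-- A pair of a non-zero vector and a non-zero form is determined up to scalars by the matrix. -/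
theorem vecMulVec_eq {v f w g : Fin 3 → F4} (hv : v ≠ 0) (hf : f ≠ 0)
    (h : Matrix.vecMulVec w g = Matrix.vecMulVec v f) : ∃ c : F4, c ≠ 0 ∧ w = c • v ∧ g = c⁻¹ • f := by
  have hij : ∀ i j, w i * g j = v i * f j := fun i j => congrFun (congrFun h i) j
  obtain ⟨i, hi⟩ := Function.ne_iff.mp hv
  obtain ⟨j, hj⟩ := Function.ne_iff.mp hf
  rw [Pi.zero_apply] at hi hj
  have hne : w i * g j ≠ 0 := hij i j ▸ mul_ne_zero hi hj
  have hw := left_ne_zero_of_mul hne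
  refine ⟨w i / v i, div_ne_zero hw hi, ?_, ?_⟩
  · funext k
    rw [Pi.smul_apply, smul_eq_mul]
    field_simp
    refine mul_right_cancel₀ (right_ne_zero_of_mul hne) ?_
    linear_combination v i * hij k j - v k * hij i j
  · funext k
    rw [Pi.smul_apply, smul_eq_mul, inv_div]
    field_simp
    linear_combination hij i k

/-- The adjacency of elations in terms of normalized representatives. -/
theorem exists_elation_iff {v f v' f' : Fin 3 → F4} (hv : v ≠ 0) (hf : f ≠ 0) (hfv : f ⬝ᵥ v = 0)
    (hv' : v' ≠ 0) (hf' : f' ≠ 0) :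
    (∃ v₁ w f₁ : Fin 3 → F4, f₁ ⬝ᵥ v₁ = 0 ∧ f₁ ⬝ᵥ w = 1 ∧
      Matrix.vecMulVec v f = Matrix.vecMulVec v₁ f₁ ∧
      Matrix.vecMulVec v' f' = Matrix.vecMulVec w (crossProduct v₁ w)) ↔
    f ⬝ᵥ v' ≠ 0 ∧ f' = (f ⬝ᵥ v') • crossProduct v v' := by
  constructor
  · rintro ⟨v₁, w, f₁, -, h1, h2, h3⟩
    obtain ⟨a, ha, rfl, rfl⟩ := vecMulVec_eq hv hf h2.symm
    obtain ⟨b, hb, rfl, h4⟩ := vecMulVec_eq hv' hf' h3.symm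
    rw [smul_dotProduct, dotProduct_smul, smul_eq_mul, smul_eq_mul] at h1
    have hs : f ⬝ᵥ v' ≠ 0 := by
      intro h
      simp [h] at h1
    refine ⟨hs, ?_⟩
    have h5 : f' = b • (crossProduct (a • v)) (b • v') := by
      rw [h4, smul_smul, mul_inv_cancel₀ hb, one_smul]
    rw [h5, map_smul, LinearMap.map_smul, LinearMap.smul_apply, smul_smul, smul_smul]
    congr 1
    -- The rescalings give `f' = a b² (v × v')`, and the normalization of `f₁` at `w` gives `a = b
    -- (f v')`. The remaining factor `b³` is 1 in the field with four elements.
    have hab : b * (f ⬝ᵥ v') = a := by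
      field_simp at h1
      exact h1
    have h6 := pow_three_F4 hs
    have h7 := pow_three_F4 hb
    rw [← hab]
    linear_combination (f ⬝ᵥ v') * h7
  · rintro ⟨hs, h⟩
    have h6 := pow_three_F4 hs
    -- With `s = f v'`, scaling `v'` by `s⁻¹` yields the factor `s⁻²`, which is `s` because `s³ =
    -- 1`.
    refine ⟨v, (f ⬝ᵥ v')⁻¹ • v', f, hfv, ?_, rfl, ?_⟩
    · rw [dotProduct_smul, smul_eq_mul, inv_mul_cancel₀ hs]
    · rw [h, LinearMap.map_smul, Matrix.smul_vecMulVec, Matrix.vecMulVec_smul,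
        Matrix.vecMulVec_smul, smul_smul]
      congr 1
      field_simp
      linear_combination h6

/-- The numbers of the centres and the codes of the forms of the elations. -/
def elTable : ℕ := 111074752661229675066533186490055261246994077503345194435620858487184830963997141400974822542864746375742288495160963210753046816456628127696598343574592579707850039355197512911952242788773850925978661260484130783697346156143161928333693026803983558640770266274305618932757104501570231190851395604269610564581074734759091787446371875076075816473783198590692133471022047386603525786859239008006492000518931506394339866548907812578450670775980312044522802383708221060150580066465986343613306995161456989921061681474295996307877412845983892525995792451648623158779475896791276337659389065212979292503821517707072239814836201456911073791795450652900441769071783632202586176878085225923283778794757216877374387636585568038600374460249104873535160682903843433447330170738520688714308572901451423567486153307836991738172436961183214194371332369532376874102208224157861712120510384786191775714267045631092802486313389975129435580620554108303943268382234533314063499138016529668064401619438130713525469709922816325774199143357031039577411152174375239808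

/-- The number of the centre of the `e`-th elation. -/
def elPt (e : ℕ) : ℕ := Nat.mod (entry 11 elTable e) 32

/-- The code of the form of the `e`-th elation. -/
def elForm (e : ℕ) : ℕ := Nat.div (entry 11 elTable e) 32

theorem elForm_lt (e : ℕ) : elForm e < 64 := by
  have h := entry_lt 11 elTable e
  change _ / 32 < 64
  omega

theorem elTable_spec : ∀ e < 315,
    elPt e < 21 ∧ elForm e ≠ 0 ∧ dotF (elForm e) (ptCode (elPt e)) = 0 := by
  decide +kernel

/-- Fifteen non-zero forms vanish at each of the 21 points, and the elations are numbered so that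
those with centre `k` start at `15 * k`. -/
theorem exists_elation_index : ∀ k < 21, ∀ f < 64, f ≠ 0 → dotF f (ptCode k) = 0 →
    ∃ j < 15, elPt (15 * k + j) = k ∧ elForm (15 * k + j) = f := by
  decide +kernel

theorem fvec_elPt_ne_zero (e : Fin 315) : fvec (ptCode (elPt e)) ≠ 0 :=
  fvec_ptCode_ne_zero ⟨elPt e, (elTable_spec e e.2).1⟩

theorem fvec_elForm_ne_zero (e : Fin 315) : fvec (elForm e) ≠ 0 :=
  (fvec_eq_zero_iff (elForm_lt e)).not.mpr (elTable_spec e e.2).2.1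

theorem elForm_dotProduct (e : Fin 315) : fvec (elForm e) ⬝ᵥ fvec (ptCode (elPt e)) = 0 := by
  rw [← felt_dotF, (elTable_spec e e.2).2.2, felt_zero]

/-- The `e`-th elation. -/
noncomputable def elation (e : Fin 315) : {M : Matrix (Fin 3) (Fin 3) F4 // M ≠ 0 ∧ M * M = 0} :=
  ⟨Matrix.vecMulVec (fvec (ptCode (elPt e))) (fvec (elForm e)),
    Matrix.vecMulVec_ne_zero (fvec_elPt_ne_zero e) (fvec_elForm_ne_zero e), by
      rw [Matrix.vecMulVec_mul_vecMulVec, elForm_dotProduct, zero_smul, Matrix.vecMulVec_zero]⟩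

theorem elation_surjective : Function.Surjective elation := by
  rintro ⟨M, h0, h⟩
  obtain ⟨v, f, hv, hf, hfv, rfl⟩ := exists_eq_vecMulVec_of_mul_self_eq_zero h0 h
  obtain ⟨n, hn, rfl⟩ := exists_fvec v
  obtain ⟨hk, c, hc, hc0, hnc⟩ := exists_eq_smulN n hn ((fvec_eq_zero_iff hn).not.mp hv)
  have hc0' := (felt_eq_zero_iff hc).not.mpr hc0
  obtain ⟨m, hm, hmf⟩ := exists_fvec (felt c • f)
  have hm0 : m ≠ 0 := (fvec_eq_zero_iff hm).not.mp (hmf ▸ smul_ne_zero hc0' hf)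
  have hfn : fvec n = felt c • fvec (ptCode (ptIdx n)) := by rw [← fvec_smulN, ← hnc]
  have hdot : dotF m (ptCode (ptIdx n)) = 0 := by
    rw [← felt_eq_zero_iff (dotF_lt _ _), felt_dotF, hmf, smul_dotProduct, ← dotProduct_smul,
      ← hfn, hfv]
  obtain ⟨j, hj, h1, h2⟩ := exists_elation_index _ hk m hm hm0 hdot
  refine ⟨⟨15 * ptIdx n + j, by omega⟩, Subtype.ext ?_⟩
  change Matrix.vecMulVec (fvec (ptCode (elPt _))) (fvec (elForm _)) = Matrix.vecMulVec (fvec n) f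
  rw [h1, h2, hmf, hfn, Matrix.vecMulVec_smul, Matrix.smul_vecMulVec]

/-! ## The second Soicher graph in coordinates -/

/-- The elation `1 + i M`, where `M` is the matrix with number `e`, fixes the `h`-th hyperoval. -/
def fixN (i h e : ℕ) : Bool := allBelow 21 fun k => !bit (hypMask h) k ||
  (fun n => !Nat.beq n 0 && bit (hypMask h) (ptIdx n))
    (Nat.xor (ptCode k) (smulN (mulN i (dotF (elForm e) (ptCode k))) (ptCode (elPt e))))

/-- The relation between the elations with numbers `e` and `e'`. -/
def elRelN (e e' : ℕ) : Bool :=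
  (fun s => !Nat.beq s 0 &&
    Nat.beq (elForm e') (smulN s (crossN (ptCode (elPt e)) (ptCode (elPt e')))))
    (dotF (elForm e) (ptCode (elPt e')))

/-- The `h`-th and `h'`-th hyperovals are disjoint. -/
def disjN (h h' : ℕ) : Bool := allBelow 21 fun k => !(bit (hypMask h) k && bit (hypMask h') k)

/-- Numbers of vertices that correspond to the vertices of the Soicher graph. -/
def soicherTable : ℕ := 1723139307022661076661443571721359639585845569705779601850581716464104330858075463542215064129627985830216825685949341841464154016695852169409855152455961483150535703202508966516097971917796477789018234165384696377358128469522121811093562136278976235873623199885292769363948929932845193011423469560193249839565579556936402076430350321001095663533171666261337393909299112802599955395164142511773770390313783419679131370158092700846519978080832367278890013062370847106398438347272289509071120776773235828743350008393347594962259614750600256001340427322411370896613583653251502982436296203347186800085677834550552993717491074267180480614241059416860596812953746543498213193641682294752602437458095310270301764616733455934813636035541510888491235246552606476740633203507701038315880977024819640425327963826968682124762312042359818286570871804630455360547028258352839152783497699579124895639042433379132414569682833087685974343067756510985994381732995313247486523998829857210110308861412895852184899197649982224906581568577330297629894852061802735961299564463939783356545456055931620119574363293668568938115877383147496021058557104579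05211512942677113048378407678644359403301813619232430336280693003963970896466142211711444484908058731024753427587382290893904175166626711594770280669976306996791870668376344284004358816256

/-- The vertices with the numbers that correspond to `a` and `b` have a colour in `{2, 3}`. -/
def edgeN (a b : ℕ) : Bool :=
  Nat.beq (Nat.div (colN (entry 9 soicherTable a) (entry 9 soicherTable b)) 2) 1

theorem edgeN_special : allBelow 3 (fun i => allBelow 3 (fun j => !edgeN i j) &&
    allBelow 3 (fun j => allBelow 56 fun h =>
      edgeN i (Nat.add 3 (Nat.add (Nat.mul 56 j) h)) == Nat.beq i j) &&
    allBelow 315 fun e => !edgeN i (Nat.add 171 e)) = true := by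
  decide +kernel

theorem edgeN_hyperoval : allBelow 3 (fun i => allBelow 56 fun h => allBelow 3 fun j =>
    allBelow 56 fun h' =>
      edgeN (Nat.add 3 (Nat.add (Nat.mul 56 i) h)) (Nat.add 3 (Nat.add (Nat.mul 56 j) h')) ==
        (Nat.beq i j && disjN h h')) = true := by
  decide +kernel

theorem edgeN_hyperoval_elation : allBelow 3 (fun i => allBelow 56 fun h => allBelow 315 fun e =>
    edgeN (Nat.add 3 (Nat.add (Nat.mul 56 i) h)) (Nat.add 171 e) == fixN (Nat.add i 1) h e) =
    true := by
  decide +kernel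

/-- Given the first elation and the centre of the second, the relation determines the form of the
second, so only the fifteen elations with that centre have to be compared. -/
theorem edgeN_elation_of_elRelN : allBelow 315 (fun e => allBelow 21 fun k =>
    (fun s => Nat.beq s 0 || (fun f => allBelow 15 fun j =>
        !Nat.beq (elForm (Nat.add (Nat.mul 15 k) j)) f ||
          edgeN (Nat.add 171 e) (Nat.add 171 (Nat.add (Nat.mul 15 k) j)))
      (smulN s (crossN (ptCode (elPt e)) (ptCode k))))
    (dotF (elForm e) (ptCode k))) = true := by
  decide +kernel

theorem elRelN_of_edgeN_elation : allBelow 315 (fun e =>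
    !edgeN (Nat.add 171 e) (Nat.add 171 e) && allBelow e fun e' =>
      !edgeN (Nat.add 171 e) (Nat.add 171 e') || elRelN e e' || elRelN e' e) = true := by
  decide +kernel

theorem exists_soicherTable_eq : allBelow 486 (fun n => !allBelow 486 fun m =>
    !Nat.beq (entry 9 soicherTable m) n) = true := by
  decide +kernel

/-- The non-zero scalars. -/
noncomputable def scalar (i : Fin 3) : F4ˣ :=
  Units.mk0 (felt (i + 1)) ((felt_eq_zero_iff (by omega)).not.mpr (Nat.succ_ne_zero _))

theorem scalar_injective : Function.Injective scalar := fun i j h =>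
  Fin.ext (Nat.succ_injective
    (felt_injOn (m := i + 1) (n := j + 1) (by omega) (by omega) (Units.ext_iff.mp h)))

theorem scalar_surjective : Function.Surjective scalar := by
  intro u
  obtain ⟨n, hn, h⟩ := exists_felt u
  have h0 : n ≠ 0 := by
    rintro rfl
    exact u.ne_zero (h.symm.trans felt_zero)
  refine ⟨⟨n - 1, by omega⟩, Units.ext ?_⟩
  change felt (n - 1 + 1) = u
  rw [Nat.sub_add_cancel (Nat.pos_of_ne_zero h0), h]

/-- The `h`-th hyperoval. -/
def hyperovalSet (h : Fin 56) : frameHyperovals :=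
  ⟨ofMask (hypMask h), (mem_frameHyperovals_iff _).mpr ⟨h, h.2, rfl⟩⟩

/-- Labels for the vertices of the second Soicher graph. -/
abbrev Label : Type := Fin 3 ⊕ (Fin 3 × Fin 56) ⊕ Fin 315

/-- The vertex with a given label. -/
noncomputable def soicherVertex : Label → SoicherVertex
  | .inl i => .special (scalar i)
  | .inr (.inl (i, h)) => .hyperoval (hyperovalSet h) (scalar i)
  | .inr (.inr e) => .elation (elation e)

theorem soicherVertex_surjective : Function.Surjective soicherVertex := by
  rintro (i | ⟨⟨O, hO⟩, i⟩ | M)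
  · obtain ⟨i, rfl⟩ := scalar_surjective i
    exact ⟨.inl i, rfl⟩
  · obtain ⟨i, rfl⟩ := scalar_surjective i
    obtain ⟨h, hh, rfl⟩ := (mem_frameHyperovals_iff O).mp hO
    exact ⟨.inr (.inl (i, ⟨h, hh⟩)), rfl⟩
  · obtain ⟨e, rfl⟩ := elation_surjective M
    exact ⟨.inr (.inr e), rfl⟩

/-- The number of a label. -/
def labelNum : Label → ℕ
  | .inl i => i
  | .inr (.inl (i, h)) => 3 + (56 * i + h)
  | .inr (.inr e) => 171 + e

/-- The vertex in coordinates that corresponds to a label. -/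
def labelVertex (x : Label) : W := vert (entry 9 soicherTable (labelNum x))

theorem exists_labelNum_eq {m : ℕ} (hm : m < 486) : ∃ x : Label, labelNum x = m := by
  by_cases h3 : m < 3
  · exact ⟨.inl ⟨m, h3⟩, rfl⟩
  by_cases h171 : m < 171
  · refine ⟨.inr (.inl (⟨(m - 3) / 56, by omega⟩, ⟨(m - 3) % 56, by omega⟩)), ?_⟩
    change 3 + (56 * ((m - 3) / 56) + (m - 3) % 56) = m
    omega
  · refine ⟨.inr (.inr ⟨m - 171, by omega⟩), ?_⟩
    change 171 + (m - 171) = m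
    omega

theorem labelVertex_bijective : Function.Bijective labelVertex := by
  rw [Nat.bijective_iff_surjective_and_card]
  constructor
  · intro p
    have h := allBelow_iff.mp exists_soicherTable_eq _ (vnum_lt p)
    rw [Bool.not_eq_true', Bool.eq_false_iff, ne_eq, allBelow_iff] at h
    push Not at h
    obtain ⟨m, hm, h⟩ := h
    obtain ⟨x, rfl⟩ := exists_labelNum_eq hm
    refine ⟨x, ?_⟩
    simp only [ne_eq, Bool.not_eq_true, Bool.not_eq_false', Nat.beq_eq] at h
    rw [labelVertex, h, vert_vnum]
  · rw [Nat.card_congr vertEquiv.symm]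
    simp [Nat.card_eq_fintype_card]

/-- The edges of the second Soicher graph in coordinates. -/
theorem colGraph_labelVertex_adj (x y : Label) :
    (colGraph col col_symm 12).Adj (labelVertex x) (labelVertex y) ↔
      edgeN (labelNum x) (labelNum y) = true := by
  have h : ∀ c < 9, (c ≠ 0 ∧ Nat.testBit 12 c = true) ↔ c / 2 = 1 := by decide
  have h1 : (colGraph col col_symm 12).Adj (labelVertex x) (labelVertex y) ↔
      _ ∧ Nat.testBit 12 (col (labelVertex x) (labelVertex y)) = true := Iff.rfl
  rw [h1, ne_eq, ← col_eq_zero_iff, ← ne_eq, h _ (col_lt _ _), edgeN, Nat.beq_eq, labelVertex,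
    labelVertex, col_vert]
  rfl

theorem edgeN_comm (x y : Label) :
    edgeN (labelNum x) (labelNum y) = edgeN (labelNum y) (labelNum x) := by
  rw [Bool.eq_iff_iff, ← colGraph_labelVertex_adj, ← colGraph_labelVertex_adj,
    SimpleGraph.adj_comm]

theorem soicherRel_hyperoval_elation (i : Fin 3) (h : Fin 56) (e : Fin 315) :
    soicherRel (.hyperoval (hyperovalSet h) (scalar i)) (.elation (elation e)) ↔
      fixN (i + 1) h e = true := by
  have key : ∀ n : ℕ, fvec n + felt (i + 1) • ((elation e).1 *ᵥ fvec n) =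
      fvec (n ^^^ smulN (mulN (i + 1) (dotF (elForm e) n)) (ptCode (elPt e))) := by
    intro n
    rw [fvec_xor, fvec_smulN, felt_mulN, felt_dotF, mul_smul]
    change _ + _ • (Matrix.vecMulVec _ _ *ᵥ _) = _
    rw [Matrix.vecMulVec_mulVec, op_smul_eq_smul]
  have hlt : ∀ k n c, ptCode k ^^^ smulN c n < 64 := fun k n c =>
    Nat.xor_lt_two_pow (n := 6) (ptCode_lt k) (smulN_lt _ _)
  have h1 : soicherRel (.hyperoval (hyperovalSet h) (scalar i)) (.elation (elation e)) ↔
      ∀ k : Fin 21, bit (hypMask h) k = true → fvec (ptCode k) +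
        felt (i + 1) • ((elation e).1 *ᵥ fvec (ptCode k)) ∈ coneOver (ofMask (hypMask h)) := by
    change (∀ v ∈ coneOver (ofMask (hypMask h)), v + felt (i + 1) • ((elation e).1 *ᵥ v) ∈
      coneOver (ofMask (hypMask h))) ↔ _
    constructor
    · exact fun hv k hk => hv _ ⟨fvec_ptCode_ne_zero k, (pt_mem_ofMask _ k).mpr hk⟩
    · intro hk v hv
      obtain ⟨n, hn, rfl⟩ := exists_fvec v
      rw [fvec_mem_coneOver _ hn] at hv
      obtain ⟨hlt, c, hc, hc0, hnc⟩ := exists_eq_smulN n hn hv.1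
      have h2 := smul_mem_coneOver (hk ⟨ptIdx n, hlt⟩ hv.2)
        ((felt_eq_zero_iff hc).not.mpr hc0)
      rw [smul_add, smul_comm, ← Matrix.mulVec_smul, ← fvec_smulN] at h2
      change fvec (smulN c (ptCode (ptIdx n))) + _ • (_ *ᵥ fvec (smulN c (ptCode (ptIdx n)))) ∈ _ at h2
      rwa [← hnc] at h2
  rw [h1, fixN, allBelow_iff]
  have h2 : ∀ k, fvec (ptCode k) + felt (i + 1) • ((elation e).1 *ᵥ fvec (ptCode k)) ∈
      coneOver (ofMask (hypMask h)) ↔ ((fun n => !Nat.beq n 0 && bit (hypMask h) (ptIdx n))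
        (Nat.xor (ptCode k) (smulN (mulN (i + 1) (dotF (elForm e) (ptCode k)))
          (ptCode (elPt e))))) = true := by
    intro k
    rw [key, fvec_mem_coneOver _ (hlt _ _ _), Bool.and_eq_true, Bool.not_eq_true',
      Bool.eq_false_iff, ne_eq, ne_eq, Nat.beq_eq]
    rfl
  simp only [h2, Bool.or_eq_true, Bool.not_eq_true', ← Bool.not_eq_true, ← imp_iff_not_or]
  exact ⟨fun h k hk => h ⟨k, hk⟩, fun h k => h k k.2⟩

theorem soicherRel_elation (e e' : Fin 315) :
    soicherRel (.elation (elation e)) (.elation (elation e')) ↔ elRelN e e' = true := by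
  refine (exists_elation_iff (fvec_elPt_ne_zero e) (fvec_elForm_ne_zero e) (elForm_dotProduct e)
    (fvec_elPt_ne_zero e') (fvec_elForm_ne_zero e')).trans ?_
  rw [← felt_dotF, ← fvec_crossN, ← fvec_smulN, ne_eq, felt_eq_zero_iff (dotF_lt _ _), elRelN,
    Bool.and_eq_true, Bool.not_eq_true', Bool.eq_false_iff, ne_eq, Nat.beq_eq, Nat.beq_eq]
  exact and_congr_right fun _ =>
    ⟨fvec_injOn (elForm_lt _) (smulN_lt _ _), fun h => congrArg fvec h⟩

/-- Makes the inequality of vertices in `SimpleGraph.fromRel` automatic. -/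
theorem soicherRel_irrefl (a : SoicherVertex) : ¬ soicherRel a a := by
  obtain ⟨i | ⟨i, h⟩ | e, rfl⟩ := soicherVertex_surjective a
  · exact id
  · intro hh
    have h0 : ofMask (hypMask h) = ∅ := disjoint_self.mp hh.2
    have h6 := (isHyperoval_ofMask h.2).1
    rw [h0, Set.ncard_empty] at h6
    exact absurd h6 (by norm_num)
  · intro hh
    exact ((exists_elation_iff (fvec_elPt_ne_zero e) (fvec_elForm_ne_zero e) (elForm_dotProduct e)
      (fvec_elPt_ne_zero e) (fvec_elForm_ne_zero e)).mp hh).1 (elForm_dotProduct e)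

theorem secondSoicherGraph_adj (a b : SoicherVertex) :
    secondSoicherGraph.Adj a b ↔ soicherRel a b ∨ soicherRel b a := by
  rw [secondSoicherGraph, SimpleGraph.fromRel_adj]
  refine and_iff_right_of_imp fun h => ?_
  rintro rfl
  exact soicherRel_irrefl a (or_self_iff.mp h)

theorem elForm_index : ∀ e < 315, ∀ j < 15, elForm (15 * elPt e + j) = elForm e →
    15 * elPt e + j = e := by
  decide +kernel

theorem edgeN_of_elRelN {e e' : ℕ} (he : e < 315) (he' : e' < 315) (h : elRelN e e' = true) :
    edgeN (171 + e) (171 + e') = true := by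
  obtain ⟨hk, hf, hd⟩ := elTable_spec e' he'
  obtain ⟨j, hj, h1, h2⟩ := exists_elation_index _ hk _ (elForm_lt e') hf hd
  have h3 := allBelow_iff.mp edgeN_elation_of_elRelN e he
  rw [allBelow_iff] at h3
  have h4 := h3 _ hk
  rw [elRelN, Bool.and_eq_true, Bool.not_eq_true'] at h
  rw [Bool.or_eq_true, allBelow_iff] at h4
  have h5 := (h4.resolve_left (by rw [h.1]; exact Bool.false_ne_true)) j hj
  have hj' : Nat.add (Nat.mul 15 (elPt e')) j = e' := elForm_index e' he' j hj h2
  rw [Bool.or_eq_true, Bool.not_eq_true', hj', h.2] at h5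
  exact h5.resolve_left Bool.noConfusion

theorem edgeN_elation_iff {e e' : Fin 315} (he : e'.val < e.val) :
    edgeN (labelNum (.inr (.inr e))) (labelNum (.inr (.inr e'))) = true ↔
      elRelN e e' = true ∨ elRelN e' e = true := by
  have hnum : ∀ e : Fin 315, labelNum (.inr (.inr e)) = 171 + e.val := fun _ => rfl
  constructor
  · rw [hnum, hnum]
    intro h
    have h1 := allBelow_iff.mp elRelN_of_edgeN_elation e e.2
    rw [Bool.and_eq_true, allBelow_iff] at h1
    have h2 := h1.2 e' he
    rw [Bool.or_eq_true, Bool.or_eq_true, Bool.not_eq_true'] at h2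
    have h3 : edgeN (Nat.add 171 e) (Nat.add 171 e') = true := h
    rw [h3] at h2
    exact h2.imp_left fun h3 => h3.resolve_left Bool.noConfusion
  · rintro (h | h)
    · rw [hnum, hnum]
      exact edgeN_of_elRelN e.2 e'.2 h
    · rw [edgeN_comm, hnum, hnum]
      exact edgeN_of_elRelN e'.2 e.2 h

theorem soicherVertex_adj_special_special (i j : Fin 3) :
    secondSoicherGraph.Adj (soicherVertex (.inl i)) (soicherVertex (.inl j)) ↔
      edgeN (labelNum (.inl i)) (labelNum (.inl j)) = true := by
  have hs := allBelow_iff.mp edgeN_special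
  simp only [Bool.and_eq_true, allBelow_iff, Bool.not_eq_true'] at hs
  have h1 : edgeN (labelNum (.inl i)) (labelNum (.inl j)) = false := (hs i i.2).1.1 j j.2
  rw [secondSoicherGraph_adj, h1]
  exact iff_of_false (fun h => h.elim id id) Bool.noConfusion

theorem soicherVertex_adj_special_hyperoval (i j : Fin 3) (h : Fin 56) :
    secondSoicherGraph.Adj (soicherVertex (.inl i)) (soicherVertex (.inr (.inl (j, h)))) ↔
      edgeN (labelNum (.inl i)) (labelNum (.inr (.inl (j, h)))) = true := by
  have hs := allBelow_iff.mp edgeN_special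
  simp only [Bool.and_eq_true, allBelow_iff, beq_iff_eq] at hs
  have h1 : edgeN (labelNum (.inl i)) (labelNum (.inr (.inl (j, h)))) = Nat.beq i j :=
    (hs i i.2).1.2 j j.2 h h.2
  rw [secondSoicherGraph_adj, h1, Nat.beq_eq, Fin.val_inj]
  exact (or_iff_left id).trans scalar_injective.eq_iff

theorem soicherVertex_adj_special_elation (i : Fin 3) (e : Fin 315) :
    secondSoicherGraph.Adj (soicherVertex (.inl i)) (soicherVertex (.inr (.inr e))) ↔
      edgeN (labelNum (.inl i)) (labelNum (.inr (.inr e))) = true := by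
  have hs := allBelow_iff.mp edgeN_special
  simp only [Bool.and_eq_true, allBelow_iff, Bool.not_eq_true'] at hs
  have h1 : edgeN (labelNum (.inl i)) (labelNum (.inr (.inr e))) = false := (hs i i.2).2 e e.2
  rw [secondSoicherGraph_adj, h1]
  exact iff_of_false (fun h => h.elim id id) Bool.noConfusion

theorem soicherVertex_adj_hyperoval_hyperoval (i j : Fin 3) (h h' : Fin 56) :
    secondSoicherGraph.Adj (soicherVertex (.inr (.inl (i, h))))
      (soicherVertex (.inr (.inl (j, h')))) ↔
      edgeN (labelNum (.inr (.inl (i, h)))) (labelNum (.inr (.inl (j, h')))) = true := by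
  have h1 := edgeN_hyperoval
  simp only [allBelow_iff, beq_iff_eq] at h1
  have h2 : edgeN (labelNum (.inr (.inl (i, h)))) (labelNum (.inr (.inl (j, h')))) =
      (Nat.beq i j && disjN h h') := h1 i i.2 h h.2 j j.2 h' h'.2
  have h3 : ∀ (i j : Fin 3) (h h' : Fin 56),
      soicherRel (soicherVertex (.inr (.inl (i, h)))) (soicherVertex (.inr (.inl (j, h')))) ↔
      i = j ∧ Disjoint (ofMask (hypMask h)) (ofMask (hypMask h')) :=
    fun i j h h' => and_congr scalar_injective.eq_iff Iff.rfl
  rw [secondSoicherGraph_adj, h2, Bool.and_eq_true, Nat.beq_eq, Fin.val_inj, h3, h3, disjN,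
    ← disjoint_ofMask_iff, disjoint_comm (a := ofMask (hypMask h')), eq_comm (a := j), or_self]

theorem soicherVertex_adj_hyperoval_elation (i : Fin 3) (h : Fin 56) (e : Fin 315) :
    secondSoicherGraph.Adj (soicherVertex (.inr (.inl (i, h)))) (soicherVertex (.inr (.inr e))) ↔
      edgeN (labelNum (.inr (.inl (i, h)))) (labelNum (.inr (.inr e))) = true := by
  have h1 := edgeN_hyperoval_elation
  simp only [allBelow_iff, beq_iff_eq] at h1
  have h2 : edgeN (labelNum (.inr (.inl (i, h)))) (labelNum (.inr (.inr e))) = fixN (i + 1) h e :=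
    h1 i i.2 h h.2 e e.2
  rw [secondSoicherGraph_adj, h2, ← soicherRel_hyperoval_elation]
  exact or_iff_left id

theorem soicherVertex_adj_elation_elation (e e' : Fin 315) :
    secondSoicherGraph.Adj (soicherVertex (.inr (.inr e))) (soicherVertex (.inr (.inr e'))) ↔
      edgeN (labelNum (.inr (.inr e))) (labelNum (.inr (.inr e'))) = true := by
  have h1 : ∀ e e' : Fin 315, e'.val < e.val →
      (secondSoicherGraph.Adj (soicherVertex (.inr (.inr e))) (soicherVertex (.inr (.inr e'))) ↔
      edgeN (labelNum (.inr (.inr e))) (labelNum (.inr (.inr e'))) = true) := by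
    intro e e' he
    rw [secondSoicherGraph_adj]
    exact (or_congr (soicherRel_elation e e') (soicherRel_elation e' e)).trans
      (edgeN_elation_iff he).symm
  rcases lt_trichotomy e.val e'.val with he | he | he
  · rw [SimpleGraph.adj_comm, edgeN_comm, h1 e' e he]
  · obtain rfl := Fin.ext he
    have h2 := allBelow_iff.mp elRelN_of_edgeN_elation e e.2
    rw [Bool.and_eq_true, Bool.not_eq_true'] at h2
    exact iff_of_false (SimpleGraph.irrefl _) (Bool.eq_false_iff.mp h2.1)
  · exact h1 e e' he

theorem soicherVertex_adj (x y : Label) :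
    secondSoicherGraph.Adj (soicherVertex x) (soicherVertex y) ↔
      edgeN (labelNum x) (labelNum y) = true := by
  rcases x with i | ⟨i, h⟩ | e <;> rcases y with j | ⟨j, h'⟩ | e'
  · exact soicherVertex_adj_special_special i j
  · exact soicherVertex_adj_special_hyperoval i j h'
  · exact soicherVertex_adj_special_elation i e'
  · rw [SimpleGraph.adj_comm, edgeN_comm, soicherVertex_adj_special_hyperoval]
  · exact soicherVertex_adj_hyperoval_hyperoval i j h h'
  · exact soicherVertex_adj_hyperoval_elation i h e'
  · rw [SimpleGraph.adj_comm, edgeN_comm, soicherVertex_adj_special_elation]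
  · rw [SimpleGraph.adj_comm, edgeN_comm, soicherVertex_adj_hyperoval_elation]
  · exact soicherVertex_adj_elation_elation e e'

/-- Different vertices have different neighbourhoods. -/
theorem eq_of_adj_iff {p q : W}
    (h : ∀ r, (colGraph col col_symm 12).Adj p r ↔ (colGraph col col_symm 12).Adj q r) : p = q := by
  by_contra hpq
  -- A non-zero intersection number provides a vertex adjacent to `p` but not to `q`.
  have hk : ∀ k < 9, k ≠ 0 → ∃ i < 9, ∃ j < 9, (i ≠ 0 ∧ Nat.testBit 12 i = true) ∧
      Nat.testBit 12 j = false ∧ interNum i j k ≠ 0 := by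
    decide +kernel
  obtain ⟨i, hi, j, hj, hi', hj', hn⟩ := hk _ (col_lt p q) ((col_eq_zero_iff p q).not.mpr hpq)
  rw [← isScheme.ncard_eq p q i hi j hj] at hn
  obtain ⟨z, hz1, hz2⟩ := Set.nonempty_of_ncard_ne_zero hn
  have hpz : (colGraph col col_symm 12).Adj p z :=
    ⟨(col_eq_zero_iff p z).not.mp (hz1 ▸ hi'.1), hz1 ▸ hi'.2⟩
  have hqz := ((h z).mp hpz).2
  rw [col_symm, hz2, hj'] at hqz
  exact Bool.noConfusion hqz

/-- The enumeration `soicherVertex` is known only to be surjective. It is injective because labels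
of the same vertex have the same neighbours in coordinates, where neighbourhoods determine vertices.
-/
theorem nonempty_iso_secondSoicherGraph :
    Nonempty (colGraph col col_symm 12 ≃g secondSoicherGraph) := by
  have hinj : Function.Injective soicherVertex := by
    intro x y hxy
    refine labelVertex_bijective.1 (eq_of_adj_iff fun r => ?_)
    obtain ⟨z, rfl⟩ := labelVertex_bijective.2 r
    rw [colGraph_labelVertex_adj, colGraph_labelVertex_adj, ← soicherVertex_adj,
      ← soicherVertex_adj, hxy]
  refine ⟨⟨(Equiv.ofBijective _ labelVertex_bijective).symm.trans
    (Equiv.ofBijective _ ⟨hinj, soicherVertex_surjective⟩), ?_⟩⟩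
  intro p q
  obtain ⟨x, rfl⟩ := (Equiv.ofBijective _ labelVertex_bijective).surjective p
  obtain ⟨y, rfl⟩ := (Equiv.ofBijective _ labelVertex_bijective).surjective q
  simp only [Equiv.trans_apply, Equiv.symm_apply_apply]
  exact (soicherVertex_adj x y).trans (colGraph_labelVertex_adj x y).symm

end KoolenRiebeek

/-! ### The theorem for Δ itself -/

theorem mainTheorem1 :
    (∀ B ∈ krBlocks, B.ncard = 45 ∧ golayCosetGraph.IsIndepSet B) ∧
    Nat.card KRVertex = 486 ∧
    ∃ H : Subgroup (Equiv.Perm KRVertex),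
      HasForm35TwoM10 H ∧
      MulAction.IsPretransitive H KRVertex ∧
      permRank H = 9 ∧
      (∀ v : KRVertex, suborbitLengths H v = {1, 2, 20, 36, 40, 45, 72, 90, 180}) ∧
      autGroup koolenRiebeekGraph = H ∧
      ∃ bip mult soi net : SimpleGraph KRVertex,
        Nonempty (bip ≃g completeBipartiteGraph (Fin 243) (Fin 243)) ∧
        Nonempty (mult ≃g SimpleGraph.completeEquipartiteGraph 162 3) ∧
        Nonempty (soi ≃g secondSoicherGraph) ∧
        (∀ p q : Fin 5 → ZMod 3, p ≠ q → Nonempty (net ≃g affineNetGraph p q)) ∧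
        HasIntersectionArray (⊤ : SimpleGraph KRVertex) [485] [1] ∧
        HasIntersectionArray bip [243, 242] [1, 243] ∧
        HasIntersectionArray mult [483, 2] [1, 483] ∧
        HasIntersectionArray koolenRiebeekGraph [45, 44, 36, 5] [1, 9, 40, 45] ∧
        HasIntersectionArray soi [56, 45, 16, 1] [1, 8, 45, 56] ∧
        HasIntersectionArray net [81, 80, 54, 1] [1, 27, 80, 81] ∧
        (∀ X : SimpleGraph KRVertex, (IsDistanceRegular X ∧ IsUnionOfOrbitals H X) ↔
          X ∈ ({⊤, bip, mult, koolenRiebeekGraph, soi, net} : Set (SimpleGraph KRVertex))) := by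
  have h := KoolenRiebeek.krIsScheme
  have : Nonempty KRVertex := ⟨KoolenRiebeek.vertexEquiv.symm (.inl 0)⟩
  obtain ⟨ebip⟩ := KoolenRiebeek.nonempty_iso_completeBipartiteGraph
  obtain ⟨emult⟩ := KoolenRiebeek.nonempty_iso_completeEquipartiteGraph
  obtain ⟨esoi⟩ := KoolenRiebeek.nonempty_iso_secondSoicherGraph
  refine ⟨fun B hB => ⟨KoolenRiebeek.ncard_of_mem_krBlocks hB,
      KoolenRiebeek.isIndepSet_of_mem_krBlocks hB⟩,
    KoolenRiebeek.card_krVertex, autGroup koolenRiebeekGraph,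
    KoolenRiebeek.HasForm35TwoM10.of_mulEquiv KoolenRiebeek.autEquiv.symm
      KoolenRiebeek.hasForm_bigGroup,
    h.isPretransitive, h.permRank_eq, fun v => KoolenRiebeek.suborbitLengths_eq_list h v, rfl,
    KoolenRiebeek.colGraph KoolenRiebeek.krCol h.symm 232,
    KoolenRiebeek.colGraph KoolenRiebeek.krCol h.symm 508,
    KoolenRiebeek.colGraph KoolenRiebeek.krCol h.symm 12,
    KoolenRiebeek.colGraph KoolenRiebeek.krCol h.symm 40,
    ⟨(KoolenRiebeek.colGraphIso 232).trans ebip⟩, ⟨(KoolenRiebeek.colGraphIso 508).trans emult⟩,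
    ⟨(KoolenRiebeek.colGraphIso 12).trans esoi⟩,
    fun p q hpq => (KoolenRiebeek.nonempty_iso_affineNetGraph hpq).map
      (KoolenRiebeek.colGraphIso 40).trans,
    ?_, KoolenRiebeek.hasIntersectionArray_bip h, KoolenRiebeek.hasIntersectionArray_mult h, ?_,
    KoolenRiebeek.hasIntersectionArray_soi h, KoolenRiebeek.hasIntersectionArray_net h,
    fun X => ?_⟩
  · rw [← KoolenRiebeek.colGraph_eq_top h]
    exact KoolenRiebeek.hasIntersectionArray_top h
  · rw [KoolenRiebeek.koolenRiebeekGraph_eq]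
    exact KoolenRiebeek.hasIntersectionArray_kr h
  · have hkr : KoolenRiebeek.colGraph KoolenRiebeek.krCol h.symm 32 = koolenRiebeekGraph :=
      KoolenRiebeek.koolenRiebeekGraph_eq.symm
    rw [KoolenRiebeek.isDistanceRegular_and_isUnionOfOrbitals_iff h X,
      KoolenRiebeek.colGraph_eq_top h, hkr]
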